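/- **Setting.** Jobs with processing times $p_1,\dots,p_n>0$ arrive one by one and have to be assigned, on arrival and irrevocably, to one of $m\ge 1$ identical machines. An algorithm for *makespan minimization with parallel schedules* (MPS) maintains several schedules in parallel, assigns every job in each of them, and finally outputs a schedule of smallest makespan. It is $\rho$-competitive if on every job sequence $\sigma$ the output has makespan at most $\rho\cdot\mathrm{OPT}(\sigma)$, where $\mathrm{OPT}(\sigma)$ is the optimum offline makespan. An algorithm for $\mathrm{MPS}_{\rm opt}$ is a finite family $\{A_k\}_{k\in K}$ of scheduling rules that get a value $\gamma$ (ideally $\gamma=\mathrm{OPT}(\sigma)$) in advance; below, such rules divide all processing times by $\gamma$. Ties and "any/arbitrary" choices may be resolved in any way. **$A_1(\varepsilon)$.** Let $\varepsilon'=\varepsilon/2$, $l=\lceil\log(1/\varepsilon')/\log(1+\varepsilon')\rceil$, $I_i=((1+\varepsilon')^{i-1}\varepsilon',(1+\varepsilon')^i\varepsilon']$ for $1\le i\le l$. There is one rule for every $v\in\{0,\dots,\lfloor m/\varepsilon'\rfloor\}^l$. It fixes a schedule of minimum makespan for $v_i$ jobs of size $(1+\varepsilon')^i\varepsilon'$,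 $1\le i\le l$, with $n_i^*(j)$ jobs of the $i$-th size on machine $j$, and lets $\ell^*(j)=\sum_i n_i^*(j)(1+\varepsilon')^i\varepsilon'$. A job of size in $I_i$ goes to a machine $j$ that so far has fewer than $n_i^*(j)$ jobs of sizes in $I_i$, and to an arbitrary machine if there is none. A job of size at most $\varepsilon'$ goes to a machine minimizing $\ell^*(j)$ plus the current load of jobs of size at most $\varepsilon'$ on $j$. **$A_2(\varepsilon)$.** Let $\varepsilon'=\varepsilon/8$, $\lambda=\lceil\log_2(\frac38+\frac1{48\varepsilon'})\rceil$, $l=\lambda+2$, and for $1\le i\le l$ let $a_i=\max\{\frac13-2\varepsilon'+(\frac1{12}+\frac32\varepsilon')2^{-(\lambda+1-i)},\frac13+2\varepsilon'\}$, $b_i=\frac13-2\varepsilon'+(\frac1{12}+\frac32\varepsilon')2^{-(\lambda-i)}$, $I_i=(a_i,b_i]$, and $I_{l+i}=(2a_i,2b_i]$ for $1\le i\le l-1$. Jobs of size at most $\frac13+2\varepsilon'$ are small, the others large; a class-$i$ job has size in $I_i$. Let $\mu=\lceil\frac{1+\varepsilon'}{1+2\varepsilon'}m\rceil$, let $\mathcal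 M_c$ be the set of the first $\mu$ machines and $\mathcal M_r$ the set of the others, $\kappa=\lceil2(2+1/\varepsilon')(2l-1)\rceil$ and $m_0=\lfloor(m-\mu)/(2l-1)\rfloor$. For $u\in\{0,\dots,\kappa\}^{2l-1}$, the configuration $c(u)$ is the vector consisting of $u_1m_0$ entries $1$, then $u_2m_0$ entries $2$, …, then $u_{2l-1}m_0$ entries $2l-1$, truncated, or extended by zeros, to length $\mu$. There is one rule $A_c$ for every vector $c$ of the form $c(u)$. Machine $j\in\mathcal M_c$ is a class-$c_j$ machine. If $c_j=0$, put $\ell^-(j)=\ell^+(j)=0$; if $1\le c_j\le l$, put $\ell^-(j)=2a_{c_j}$, $\ell^+(j)=2b_{c_j}$; if $c_j=l+i'$ with $i'\ge 1$, put $\ell^-(j)=2a_{i'}$, $\ell^+(j)=2b_{i'}$. A class-$i$ machine, $i\ge1$, is admissible while it has fewer than two (if $i\le l$), respectively no (if $i>l$), class-$i$ jobs. Let $\ell(j)$ be the current load of machine $j$ and $\ell_s(j)$ its load due to small jobs. A class-$i$ job of size $p$ goes to an admissible class-$i$ machine of $\mathcal M_c$ if there is one; otherwise to a machine $j\in\mathcal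 M_r$ of largest $\ell(j)$ among those with $\ell(j)+p\le\frac43+\varepsilon$ if there is one; otherwise to an arbitrary machine of $\mathcal M_r$. A small job of size $p$ goes to any $j\in\mathcal M_c$ with $\ell_s(j)>0$ and $\ell^+(j)+\ell_s(j)+p\le\frac43+\varepsilon$ if there is one; otherwise to a $j\in\mathcal M_c$ of smallest $\ell^-(j)$ among those with $\ell_s(j)=0$ and $\ell^+(j)+p\le\frac43+\varepsilon$ if there is one; otherwise to an arbitrary machine of $\mathcal M_c$. **$A_3(\varepsilon)$** is $A_1(1/3)$ if $m<2l/(\varepsilon')^2$, with $l,\varepsilon'$ as in $A_2(\varepsilon)$, and $A_2(\varepsilon)$ otherwise. **$A^*(\varepsilon)$.** Given $\{A_k\}_{k\in K}$ for $\mathrm{MPS}_{\rm opt}$ with competitive ratio $\rho$, let $\delta=\varepsilon/(3\rho)$ and $h=\lceil\log(1+6\rho/\varepsilon)/\log(1+\delta)\rceil$. The algorithm keeps guesses $\gamma_1<\dots<\gamma_h$, initially $\gamma_i=p_1(1+\delta)^{i-1}$, and for every guess $\gamma_i$ and every $k\in K$ a schedule $S_{ik}$. When job $t$ arrives, $A_k$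 using $\gamma_i$ *fails* if it does not specify a machine, or if the load of the specified machine would exceed $\rho\gamma_i$, or if $\gamma_i<p_t$, or if $\gamma_i$ is smaller than $1/m$ times the total processing time of the jobs up to and including $t$; here, and in all decisions of $A_k$, jobs before the one at which $\gamma_i$ was last adjusted are ignored. If $A_k$ using $\gamma_i$ fails, or has failed since the last adjustment of $\gamma_i$, the job goes to a least loaded machine of $S_{ik}$ (with or without ignoring those old jobs: the result holds in both cases); otherwise it goes to the machine specified by $A_k$. If afterwards there is an $i$ such that all $A_k$ using $\gamma_i$ have failed since its last adjustment, let $i^*$ be the largest such $i$; then $\gamma_i$ is adjusted to $(1+\delta)^i\max\{\gamma_h,p_t,\sum_{t'\le t}p_{t'}/m\}$ (old $\gamma_h$) for $i=1,\dots,i^*$, in the corresponding schedules the machines are renumbered so that job $t$ lies where $A_k$ using the new guess would put it as a first job, and guesses (with their schedules) are renumbered increasingly. **Corollary.** For $0<\varepsilon\le1$ let $A_3^*(\varepsilon)$ be the algorithm for MPS obtained by executing $A_3(\varepsilon/2)$, with $\rho=\frac43+\frac\varepsilon2$, in $A^*(\varepsilon/2)$. Then, for every $m\ge1$, $A_3^*(\varepsilon)$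 is $(\frac43+\varepsilon)$-competitive. Moreover it uses at most $1/\varepsilon^{O(\log(1/\varepsilon))}$ schedules, a bound independent of $n$ and $m$: there are absolute constants $C,K>0$ such that for all $0<\varepsilon\le1$ and all $m\ge1$ the number of schedules is at most $K\,(1/\varepsilon)^{C\log(1/\varepsilon)}$. -/

import Mathlib

noncomputable section

open scoped Classical

namespace MPS

/-! ### Schedules, makespan, online algorithms with parallel schedules -/

/-- A (partial) schedule on `m` machines: the jobs in order of arrival, each given by its processing
time and the machine it is assigned to. -/
abbrev Schedule (m : ℕ) : Type := List (ℝ × Fin m)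

/-- The load of machine `j`: total processing time of the jobs assigned to it. -/
def load {m : ℕ} (S : Schedule m) (j : Fin m) : ℝ :=
  ((S.filter fun x => x.2 = j).map Prod.fst).sum

/-- The load of machine `j` caused by the jobs whose processing time satisfies `P`. -/
def loadOf {m : ℕ} (P : ℝ → Prop) (S : Schedule m) (j : Fin m) : ℝ :=
  load (S.filter fun x => P x.1) j

/-- The number of jobs on machine `j` whose processing time satisfies `P`. -/
def countOf {m : ℕ} (P : ℝ → Prop) (S : Schedule m) (j : Fin m) : ℕ :=
  (S.filter fun x => P x.1 ∧ x.2 = j).length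

/-- The total processing time of all jobs of the schedule. -/
def volume {m : ℕ} (S : Schedule m) : ℝ := (S.map Prod.fst).sum

/-- The makespan: the maximum load of a machine (used for `m ≥ 1` only). -/
def makespan {m : ℕ} (S : Schedule m) : ℝ := ⨆ j : Fin m, load S j

/-- The optimum makespan of the job sequence `σ` on `m` machines: the minimum makespan over the
finitely many assignments of jobs to machines (used for `m ≥ 1` only). -/
def opt (m : ℕ) (σ : List ℝ) : ℝ :=
  ⨅ f : Fin σ.length → Fin m, makespan (List.ofFn fun t => (σ.get t, f t))

/-- An online algorithm for makespan minimization with parallel schedules on `m` machines. It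
maintains one schedule for every `k : Index`; in schedule `k`, a job of processing time `p` that
arrives after the jobs `past` is assigned to machine `assign k past p`. -/
structure Algorithm (m : ℕ) where
  /-- the names of the parallel schedules -/
  Index : Type
  finite_index : Finite Index
  /-- the online assignment rule -/
  assign : Index → List ℝ → ℝ → Fin m

/-- The number of parallel schedules used by the algorithm. -/
def Algorithm.numSchedules {m : ℕ} (A : Algorithm m) : ℕ := Nat.card A.Index

/-- The schedule with name `k` after the whole sequence `σ` has been processed. -/
def Algorithm.schedule {m : ℕ} (A : Algorithm m) (k : A.Index) (σ : List ℝ) : Schedule m :=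
  List.ofFn fun t : Fin σ.length => (σ.get t, A.assign k (σ.take t) (σ.get t))

/-- `ρ`-competitiveness: on every sequence of jobs with positive processing times, the schedule of
smallest makespan, which is the output, has makespan at most `ρ` times the optimum. -/
def Algorithm.IsCompetitive {m : ℕ} (A : Algorithm m) (ρ : ℝ) : Prop :=
  ∀ σ : List ℝ, (∀ p ∈ σ, 0 < p) →
    ∃ k : A.Index,
      (∀ k' : A.Index, makespan (A.schedule k σ) ≤ makespan (A.schedule k' σ)) ∧
      makespan (A.schedule k σ) ≤ ρ * opt m σ

/-- An algorithm for the variant where a value `γ` (the optimum makespan, or a guess on it) is given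
in advance: a finite family of independent scheduling rules. Given `γ`, the current schedule `S_k`
and the processing time of the next job, rule `k` names a machine, or `none` if the rule does not
specify a machine. -/
structure OptAlgorithm (m : ℕ) where
  /-- the names of the parallel schedules -/
  Index : Type
  finite_index : Finite Index
  /-- the assignment rules -/
  rule : Index → ℝ → Schedule m → ℝ → Option (Fin m)

/-! ### Arbitrary choices -/

/-- A way to resolve "choose an arbitrary machine among ...". The choice may depend on any
information of type `α`. -/
structure TieBreak (m : ℕ) (α : Type) where
  /-- the machine that is chosen -/
  pick : α → Finset (Fin m) → Fin m
  pick_mem : ∀ a T, T.Nonempty → pick a T ∈ T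

/-- Choose from the first nonempty set of the list; `none` if all of them are empty. -/
def TieBreak.first {m : ℕ} {α : Type} (τ : TieBreak m α) (a : α) (L : List (Finset (Fin m))) :
    Option (Fin m) :=
  (L.find? fun T => T.Nonempty).map (τ.pick a)

/-- The elements of `T` at which `f` is smallest. -/
def argminOn {m : ℕ} (T : Finset (Fin m)) (f : Fin m → ℝ) : Finset (Fin m) :=
  T.filter fun j => ∀ j' ∈ T, f j ≤ f j'

/-- The elements of `T` at which `f` is largest. -/
def argmaxOn {m : ℕ} (T : Finset (Fin m)) (f : Fin m → ℝ) : Finset (Fin m) :=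
  T.filter fun j => ∀ j' ∈ T, f j' ≤ f j

/-- Divide all processing times by `γ`, so that the (guessed) optimum makespan becomes `1`. -/
def normalize {m : ℕ} (γ : ℝ) (S : Schedule m) : Schedule m := S.map fun x => (x.1 / γ, x.2)

/-! ### The algorithm `A₁(ε)` (known optimum) -/

namespace A1

/-- `ε' = ε / 2` -/
def eps' (ε : ℝ) : ℝ := ε / 2

/-- `l`, the number of classes of large jobs -/
def l (ε : ℝ) : ℕ := ⌈Real.log (1 / eps' ε) / Real.log (1 + eps' ε)⌉₊

/-- The vectors `v`, with entries in `{0, …, ⌊m / ε'⌋}`. -/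
abbrev V (m : ℕ) (ε : ℝ) : Type := Fin (l ε) → Fin (⌊(m : ℝ) / eps' ε⌋₊ + 1)

/-- The largest processing time of each class. The class with 1-based number `i + 1` is
represented by `i : Fin l`. -/
def size (ε : ℝ) (i : Fin (l ε)) : ℝ := (1 + eps' ε) ^ ((i : ℕ) + 1) * eps' ε

/-- `q` belongs to the class `i`. -/
def InClass (ε : ℝ) (i : Fin (l ε)) (q : ℝ) : Prop :=
  (1 + eps' ε) ^ (i : ℕ) * eps' ε < q ∧ q ≤ size ε i

/-- The load `ℓ*(j)` on machine `j` if `n i j` jobs of rounded size `size i` lie on it. -/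
def targetLoad {m : ℕ} (ε : ℝ) (n : Fin (l ε) → Fin m → ℕ) (j : Fin m) : ℝ :=
  ∑ i, (n i j : ℝ) * size ε i

/-- `n` describes a schedule of `v i` jobs of size `size i`, for every `i`. -/
def IsTarget {m : ℕ} {ε : ℝ} (v : V m ε) (n : Fin (l ε) → Fin m → ℕ) : Prop :=
  ∀ i, ∑ j, n i j = (v i : ℕ)

/-- `n` describes such a schedule of minimum makespan. -/
def IsOptimalTarget {m : ℕ} {ε : ℝ} (v : V m ε) (n : Fin (l ε) → Fin m → ℕ) : Prop :=
  IsTarget v n ∧ ∀ n', IsTarget v n' → (⨆ j, targetLoad ε n j) ≤ ⨆ j, targetLoad ε n' j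

/-- The free choices of the algorithm: an optimal schedule `S_v^*` for every `v`, given by the
numbers `n_i^*(j)`, and the choice among several possible machines. -/
structure Choices (m : ℕ) (ε : ℝ) where
  /-- the numbers `n_i^*(j)` -/
  target : V m ε → Fin (l ε) → Fin m → ℕ
  target_opt : ∀ v, IsOptimalTarget v (target v)
  /-- choice among several machines -/
  tie : TieBreak m (V m ε × ℝ × Schedule m × ℝ)

/-- The sets of machines, in order of preference, to which a job of size `q` may be assigned by
the rule for the target `n` in the schedule `S`, sizes being relative to the optimum makespan. -/
def preferences {m : ℕ} (ε : ℝ) (n : Fin (l ε) → Fin m → ℕ) (S : Schedule m) (q : ℝ) :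
    List (Finset (Fin m)) :=
  if q ≤ eps' ε then
    [argminOn Finset.univ fun j => targetLoad ε n j + loadOf (fun x => x ≤ eps' ε) S j]
  else if ∃ i, InClass ε i q then
    [Finset.univ.filter fun j => ∃ i, InClass ε i q ∧ countOf (InClass ε i) S j < n i j,
      Finset.univ]
  else []

end A1

/-- The algorithm `A₁(ε)` for known optimum makespan. -/
def A1 (m : ℕ) (ε : ℝ) (ch : A1.Choices m ε) : OptAlgorithm m where
  Index := A1.V m ε
  finite_index := inferInstance
  rule v γ S p :=
    ch.tie.first (v, γ, S, p) (A1.preferences ε (ch.target v) (normalize γ S) (p / γ))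

/-! ### The algorithm `A₂(ε)` (known optimum) -/

namespace A2

/-- `ε' = ε / 8` -/
def eps' (ε : ℝ) : ℝ := ε / 8

/-- `λ`; the ceiling is a nonnegative integer for every `0 < ε ≤ 1`. -/
def lam (ε : ℝ) : ℕ := ⌈Real.logb 2 (3 / 8 + 1 / (48 * eps' ε))⌉₊

/-- `l = λ + 2` -/
def l (ε : ℝ) : ℕ := lam ε + 2

/-- the numbers `a_i`, for `1 ≤ i ≤ l` -/
def a (ε : ℝ) (i : ℕ) : ℝ :=
  max (1 / 3 - 2 * eps' ε +
      (1 / 12 + 3 / 2 * eps' ε) * (1 / (2 : ℝ) ^ ((lam ε : ℤ) + 1 - (i : ℤ))))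
    (1 / 3 + 2 * eps' ε)

/-- the numbers `b_i`, for `1 ≤ i ≤ l` -/
def b (ε : ℝ) (i : ℕ) : ℝ :=
  1 / 3 - 2 * eps' ε + (1 / 12 + 3 / 2 * eps' ε) * (1 / (2 : ℝ) ^ ((lam ε : ℤ) - (i : ℤ)))

/-- Jobs of relative size at most `1/3 + 2 ε'` are small, the others are large. -/
def IsSmall (ε : ℝ) (q : ℝ) : Prop := q ≤ 1 / 3 + 2 * eps' ε

/-- Membership in the job class `i`, for `1 ≤ i ≤ 2 l - 1`. -/
def InClass (ε : ℝ) (i : ℕ) (q : ℝ) : Prop :=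
  if i ≤ l ε then a ε i < q ∧ q ≤ b ε i
  else 2 * a ε (i - l ε) < q ∧ q ≤ 2 * b ε (i - l ε)

/-- `μ`, the number of machines that are not reserve machines -/
def mu (m : ℕ) (ε : ℝ) : ℕ := ⌈(1 + eps' ε) / (1 + 2 * eps' ε) * (m : ℝ)⌉₊

/-- The set of the first `μ` machines. -/
def Mc (m : ℕ) (ε : ℝ) : Finset (Fin m) := Finset.univ.filter fun j => (j : ℕ) < mu m ε

/-- The set of the reserve machines. -/
def Mr (m : ℕ) (ε : ℝ) : Finset (Fin m) := Finset.univ.filter fun j => mu m ε ≤ (j : ℕ)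

/-- `κ` -/
def kappa (ε : ℝ) : ℕ := ⌈2 * (2 + 1 / eps' ε) * (2 * (l ε : ℝ) - 1)⌉₊

/-- the set `U = {0, …, κ} ^ (2 l - 1)` -/
abbrev U (ε : ℝ) : Type := Fin (2 * l ε - 1) → Fin (kappa ε + 1)

/-- The vector `c'(u)`: first `u_1 m_0` entries `1`, then `u_2 m_0` entries `2`, and so on, where
`m_0 = ⌊(m - μ) / (2 l - 1)⌋`. -/
def config' (m : ℕ) (ε : ℝ) (u : U ε) : List ℕ :=
  (List.finRange (2 * l ε - 1)).flatMap fun i =>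
    List.replicate ((u i : ℕ) * ((m - mu m ε) / (2 * l ε - 1))) ((i : ℕ) + 1)

/-- The target configuration `c(u)`: the vector `c'(u)` truncated to length `μ` or extended to
length `μ` by zeros. -/
def config (m : ℕ) (ε : ℝ) (u : U ε) : Fin (mu m ε) → ℕ := fun j => (config' m ε u).getD j 0

/-- the set `C` of all target configurations `c(u)` -/
def C (m : ℕ) (ε : ℝ) : Set (Fin (mu m ε) → ℕ) := Set.range (config m ε)

/-- The class of machine `j` in the configuration `c`. -/
def classOf {m : ℕ} {ε : ℝ} (c : Fin (mu m ε) → ℕ) (j : Fin m) : ℕ :=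
  if h : (j : ℕ) < mu m ε then c ⟨j, h⟩ else 0

/-- The targeted minimal load `ℓ⁻` of a class-`i` machine, caused by large jobs. -/
def loadMin (ε : ℝ) (i : ℕ) : ℝ :=
  if i = 0 then 0 else if i ≤ l ε then 2 * a ε i else 2 * a ε (i - l ε)

/-- The targeted maximal load `ℓ⁺` of a class-`i` machine, caused by large jobs. -/
def loadMax (ε : ℝ) (i : ℕ) : ℝ :=
  if i = 0 then 0 else if i ≤ l ε then 2 * b ε i else 2 * b ε (i - l ε)

/-- The number of class-`i` jobs on a class-`i` machine of a target configuration. -/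
def capacity (ε : ℝ) (i : ℕ) : ℕ := if i ≤ l ε then 2 else 1

/-- The sets of machines, in order of preference, to which a job of size `q` may be assigned by
`A_c` in the schedule `S`, sizes being relative to the optimum makespan. -/
def preferences {m : ℕ} (ε : ℝ) (c : Fin (mu m ε) → ℕ) (S : Schedule m) (q : ℝ) :
    List (Finset (Fin m)) :=
  if IsSmall ε q then
    [(Mc m ε).filter fun j => 0 < loadOf (IsSmall ε) S j ∧
        loadMax ε (classOf c j) + loadOf (IsSmall ε) S j + q ≤ 4 / 3 + ε,
      argminOn ((Mc m ε).filter fun j => loadOf (IsSmall ε) S j = 0 ∧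
        loadMax ε (classOf c j) + q ≤ 4 / 3 + ε) fun j => loadMin ε (classOf c j),
      Mc m ε]
  else if ∃ i, 1 ≤ i ∧ i ≤ 2 * l ε - 1 ∧ InClass ε i q then
    [(Mc m ε).filter fun j => ∃ i, 1 ≤ i ∧ i ≤ 2 * l ε - 1 ∧ InClass ε i q ∧
        classOf c j = i ∧ countOf (InClass ε i) S j < capacity ε i,
      argmaxOn ((Mr m ε).filter fun j => load S j + q ≤ 4 / 3 + ε) fun j => load S j,
      Mr m ε]
  else []

end A2

/-- The algorithm `A₂(ε)` for known optimum makespan. -/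
def A2 (m : ℕ) (ε : ℝ) (tie : TieBreak m (A2.C m ε × ℝ × Schedule m × ℝ)) : OptAlgorithm m where
  Index := A2.C m ε
  finite_index := (Set.finite_range (A2.config m ε)).to_subtype
  rule c γ S p := tie.first (c, γ, S, p) (A2.preferences ε c.1 (normalize γ S) (p / γ))

/-! ### The algorithm `A₃(ε)` (known optimum) -/

/-- The free choices of `A₃(ε)`. -/
structure A3Choices (m : ℕ) (ε : ℝ) where
  /-- the choices of `A₁(1/3)` -/
  one : A1.Choices m (1 / 3)
  /-- the choices of `A₂(ε)` -/
  two : TieBreak m (A2.C m ε × ℝ × Schedule m × ℝ)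

/-- The algorithm `A₃(ε)`: use `A₁(1/3)` if `m < 2 l / ε' ^ 2` and `A₂(ε)` otherwise. -/
def A3 (m : ℕ) (ε : ℝ) (ch : A3Choices m ε) : OptAlgorithm m :=
  if (m : ℝ) < 2 * (A2.l ε : ℝ) / A2.eps' ε ^ 2 then A1 m (1 / 3) ch.one else A2 m ε ch.two

/-! ### The reduction `A*(ε, h)` from unknown to known optimum -/

namespace Star

/-- The free choices of the reduction. -/
structure Choices (m h : ℕ) (K : Type) where
  /-- Which jobs count when a least loaded machine is determined after a failure: only those that
  arrived since the last adjustment of the guess (`true`), or all jobs (`false`). -/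
  ignoreOld : Bool
  /-- The choice among several least loaded machines in the schedule `(i, k)`; it may depend on
  all jobs that have arrived. -/
  tie : TieBreak m (List ℝ × Fin h × K)
  /-- `renumber σ i k v j` is the renumbering of machines (from new number to actual machine) used
  if a job lies on the actual machine `j` and should lie on the machine with number `v`. -/
  renumber : List ℝ → Fin h → K → Fin m → Fin m → Equiv.Perm (Fin m)
  renumber_spec : ∀ σ i k v j, renumber σ i k v j v = j

/-- The state of the reduction. The guess is stored in `h` variables, which are not re-sorted. -/
structure State (m h : ℕ) (K : Type) where
  /-- all jobs that have arrived -/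
  jobs : List ℝ
  /-- the current guesses -/
  guess : Fin h → ℝ
  /-- the whole schedule `(i, k)`, on the actual machines -/
  full : Fin h → K → Schedule m
  /-- the part of the schedule `(i, k)` that the rule `k` sees: the jobs since the last adjustment
  of guess `i` (including the job that caused the adjustment), in the current numbering -/
  view : Fin h → K → Schedule m
  /-- the current numbering: from machine numbers to actual machines -/
  actual : Fin h → K → Equiv.Perm (Fin m)
  /-- the rule `k` using guess `i` has failed since the last adjustment of the guess -/
  failed : Fin h → K → Prop

/-- The state before the first job, of processing time `p₁`, is scheduled. -/
def init (m h : ℕ) (K : Type) (ε p₁ : ℝ) : State m h K where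
  jobs := []
  guess i := p₁ * (1 + ε) ^ (i : ℕ)
  full _ _ := []
  view _ _ := []
  actual _ _ := 1
  failed _ _ := False

variable {m h : ℕ}

/-- The rule `k` using guess `γ` fails on a job of processing time `p` in the schedule `S`:
no machine is specified, or the load would exceed `ρ γ`, or `γ` is smaller than the average
machine load or than `p`. -/
def Fails (A : OptAlgorithm m) (ρ : ℝ) (k : A.Index) (γ : ℝ) (S : Schedule m) (p : ℝ) : Prop :=
  A.rule k γ S p = none ∨
  (∃ j, A.rule k γ S p = some j ∧ ρ * γ < load S j + p) ∨
  (γ < (volume S + p) / m ∨ γ < p)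

/-- The rule `k` using guess `i` fails on the job `p`, or has failed before. -/
def failedNow (A : OptAlgorithm m) (ρ : ℝ) (st : State m h A.Index) (p : ℝ)
    (i : Fin h) (k : A.Index) : Prop :=
  st.failed i k ∨ Fails A ρ k (st.guess i) (st.view i k) p

/-- A least loaded machine (its number in the current numbering) of the schedule `(i, k)`. -/
def leastLoaded {K : Type} (ch : Choices m h K) (st : State m h K) (p : ℝ)
    (i : Fin h) (k : K) : Fin m :=
  ch.tie.pick (st.jobs ++ [p], i, k) (argminOn Finset.univ fun v =>
    if ch.ignoreOld then load (st.view i k) v else load (st.full i k) (st.actual i k v))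

/-- The number of the machine to which job `p` is assigned in the schedule `(i, k)`. -/
def place (A : OptAlgorithm m) (ρ : ℝ) (ch : Choices m h A.Index) (st : State m h A.Index)
    (p : ℝ) (i : Fin h) (k : A.Index) : Fin m :=
  if failedNow A ρ st p i k then leastLoaded ch st p i k
  else (A.rule k (st.guess i) (st.view i k) p).getD (leastLoaded ch st p i k)

/-- The actual machine to which job `p` is assigned in the schedule `(i, k)`. -/
def placeActual (A : OptAlgorithm m) (ρ : ℝ) (ch : Choices m h A.Index) (st : State m h A.Index)
    (p : ℝ) (i : Fin h) (k : A.Index) : Fin m :=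
  st.actual i k (place A ρ ch st p i k)

/-- Guess `i` is adjusted after job `p`: it is at most a guess for which all rules have failed. -/
def Adjusted (A : OptAlgorithm m) (ρ : ℝ) (st : State m h A.Index) (p : ℝ) (i : Fin h) : Prop :=
  ∃ i', (∀ k, failedNow A ρ st p i' k) ∧ st.guess i ≤ st.guess i'

/-- The position of guess `i` in the increasing order of all guesses, counted from `1`. -/
def rank {K : Type} (st : State m h K) (i : Fin h) : ℕ :=
  (Finset.univ.filter fun i' => st.guess i' ≤ st.guess i).card

/-- The value of guess `i` if it is adjusted after job `p`. -/
def newGuess {K : Type} (ε : ℝ) (st : State m h K) (p : ℝ) (i : Fin h) : ℝ :=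
  (1 + ε) ^ rank st i * max (⨆ i', st.guess i') (max p ((st.jobs.sum + p) / m))

/-- The number that the machine of the job `p` gets if guess `i` is adjusted after this job: that
of the machine where rule `k` using the new guess puts `p` as a first job. -/
def firstPlace (A : OptAlgorithm m) (ε ρ : ℝ) (ch : Choices m h A.Index)
    (st : State m h A.Index) (p : ℝ) (i : Fin h) (k : A.Index) : Fin m :=
  (A.rule k (newGuess ε st p i) [] p).getD (placeActual A ρ ch st p i k)

/-- The processing of the job `p`. -/
def step (A : OptAlgorithm m) (ε ρ : ℝ) (ch : Choices m h A.Index) (st : State m h A.Index)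
    (p : ℝ) : State m h A.Index where
  jobs := st.jobs ++ [p]
  guess i := if Adjusted A ρ st p i then newGuess ε st p i else st.guess i
  full i k := st.full i k ++ [(p, placeActual A ρ ch st p i k)]
  view i k :=
    if Adjusted A ρ st p i then [(p, firstPlace A ε ρ ch st p i k)]
    else st.view i k ++ [(p, place A ρ ch st p i k)]
  actual i k :=
    if Adjusted A ρ st p i then
      ch.renumber (st.jobs ++ [p]) i k (firstPlace A ε ρ ch st p i k) (placeActual A ρ ch st p i k)
    else st.actual i k
  failed i k := ¬ Adjusted A ρ st p i ∧ failedNow A ρ st p i k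

/-- The algorithm `A*(ε, h)`, for an algorithm `A` for known optimum makespan with target ratio `ρ`.
The guesses are initialized when the first job arrives. -/
def algorithm (A : OptAlgorithm m) (ρ ε : ℝ) (h : ℕ) (ch : Choices m h A.Index) :
    Algorithm m where
  Index := Fin h × A.Index
  finite_index := by
    have := A.finite_index
    infer_instance
  assign ik past p :=
    placeActual A ρ ch
      (past.foldl (step A ε ρ ch) (init m h A.Index ε ((past ++ [p]).headD 0))) p ik.1 ik.2

/-- The number `h` of guesses used by `A*(ε)`. -/
def numGuesses (ρ ε : ℝ) : ℕ :=
  ⌈Real.log (1 + 6 * ρ / ε) / Real.log (1 + ε / (3 * ρ))⌉₊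

end Star

/-- The algorithm `A*(ε) = A*(ε / (3 ρ), h)`. -/
def AStar {m : ℕ} (A : OptAlgorithm m) (ρ ε : ℝ)
    (ch : Star.Choices m (Star.numGuesses ρ ε) A.Index) : Algorithm m :=
  Star.algorithm A ρ (ε / (3 * ρ)) (Star.numGuesses ρ ε) ch

/-- The free choices of `A₃*(ε)`. -/
structure A3StarChoices (m : ℕ) (ε : ℝ) where
  /-- the choices of `A₃(ε/2)` -/
  inner : A3Choices m (ε / 2)
  /-- the choices of the reduction -/
  outer : Star.Choices m (Star.numGuesses (4 / 3 + ε / 2) (ε / 2)) (A3 m (ε / 2) inner).Index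

/-- The algorithm `A₃*(ε)`: the algorithm `A₃(ε/2)`, whose target ratio is `ρ = 4/3 + ε/2`, executed
in `A*(ε/2)`. -/
def A3Star (m : ℕ) (ε : ℝ) (ch : A3StarChoices m ε) : Algorithm m :=
  AStar (A3 m (ε / 2) ch.inner) (4 / 3 + ε / 2) (ε / 2) ch.outer

/-! ### The free choices can always be made -/

theorem nonempty_tieBreak {m : ℕ} (hm : 0 < m) (α : Type) : Nonempty (TieBreak m α) :=
  ⟨⟨fun _ T => if hT : T.Nonempty then hT.choose else ⟨0, hm⟩,
    fun _ T hT => by simpa [hT] using hT.choose_spec⟩⟩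

theorem A1.exists_optimalTarget {m : ℕ} (hm : 0 < m) {ε : ℝ} (v : A1.V m ε) :
    ∃ n, A1.IsOptimalTarget v n := by
  have hfin : {n : Fin (A1.l ε) → Fin m → ℕ | A1.IsTarget v n}.Finite := by
    refine (Set.Finite.pi' fun i => Set.Finite.pi' fun _ : Fin m =>
      Set.finite_Iic (v i : ℕ)).subset fun n hn i j => ?_
    have h := hn i
    exact (Finset.single_le_sum (f := fun j => n i j) (fun _ _ => Nat.zero_le _)
      (Finset.mem_univ j)).trans h.le
  have hne : {n : Fin (A1.l ε) → Fin m → ℕ | A1.IsTarget v n}.Nonempty :=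
    ⟨fun i j => if j = ⟨0, hm⟩ then (v i : ℕ) else 0, fun i => by simp⟩
  obtain ⟨n, hn, hmin⟩ := Set.exists_min_image _ (fun n => ⨆ j, A1.targetLoad ε n j) hfin hne
  exact ⟨n, hn, hmin⟩

theorem nonempty_choices {m : ℕ} (hm : 0 < m) (ε : ℝ) : Nonempty (A3StarChoices m ε) := by
  choose t ht using fun v : A1.V m (1 / 3) => A1.exists_optimalTarget hm v
  obtain ⟨t1⟩ := nonempty_tieBreak hm (A1.V m (1 / 3) × ℝ × Schedule m × ℝ)
  obtain ⟨t2⟩ := nonempty_tieBreak hm (A2.C m (ε / 2) × ℝ × Schedule m × ℝ)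
  let inner : A3Choices m (ε / 2) := ⟨⟨t, ht, t1⟩, t2⟩
  obtain ⟨t3⟩ := nonempty_tieBreak hm (List ℝ ×
    Fin (Star.numGuesses (4 / 3 + ε / 2) (ε / 2)) × (A3 m (ε / 2) inner).Index)
  exact ⟨⟨inner, ⟨true, t3, fun _ _ _ v j => Equiv.swap v j, fun _ _ _ v j => by simp⟩⟩⟩

end MPS

end

/-! The reduction and the rules meet in the predicate `IsGood A ρ`: if the guess γ is at least the
optimum of a job sequence, then some rule, chosen with hindsight, places every job of it with load
at most ργ. `WeakRun` tolerates jobs for which the rule names no machine, because the job that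
triggers an adjustment enters the new view without a failure test.

A₁ (`isGood_A1`). The right vector counts the jobs of each class in a schedule T of makespan at most
1. Rounding up the jobs of T shows that the target has makespan at most 1+ε'. Large jobs always find
a reserved place. A small job goes to a machine whose target load plus small load is at most the
average, hence at most 1+ε', and adds at most ε' = ε/2.

A₂ (`isGood_A2`). A large job has weight 1 or 2, in units of half a machine. As large jobs exceed
1/3+2ε', a machine of T carries weight at most 2, so the total weight is at most 2m. Rounding the
class counts down to whole blocks of m₀ machines loses weight at most 2(m-μ), which the reserve
machines can absorb; so one of the configurations is `Suitable` (`A2.exists_suitable`). A large job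
that fitted nowhere would bring the weight on the reserve machines above 2(m-μ)
(`A2.Invariant.exists_fits_Mr`). If a small job fitted nowhere, then all but one machine of each
class would have targeted minimal load plus small load at least 1+2ε'; since (1+2ε')μ ≥ (1+ε')m,
this would exceed the total processing time m once m ≥ 2l/ε'² (`A2.Invariant.exists_fits_Mc`). Both
arguments rest on `PairwiseFull`: a fresh machine is opened only for a job that fits on no
comparable machine in use.

Reduction (`Star.isCompetitive_algorithm`). A guess for which all rules have failed is below OPT.
Hence the guesses keep no large gap above OPT and one of them is always at most (1+δ)OPT
(`Star.GuessInvariant.adjust`). Loads in a schedule never exceed 2+δ times its guess, even after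
failures, and an adjustment multiplies the guess by at least (1+δ)^h ≥ 1+2/δ; so the jobs before the
last adjustment contribute at most δ times the current guess. A rule that has not failed for the
guess at most (1+δ)OPT gives makespan at most (ρ+δ)(1+δ)OPT.

Number of schedules. The number of guesses and the base κ+1 are polynomial in 1/ε, and the exponent
2l-1 is O(1+log(1/ε)). A₁ runs with the fixed accuracy 1/3, and only for m polynomial in 1/ε, so it
needs polynomially many schedules. -/

noncomputable section

open scoped Classical

namespace MPS

/-! ### Loads as weighted sums over the jobs of a machine -/

/-- The sum of `g p` over the processing times `p` of the jobs on machine `j`. -/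
def weightOn {m : ℕ} (g : ℝ → ℝ) (S : Schedule m) (j : Fin m) : ℝ :=
  (S.map fun x => if x.2 = j then g x.1 else 0).sum

section weightOn

variable {m : ℕ}

@[simp] theorem weightOn_nil (g : ℝ → ℝ) (j : Fin m) : weightOn g [] j = 0 := by
  simp [weightOn]

@[simp] theorem weightOn_cons (g : ℝ → ℝ) (x : ℝ × Fin m) (S : Schedule m) (j : Fin m) :
    weightOn g (x :: S) j = (if x.2 = j then g x.1 else 0) + weightOn g S j := by
  simp [weightOn]

theorem weightOn_append (g : ℝ → ℝ) (S T : Schedule m) (j : Fin m) :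
    weightOn g (S ++ T) j = weightOn g S j + weightOn g T j := by
  simp [weightOn]

theorem weightOn_concat (g : ℝ → ℝ) (S : Schedule m) (p : ℝ) (v j : Fin m) :
    weightOn g (S ++ [(p, v)]) j = weightOn g S j + if v = j then g p else 0 := by
  simp [weightOn_append]

theorem load_eq_weightOn (S : Schedule m) (j : Fin m) : load S j = weightOn (fun q => q) S j := by
  induction S with
  | nil => simp [load]
  | cons x S ih =>
    rw [weightOn_cons, ← ih]
    by_cases h : x.2 = j <;> simp [load, h]

theorem loadOf_eq_weightOn (P : ℝ → Prop) (S : Schedule m) (j : Fin m) :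
    loadOf P S j = weightOn (fun q => if P q then q else 0) S j := by
  induction S with
  | nil => simp [loadOf, load]
  | cons x S ih =>
    rw [weightOn_cons, ← ih]
    by_cases h : x.2 = j <;> by_cases h' : P x.1 <;> simp [loadOf, load, h, h']

theorem countOf_eq_weightOn (P : ℝ → Prop) (S : Schedule m) (j : Fin m) :
    (countOf P S j : ℝ) = weightOn (fun q => if P q then 1 else 0) S j := by
  induction S with
  | nil => simp [countOf]
  | cons x S ih =>
    rw [weightOn_cons, ← ih]
    by_cases h : x.2 = j <;> by_cases h' : P x.1 <;> simp [countOf, h, h', add_comm]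

theorem load_concat (S : Schedule m) (p : ℝ) (v j : Fin m) :
    load (S ++ [(p, v)]) j = load S j + if v = j then p else 0 := by
  simp only [load_eq_weightOn, weightOn_concat]

theorem loadOf_concat (P : ℝ → Prop) (S : Schedule m) (p : ℝ) (v j : Fin m) :
    loadOf P (S ++ [(p, v)]) j = loadOf P S j + if v = j ∧ P p then p else 0 := by
  simp only [loadOf_eq_weightOn, weightOn_concat, ite_and]

theorem countOf_concat (P : ℝ → Prop) (S : Schedule m) (p : ℝ) (v j : Fin m) :
    countOf P (S ++ [(p, v)]) j = countOf P S j + if v = j ∧ P p then 1 else 0 := by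
  have : (countOf P (S ++ [(p, v)]) j : ℝ) =
      ((countOf P S j + if v = j ∧ P p then 1 else 0 : ℕ) : ℝ) := by
    push_cast
    simp only [countOf_eq_weightOn, weightOn_concat, ite_and]
  exact_mod_cast this

@[simp] theorem load_nil (j : Fin m) : load ([] : Schedule m) j = 0 := by simp [load]

@[simp] theorem loadOf_nil (P : ℝ → Prop) (j : Fin m) : loadOf P ([] : Schedule m) j = 0 := by
  simp [loadOf]

@[simp] theorem countOf_nil (P : ℝ → Prop) (j : Fin m) : countOf P ([] : Schedule m) j = 0 := by
  simp [countOf]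

theorem sum_weightOn (g : ℝ → ℝ) (S : Schedule m) :
    ∑ j, weightOn g S j = ((S.map Prod.fst).map g).sum := by
  induction S with
  | nil => simp
  | cons x S ih => simp [Finset.sum_add_distrib, ih]

theorem sum_load (S : Schedule m) : ∑ j, load S j = (S.map Prod.fst).sum := by
  simp only [load_eq_weightOn, sum_weightOn, List.map_id']

theorem weightOn_mono {g g' : ℝ → ℝ} {S : Schedule m} (h : ∀ q ∈ S.map Prod.fst, g q ≤ g' q)
    (j : Fin m) : weightOn g S j ≤ weightOn g' S j := by
  refine List.sum_le_sum fun x hx => ?_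
  split_ifs
  · exact h _ (List.mem_map_of_mem hx)
  · exact le_rfl

theorem weightOn_congr {g g' : ℝ → ℝ} {S : Schedule m} (h : ∀ q ∈ S.map Prod.fst, g q = g' q)
    (j : Fin m) : weightOn g S j = weightOn g' S j :=
  le_antisymm (weightOn_mono (fun q hq => (h q hq).le) j)
    (weightOn_mono (fun q hq => (h q hq).ge) j)

theorem weightOn_add (g g' : ℝ → ℝ) (S : Schedule m) (j : Fin m) :
    weightOn (fun q => g q + g' q) S j = weightOn g S j + weightOn g' S j := by
  induction S with
  | nil => simp
  | cons x S ih =>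
    simp only [weightOn_cons, ih]
    split_ifs <;> ring

theorem weightOn_mul (c : ℝ) (g : ℝ → ℝ) (S : Schedule m) (j : Fin m) :
    weightOn (fun q => c * g q) S j = c * weightOn g S j := by
  induction S with
  | nil => simp
  | cons x S ih =>
    simp only [weightOn_cons, ih]
    split_ifs <;> ring

theorem weightOn_sum {ι : Type*} (s : Finset ι) (g : ι → ℝ → ℝ) (S : Schedule m) (j : Fin m) :
    weightOn (fun q => ∑ i ∈ s, g i q) S j = ∑ i ∈ s, weightOn (g i) S j := by
  induction S with
  | nil => simp
  | cons x S ih =>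
    simp only [weightOn_cons, ih, Finset.sum_add_distrib]
    split_ifs <;> simp

theorem weightOn_nonneg {g : ℝ → ℝ} {S : Schedule m} (h : ∀ q ∈ S.map Prod.fst, 0 ≤ g q)
    (j : Fin m) : 0 ≤ weightOn g S j := by
  refine List.sum_nonneg ?_
  simp only [List.mem_map]
  rintro _ ⟨x, hx, rfl⟩
  split_ifs
  · exact h _ (List.mem_map_of_mem hx)
  · exact le_rfl

/-- Integrality will sharpen a bound `< 3` on the weight of a machine to `≤ 2`. -/
theorem exists_nat_eq_weightOn (g : ℝ → ℕ) (S : Schedule m) (j : Fin m) :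
    ∃ n : ℕ, weightOn (fun q => (g q : ℝ)) S j = n := by
  induction S with
  | nil => exact ⟨0, by simp⟩
  | cons x S ih =>
    obtain ⟨n, hn⟩ := ih
    refine ⟨(if x.2 = j then g x.1 else 0) + n, ?_⟩
    rw [weightOn_cons, hn]
    push_cast
    rfl

theorem load_nonneg {S : Schedule m} (h : ∀ q ∈ S.map Prod.fst, 0 ≤ q) (j : Fin m) :
    0 ≤ load S j := by
  rw [load_eq_weightOn]
  exact weightOn_nonneg h j

theorem loadOf_nonneg {S : Schedule m} (h : ∀ q ∈ S.map Prod.fst, 0 ≤ q) (P : ℝ → Prop)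
    (j : Fin m) : 0 ≤ loadOf P S j := by
  rw [loadOf_eq_weightOn]
  refine weightOn_nonneg (fun q hq => ?_) j
  split_ifs
  · exact h q hq
  · exact le_rfl

theorem sum_countOf (P : ℝ → Prop) (S : Schedule m) :
    ∑ j, countOf P S j = (S.map Prod.fst).countP (fun q => P q) := by
  have : ((∑ j, countOf P S j : ℕ) : ℝ) =
      (((S.map Prod.fst).countP fun q => P q : ℕ) : ℝ) := by
    push_cast
    simp only [countOf_eq_weightOn, sum_weightOn]
    induction S.map Prod.fst with
    | nil => simp
    | cons q L ih =>
      simp only [List.map_cons, List.sum_cons, ih, List.countP_cons]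
      by_cases h : P q <;> simp [h, add_comm]
  exact_mod_cast this

theorem sum_map_ite_eq_countP (P : ℝ → Prop) (c : ℝ) (L : List ℝ) :
    (L.map fun q => if P q then c else 0).sum = L.countP (fun q => P q) * c := by
  induction L with
  | nil => simp
  | cons q L ih =>
    simp only [List.map_cons, List.sum_cons, ih, List.countP_cons]
    by_cases h : P q <;> simp [h]; ring

theorem sum_map_finset_sum {ι : Type*} (s : Finset ι) (g : ι → ℝ → ℝ) (L : List ℝ) :
    (L.map fun q => ∑ i ∈ s, g i q).sum = ∑ i ∈ s, (L.map (g i)).sum := by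
  induction L with
  | nil => simp
  | cons q L ih => simp [ih, Finset.sum_add_distrib]

theorem sum_map_le_of_prefix {g : ℝ → ℝ} {L τ : List ℝ} (hL : L <+: τ)
    (h : ∀ q ∈ τ, 0 ≤ g q) : (L.map g).sum ≤ (τ.map g).sum := by
  obtain ⟨R, rfl⟩ := hL
  rw [List.map_append, List.sum_append]
  refine le_add_of_nonneg_right (List.sum_nonneg ?_)
  simp only [List.mem_map]
  rintro _ ⟨x, hx, rfl⟩
  exact h x (by simp [hx])

theorem weightOn_sublist {g : ℝ → ℝ} {S T : Schedule m} (hST : S.Sublist T)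
    (h : ∀ q ∈ T.map Prod.fst, 0 ≤ g q) (j : Fin m) : weightOn g S j ≤ weightOn g T j := by
  induction hST with
  | slnil => simp
  | cons x _ ih =>
    rw [weightOn_cons]
    have hx : 0 ≤ g x.1 := h _ (by simp)
    have := ih fun q hq => h q (by simp only [List.map_cons, List.mem_cons]; exact Or.inr hq)
    split_ifs <;> linarith
  | cons_cons x _ ih =>
    rw [weightOn_cons, weightOn_cons]
    have := ih fun q hq => h q (by simp only [List.map_cons, List.mem_cons]; exact Or.inr hq)
    linarith

end weightOn

/-! ### Makespan and optimum -/

section opt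

variable {m : ℕ}

theorem load_le_makespan (S : Schedule m) (j : Fin m) : load S j ≤ makespan S :=
  le_ciSup (f := fun j => load S j) (Set.finite_range _).bddAbove j

theorem makespan_le (hm : 0 < m) {S : Schedule m} {c : ℝ} (h : ∀ j, load S j ≤ c) :
    makespan S ≤ c := by
  have : Nonempty (Fin m) := ⟨⟨0, hm⟩⟩
  exact ciSup_le h

theorem opt_le_makespan {σ : List ℝ} {S : Schedule m} (h : S.map Prod.fst = σ) :
    opt m σ ≤ makespan S := by
  subst h
  let f : Fin (S.map Prod.fst).length → Fin m := fun t => (S.get (t.cast (by simp))).2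
  have hS : (List.ofFn fun t => ((S.map Prod.fst).get t, f t)) = S := by
    refine List.ext_get (by simp) fun n h₁ h₂ => ?_
    simp [f]
  have := ciInf_le (f := fun f : Fin (S.map Prod.fst).length → Fin m =>
    makespan (List.ofFn fun t => ((S.map Prod.fst).get t, f t))) (Set.finite_range _).bddBelow f
  rwa [hS] at this

theorem exists_makespan_eq_opt (hm : 0 < m) (σ : List ℝ) :
    ∃ S : Schedule m, S.map Prod.fst = σ ∧ makespan S = opt m σ := by
  have : Nonempty (Fin σ.length → Fin m) := ⟨fun _ => ⟨0, hm⟩⟩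
  obtain ⟨f, hf⟩ := exists_eq_ciInf_of_finite (f := fun f : Fin σ.length → Fin m =>
    makespan (List.ofFn fun t => (σ.get t, f t)))
  refine ⟨_, ?_, hf⟩
  rw [List.map_ofFn]
  exact List.ofFn_get σ

/-- Deleting jobs from an optimum schedule does not increase loads. This is needed because a rule in
the reduction sees only the jobs since the last adjustment of its guess. -/
theorem opt_le_of_sublist (hm : 0 < m) {τ σ : List ℝ} (h : τ.Sublist σ) (hσ : ∀ p ∈ σ, 0 ≤ p) :
    opt m τ ≤ opt m σ := by
  obtain ⟨S, rfl, hS⟩ := exists_makespan_eq_opt hm σ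
  obtain ⟨T, hT, rfl⟩ := List.sublist_map_iff.1 h
  rw [← hS]
  refine (opt_le_makespan rfl).trans (makespan_le hm fun j => ?_)
  refine le_trans ?_ (load_le_makespan S j)
  rw [load_eq_weightOn, load_eq_weightOn]
  exact weightOn_sublist hT hσ j

theorem sum_le_mul_opt (hm : 0 < m) (σ : List ℝ) : σ.sum ≤ m * opt m σ := by
  obtain ⟨S, rfl, hS⟩ := exists_makespan_eq_opt hm σ
  rw [← sum_load, ← hS]
  calc ∑ j, load S j ≤ ∑ _j : Fin m, makespan S :=
        Finset.sum_le_sum fun j _ => load_le_makespan S j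
    _ = m * makespan S := by simp

theorem le_opt_of_mem (hm : 0 < m) {σ : List ℝ} (hσ : ∀ p ∈ σ, 0 ≤ p) {p : ℝ} (hp : p ∈ σ) :
    p ≤ opt m σ := by
  obtain ⟨S, rfl, hS⟩ := exists_makespan_eq_opt hm σ
  obtain ⟨x, hx, rfl⟩ := List.mem_map.1 hp
  rw [← hS]
  refine le_trans ?_ (load_le_makespan S x.2)
  rw [load_eq_weightOn]
  have := weightOn_sublist (g := fun q => q) (List.singleton_sublist.2 hx) hσ x.2
  simpa using this

end opt

/-! ### Rules that never fail -/

/-- The rule `k` using `γ` has built the schedule, up to jobs for which it names no machine. -/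
def WeakRun {m : ℕ} (A : OptAlgorithm m) (k : A.Index) (γ : ℝ) (S : Schedule m) : Prop :=
  ∀ S₀ p j, S₀ ++ [(p, j)] <+: S → ∀ j', A.rule k γ S₀ p = some j' → j' = j

/-- If the guess is at least the optimum makespan, then some rule never fails, where `ρ` is the
target ratio. -/
def IsGood {m : ℕ} (A : OptAlgorithm m) (ρ : ℝ) : Prop :=
  ∀ γ : ℝ, 0 < γ → ∀ τ : List ℝ, (∀ p ∈ τ, 0 < p) → opt m τ ≤ γ →
    ∃ k : A.Index, ∀ (S : Schedule m) (p : ℝ), WeakRun A k γ S → S.map Prod.fst ++ [p] <+: τ →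
      ∃ j, A.rule k γ S p = some j ∧ load S j + p ≤ ρ * γ

section WeakRun

variable {m : ℕ} {A : OptAlgorithm m} {k : A.Index} {γ : ℝ}

theorem WeakRun.nil : WeakRun A k γ [] := by
  intro S₀ p j h
  simp at h

theorem WeakRun.of_prefix {S T : Schedule m} (hT : WeakRun A k γ T) (h : S <+: T) :
    WeakRun A k γ S :=
  fun S₀ p j h' => hT S₀ p j (h'.trans h)

theorem WeakRun.concat {S : Schedule m} {p : ℝ} {j : Fin m} (hS : WeakRun A k γ S)
    (h : ∀ j', A.rule k γ S p = some j' → j' = j) : WeakRun A k γ (S ++ [(p, j)]) := by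
  intro S₀ p' j' h' j'' hj''
  rcases List.prefix_concat_iff.1 h' with h' | h'
  · obtain ⟨rfl, h'⟩ := List.append_inj' h' rfl
    obtain ⟨rfl, rfl⟩ : p' = p ∧ j' = j := by simpa using h'
    exact h _ hj''
  · exact hS _ _ _ h' _ hj''

theorem TieBreak.first_cons_of_nonempty {α : Type} (τ : TieBreak m α) (a : α) {T : Finset (Fin m)}
    (L : List (Finset (Fin m))) (hT : T.Nonempty) :
    ∃ j ∈ T, τ.first a (T :: L) = some j :=
  ⟨τ.pick a T, τ.pick_mem a T hT, by simp [TieBreak.first, hT]⟩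

theorem TieBreak.first_cons_of_not_nonempty {α : Type} (τ : TieBreak m α) (a : α)
    {T : Finset (Fin m)} (L : List (Finset (Fin m))) (hT : ¬ T.Nonempty) :
    τ.first a (T :: L) = τ.first a L := by
  simp [TieBreak.first, hT]

theorem mem_argminOn {T : Finset (Fin m)} {f : Fin m → ℝ} {j : Fin m} :
    j ∈ argminOn T f ↔ j ∈ T ∧ ∀ j' ∈ T, f j ≤ f j' := by
  simp [argminOn]

theorem mem_argmaxOn {T : Finset (Fin m)} {f : Fin m → ℝ} {j : Fin m} :
    j ∈ argmaxOn T f ↔ j ∈ T ∧ ∀ j' ∈ T, f j' ≤ f j := by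
  simp [argmaxOn]

theorem argminOn_nonempty {T : Finset (Fin m)} (f : Fin m → ℝ) (hT : T.Nonempty) :
    (argminOn T f).Nonempty := by
  obtain ⟨j, hj, h⟩ := Finset.exists_min_image T f hT
  exact ⟨j, mem_argminOn.2 ⟨hj, h⟩⟩

theorem argmaxOn_nonempty {T : Finset (Fin m)} (f : Fin m → ℝ) (hT : T.Nonempty) :
    (argmaxOn T f).Nonempty := by
  obtain ⟨j, hj, h⟩ := Finset.exists_max_image T f hT
  exact ⟨j, mem_argmaxOn.2 ⟨hj, h⟩⟩

end WeakRun

/-! ### Scaling by the guess, and rules controlled by an invariant -/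

section normalize

variable {m : ℕ}

theorem weightOn_normalize (g : ℝ → ℝ) (γ : ℝ) (S : Schedule m) (j : Fin m) :
    weightOn g (normalize γ S) j = weightOn (fun q => g (q / γ)) S j := by
  simp [weightOn, normalize, Function.comp_def]

theorem load_normalize (γ : ℝ) (S : Schedule m) (j : Fin m) :
    load (normalize γ S) j = load S j / γ := by
  simp only [load_eq_weightOn, weightOn_normalize]
  simp_rw [div_eq_inv_mul]
  exact weightOn_mul _ _ _ _

theorem normalize_concat (γ : ℝ) (S : Schedule m) (p : ℝ) (j : Fin m) :
    normalize γ (S ++ [(p, j)]) = normalize γ S ++ [(p / γ, j)] := by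
  simp [normalize]

theorem map_fst_normalize (γ : ℝ) (S : Schedule m) :
    (normalize γ S).map Prod.fst = (S.map Prod.fst).map (· / γ) := by
  simp [normalize, Function.comp_def]

/-- A rule whose decisions depend on relative sizes only never fails if an invariant of the
normalized schedules guarantees this. -/
theorem exists_rule_of_invariant {A : OptAlgorithm m} {k : A.Index} {γ ρ : ℝ} (hγ : 0 < γ)
    {τ : List ℝ} (Inv : Schedule m → Prop) (h_nil : Inv [])
    (h_step : ∀ (S : Schedule m) (p : ℝ), Inv (normalize γ S) →
      (normalize γ S).map Prod.fst ++ [p / γ] <+: τ.map (· / γ) →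
      ∃ j, A.rule k γ S p = some j ∧ load (normalize γ S) j + p / γ ≤ ρ ∧
        Inv (normalize γ S ++ [(p / γ, j)])) :
    ∀ (S : Schedule m) (p : ℝ), WeakRun A k γ S → S.map Prod.fst ++ [p] <+: τ →
      ∃ j, A.rule k γ S p = some j ∧ load S j + p ≤ ρ * γ := by
  have key : ∀ (S : Schedule m) (p : ℝ), S.map Prod.fst ++ [p] <+: τ →
      (normalize γ S).map Prod.fst ++ [p / γ] <+: τ.map (· / γ) := by
    intro S p h
    have := h.map (· / γ)
    rwa [List.map_append, ← map_fst_normalize] at this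
  have inv : ∀ S : Schedule m, WeakRun A k γ S → S.map Prod.fst <+: τ → Inv (normalize γ S) := by
    intro S
    induction S using List.reverseRecOn with
    | nil => exact fun _ _ => h_nil
    | append_singleton S x ih =>
      intro hrun hpre
      rw [List.map_append] at hpre
      have hS := ih (hrun.of_prefix (List.prefix_append _ _))
        ((List.prefix_append _ _).trans hpre)
      obtain ⟨j, hj, -, hinv⟩ := h_step S x.1 hS (key S x.1 hpre)
      -- The invariant guarantees that the rule names a machine here, so the weak run must have
      -- followed it.
      have : j = x.2 := hrun S x.1 x.2 (List.prefix_refl _) j hj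
      subst this
      rw [show S ++ [x] = S ++ [(x.1, x.2)] from rfl, normalize_concat]
      exact hinv
  intro S p hrun hpre
  obtain ⟨j, hj, hle, -⟩ := h_step S p (inv S hrun ((List.prefix_append _ _).trans hpre))
    (key S p hpre)
  refine ⟨j, hj, ?_⟩
  rw [load_normalize, ← add_div, div_le_iff₀ hγ] at hle
  exact hle

/-- The normalized job sequence has a schedule of makespan at most `1`. -/
theorem exists_normalized_schedule (hm : 0 < m) {γ : ℝ} (hγ : 0 < γ) {τ : List ℝ}
    (h : opt m τ ≤ γ) :
    ∃ T : Schedule m, T.map Prod.fst = τ.map (· / γ) ∧ ∀ j, load T j ≤ 1 := by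
  obtain ⟨S, rfl, hS⟩ := exists_makespan_eq_opt hm τ
  refine ⟨normalize γ S, map_fst_normalize γ S, fun j => ?_⟩
  rw [load_normalize, div_le_one hγ]
  exact (load_le_makespan S j).trans (hS.le.trans h)

theorem le_one_of_mem_map_fst {T : Schedule m} (hT : ∀ j, load T j ≤ 1)
    (hpos : ∀ q ∈ T.map Prod.fst, 0 < q) {q : ℝ} (hq : q ∈ T.map Prod.fst) : q ≤ 1 := by
  obtain ⟨x, hx, rfl⟩ := List.mem_map.1 hq
  refine le_trans ?_ (hT x.2)
  rw [load_eq_weightOn]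
  have := weightOn_sublist (g := fun q => q) (List.singleton_sublist.2 hx)
    (fun q hq => (hpos q hq).le) x.2
  simpa using this

theorem sum_map_fst_le {T : Schedule m} (hT : ∀ j, load T j ≤ 1) : (T.map Prod.fst).sum ≤ m := by
  rw [← sum_load]
  exact (Finset.sum_le_sum fun j _ => hT j).trans (by simp)

end normalize

/-- A point of `(B 0, B n]` lies in one of the intervals `(B i, B (i + 1)]`. -/
theorem exists_lt_le_succ (B : ℕ → ℝ) {n : ℕ} {q : ℝ} (h₀ : B 0 < q) (hn : q ≤ B n) :
    ∃ i < n, B i < q ∧ q ≤ B (i + 1) := by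
  induction n with
  | zero => linarith
  | succ n ih =>
    rcases le_or_gt q (B n) with h | h
    · obtain ⟨i, hi, h'⟩ := ih h
      exact ⟨i, by omega, h'⟩
    · exact ⟨n, by omega, h, hn⟩

theorem eq_of_lt_le_succ {B : ℕ → ℝ} (hB : Monotone B) {q : ℝ} {i j : ℕ}
    (hi : B i < q ∧ q ≤ B (i + 1)) (hj : B j < q ∧ q ≤ B (j + 1)) : i = j := by
  rcases lt_trichotomy i j with h | h | h
  · linarith [hB (Nat.succ_le_of_lt h), hi.2, hj.1]
  · exact h
  · linarith [hB (Nat.succ_le_of_lt h), hj.2, hi.1]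

theorem sum_ite_eq_of_unique {ι : Type*} {s : Finset ι} {P : ι → Prop} (c : ι → ℝ) {i : ι}
    (his : i ∈ s) (hi : P i) (h : ∀ j ∈ s, P j → j = i) :
    ∑ j ∈ s, (if P j then c j else 0) = c i := by
  rw [Finset.sum_eq_single_of_mem i his fun j hj hji => if_neg fun hP => hji (h j hj hP), if_pos hi]

theorem IsGood.mono {m : ℕ} {A : OptAlgorithm m} {ρ ρ' : ℝ} (hA : IsGood A ρ) (h : ρ ≤ ρ') :
    IsGood A ρ' := by
  intro γ hγ τ hτ hopt
  obtain ⟨k, hk⟩ := hA γ hγ τ hτ hopt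
  refine ⟨k, fun S p hS hp => ?_⟩
  obtain ⟨j, hj, hle⟩ := hk S p hS hp
  exact ⟨j, hj, hle.trans (mul_le_mul_of_nonneg_right h hγ.le)⟩

/-! ### The algorithm `A₁` -/

namespace A1

variable {m : ℕ} {ε : ℝ}

theorem monotone_breakpoint (hε : 0 < ε) : Monotone fun i : ℕ => (1 + eps' ε) ^ i * eps' ε := by
  have hd : 0 < eps' ε := by unfold eps'; linarith
  intro i j hij
  exact mul_le_mul_of_nonneg_right (pow_le_pow_right₀ (by linarith) hij) hd.le

/-- The number `l` of classes is chosen for this: the classes cover all of (ε', 1]. -/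
theorem one_le_breakpoint (hε : 0 < ε) : 1 ≤ (1 + eps' ε) ^ l ε * eps' ε := by
  have hd : 0 < eps' ε := by unfold eps'; linarith
  have hlog : 0 < Real.log (1 + eps' ε) := Real.log_pos (by linarith)
  have h : Real.log (1 / eps' ε) / Real.log (1 + eps' ε) ≤ l ε := Nat.le_ceil _
  rw [div_le_iff₀ hlog, ← Real.log_pow] at h
  have := (Real.log_le_log_iff (by positivity) (by positivity)).1 h
  rwa [div_le_iff₀ hd] at this

theorem inClass_unique (hε : 0 < ε) {q : ℝ} {i j : Fin (l ε)} (hi : InClass ε i q)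
    (hj : InClass ε j q) : i = j :=
  Fin.ext (eq_of_lt_le_succ (monotone_breakpoint hε) hi hj)

theorem exists_inClass (hε : 0 < ε) {q : ℝ} (h : eps' ε < q) (h1 : q ≤ 1) :
    ∃ i, InClass ε i q := by
  obtain ⟨i, hi, h'⟩ := exists_lt_le_succ (fun i : ℕ => (1 + eps' ε) ^ i * eps' ε) (n := l ε)
    (by simpa using h) (h1.trans (one_le_breakpoint hε))
  exact ⟨⟨i, hi⟩, h'⟩

theorem not_inClass_of_le (hε : 0 < ε) {q : ℝ} (h : q ≤ eps' ε) (i : Fin (l ε)) :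
    ¬ InClass ε i q := by
  intro hi
  have := monotone_breakpoint hε (Nat.zero_le i)
  simp only [pow_zero, one_mul] at this
  linarith [hi.1]

/-- The processing time of a large job, rounded up; `0` for other jobs. -/
def roundUp (ε q : ℝ) : ℝ := ∑ i, if InClass ε i q then size ε i else 0

theorem roundUp_of_inClass (hε : 0 < ε) {q : ℝ} {i : Fin (l ε)} (hi : InClass ε i q) :
    roundUp ε q = size ε i :=
  sum_ite_eq_of_unique (size ε) (Finset.mem_univ i) hi fun _ _ hj => inClass_unique hε hj hi

theorem roundUp_of_le (hε : 0 < ε) {q : ℝ} (h : q ≤ eps' ε) : roundUp ε q = 0 :=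
  Finset.sum_eq_zero fun i _ => if_neg (not_inClass_of_le hε h i)

/-- The endpoints of a class differ by the factor 1+ε', so rounding up costs at most this factor;
small jobs are not rounded. Jobs above the last class count as 0, which only helps. -/
theorem roundUp_add_small_le (hε : 0 < ε) {q : ℝ} (hq : 0 < q) :
    roundUp ε q + (if q ≤ eps' ε then q else 0) ≤ (1 + eps' ε) * q := by
  have hd : 0 < eps' ε := by unfold eps'; linarith
  by_cases h : q ≤ eps' ε
  · rw [roundUp_of_le hε h, if_pos h]
    nlinarith
  · rw [if_neg h]
    by_cases hi : ∃ i, InClass ε i q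
    · obtain ⟨i, hi⟩ := hi
      rw [roundUp_of_inClass hε hi, size, pow_succ]
      nlinarith [hi.1]
    · have : roundUp ε q = 0 :=
        Finset.sum_eq_zero fun i _ => if_neg fun h' => hi ⟨i, h'⟩
      rw [this]
      nlinarith

theorem roundUp_le (hε : 0 < ε) {q : ℝ} (hq : 0 < q) : roundUp ε q ≤ (1 + eps' ε) * q := by
  have := roundUp_add_small_le hε hq
  split_ifs at this <;> linarith

theorem le_roundUp_add_small (hε : 0 < ε) {q : ℝ} (h1 : q ≤ 1) :
    q ≤ roundUp ε q + (if q ≤ eps' ε then q else 0) := by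
  by_cases h : q ≤ eps' ε
  · rw [roundUp_of_le hε h, if_pos h, zero_add]
  · obtain ⟨i, hi⟩ := exists_inClass hε (not_le.1 h) h1
    rw [roundUp_of_inClass hε hi, if_neg h, add_zero]
    exact hi.2

theorem weightOn_roundUp (S : Schedule m) (j : Fin m) :
    weightOn (roundUp ε) S j = targetLoad ε (fun i j => countOf (InClass ε i) S j) j := by
  have : weightOn (roundUp ε) S j =
      ∑ i, weightOn (fun q => if InClass ε i q then size ε i else 0) S j := by
    unfold roundUp
    exact weightOn_sum _ (fun i q => if InClass ε i q then size ε i else 0) _ _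
  rw [this, targetLoad]
  refine Finset.sum_congr rfl fun i _ => ?_
  rw [countOf_eq_weightOn, mul_comm, ← weightOn_mul]
  refine weightOn_congr (fun q _ => ?_) j
  split_ifs <;> simp

/-- If the rule for the correct numbers of large jobs is used, then the numbers of large jobs
on the machines never exceed their targets, and the small jobs are balanced. -/
structure Invariant (ε : ℝ) (n : Fin (l ε) → Fin m → ℕ) (S : Schedule m) : Prop where
  count_le : ∀ i j, countOf (InClass ε i) S j ≤ n i j
  load_le : ∀ j, targetLoad ε n j + loadOf (fun q => q ≤ eps' ε) S j ≤ 1 + ε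

theorem Invariant.load_le_target {n : Fin (l ε) → Fin m → ℕ} {S : Schedule m} (hε : 0 < ε)
    (hS : Invariant ε n S) (h1 : ∀ q ∈ S.map Prod.fst, q ≤ 1) (j : Fin m) :
    load S j ≤ targetLoad ε n j + loadOf (fun q => q ≤ eps' ε) S j := by
  have hd : 0 < eps' ε := by unfold eps'; linarith
  rw [load_eq_weightOn, loadOf_eq_weightOn]
  refine (weightOn_mono (fun q hq => le_roundUp_add_small hε (h1 q hq)) j).trans ?_
  rw [weightOn_add, weightOn_roundUp]
  gcongr
  unfold targetLoad
  refine Finset.sum_le_sum fun i _ => ?_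
  have : (countOf (InClass ε i) S j : ℝ) ≤ n i j := by exact_mod_cast hS.count_le i j
  refine mul_le_mul_of_nonneg_right this ?_
  unfold size
  positivity

theorem isTarget_countOf {v : V m ε} {T : Schedule m}
    (hv : ∀ i, (v i : ℕ) = (T.map Prod.fst).countP (fun q => InClass ε i q)) :
    IsTarget v fun i j => countOf (InClass ε i) T j :=
  fun i => (sum_countOf _ T).trans (hv i).symm

/-- The numbers of jobs of each class on the machines of T form a competing target, and rounding
raises the loads of T, which are at most 1, by a factor of at most 1+ε'. -/
theorem targetLoad_le_of_isOptimalTarget (hm : 0 < m) (hε : 0 < ε) {v : V m ε}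
    {n : Fin (l ε) → Fin m → ℕ} (hn : IsOptimalTarget v n) {T : Schedule m}
    (hT : ∀ j, load T j ≤ 1) (hpos : ∀ q ∈ T.map Prod.fst, 0 < q)
    (hv : ∀ i, (v i : ℕ) = (T.map Prod.fst).countP (fun q => InClass ε i q)) (j : Fin m) :
    targetLoad ε n j ≤ 1 + eps' ε := by
  have hd : 0 < eps' ε := by unfold eps'; linarith
  have : Nonempty (Fin m) := ⟨⟨0, hm⟩⟩
  refine (le_ciSup (Set.finite_range fun j => targetLoad ε n j).bddAbove j).trans
    ((hn.2 _ (isTarget_countOf hv)).trans (ciSup_le fun j => ?_))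
  rw [← weightOn_roundUp]
  refine (weightOn_mono (fun q hq => roundUp_le hε (hpos q hq)) j).trans ?_
  rw [weightOn_mul, ← load_eq_weightOn]
  nlinarith [hT j]

/-- The average load of target and small jobs. -/
theorem sum_targetLoad_add_small_le (hε : 0 < ε) {v : V m ε}
    {n : Fin (l ε) → Fin m → ℕ} (hn : IsTarget v n) {T : Schedule m}
    (hT : ∀ j, load T j ≤ 1) (hpos : ∀ q ∈ T.map Prod.fst, 0 < q)
    (hv : ∀ i, (v i : ℕ) = (T.map Prod.fst).countP (fun q => InClass ε i q))
    {S : Schedule m} (hS : S.map Prod.fst <+: T.map Prod.fst) :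
    ∑ j, (targetLoad ε n j + loadOf (fun q => q ≤ eps' ε) S j) ≤ (1 + eps' ε) * m := by
  have hd : 0 < eps' ε := by unfold eps'; linarith
  have h₁ : ∑ j, targetLoad ε n j = ((T.map Prod.fst).map (roundUp ε)).sum := by
    unfold targetLoad roundUp
    rw [sum_map_finset_sum, Finset.sum_comm]
    refine Finset.sum_congr rfl fun i _ => ?_
    rw [sum_map_ite_eq_countP, ← Finset.sum_mul, ← hv i, ← hn i]
    push_cast
    rfl
  have h₂ : ∑ j, loadOf (fun q => q ≤ eps' ε) S j ≤
      ((T.map Prod.fst).map fun q => if q ≤ eps' ε then q else 0).sum := by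
    simp only [loadOf_eq_weightOn, sum_weightOn]
    refine sum_map_le_of_prefix hS fun q hq => ?_
    split_ifs
    · exact (hpos q hq).le
    · exact le_rfl
  rw [Finset.sum_add_distrib, h₁]
  refine (add_le_add_right h₂ _).trans ?_
  rw [← List.sum_map_add]
  refine (List.sum_le_sum fun q hq => roundUp_add_small_le hε (hpos q hq)).trans ?_
  rw [List.sum_map_mul_left, List.map_id']
  exact mul_le_mul_of_nonneg_left (sum_map_fst_le hT) (by linarith)

/-- Each such job is longer than ε' and the total is at most m; so the vector of the true counts is
one of the vectors `v` of the algorithm. -/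
theorem countP_inClass_le (hε : 0 < ε) {T : Schedule m} (hT : ∀ j, load T j ≤ 1)
    (hpos : ∀ q ∈ T.map Prod.fst, 0 < q) (i : Fin (l ε)) :
    (T.map Prod.fst).countP (fun q => InClass ε i q) ≤ ⌊(m : ℝ) / eps' ε⌋₊ := by
  have hd : 0 < eps' ε := by unfold eps'; linarith
  refine Nat.le_floor ?_
  rw [le_div_iff₀ hd, ← sum_map_ite_eq_countP]
  refine le_trans ?_ (sum_map_fst_le hT)
  conv_rhs => rw [← List.map_id' (T.map Prod.fst)]
  refine List.sum_le_sum fun q hq => ?_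
  split_ifs with h
  · exact (not_le.1 fun h' => not_inClass_of_le hε h' i h).le
  · exact (hpos q hq).le

/-- A small job is handled by comparing the minimum with the average, a large job by the pigeonhole
principle on the places reserved for its class. -/
theorem Invariant.exists_next (hm : 0 < m) (hε : 0 < ε) {v : V m ε}
    {n : Fin (l ε) → Fin m → ℕ} (hn : IsOptimalTarget v n) {T : Schedule m}
    (hT : ∀ j, load T j ≤ 1) (hpos : ∀ q ∈ T.map Prod.fst, 0 < q)
    (hv : ∀ i, (v i : ℕ) = (T.map Prod.fst).countP (fun q => InClass ε i q))
    {S : Schedule m} {q : ℝ} (hS : Invariant ε n S)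
    (hpre : S.map Prod.fst ++ [q] <+: T.map Prod.fst)
    {α : Type} (tie : TieBreak m α) (x : α) :
    ∃ j, tie.first x (preferences ε n S q) = some j ∧ Invariant ε n (S ++ [(q, j)]) := by
  have hq : q ∈ T.map Prod.fst := hpre.subset (by simp)
  have hq1 := le_one_of_mem_map_fst hT hpos hq
  have hpre' := (List.prefix_append _ [q]).trans hpre
  have huniv : (Finset.univ : Finset (Fin m)).Nonempty := ⟨⟨0, hm⟩, Finset.mem_univ _⟩
  unfold preferences
  by_cases hsmall : q ≤ eps' ε
  · rw [if_pos hsmall]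
    obtain ⟨j, hj, hfirst⟩ := tie.first_cons_of_nonempty x [] (argminOn_nonempty
      (fun j => targetLoad ε n j + loadOf (fun x => x ≤ eps' ε) S j) huniv)
    refine ⟨j, hfirst, ⟨fun i j' => ?_, fun j' => ?_⟩⟩
    · rw [countOf_concat, if_neg fun h => not_inClass_of_le hε hsmall i h.2]
      exact hS.count_le i j'
    · rw [loadOf_concat]
      by_cases hjj : j = j'
      · subst hjj
        rw [if_pos ⟨rfl, hsmall⟩]
        have hmin := (mem_argminOn.1 hj).2
        have hsum := sum_targetLoad_add_small_le hε hn.1 hT hpos hv hpre'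
        have : (m : ℝ) * (targetLoad ε n j + loadOf (fun x => x ≤ eps' ε) S j) ≤
            (1 + eps' ε) * m := by
          refine le_trans ?_ hsum
          have := Finset.card_nsmul_le_sum Finset.univ
            (fun j => targetLoad ε n j + loadOf (fun x => x ≤ eps' ε) S j) _
            (fun j' _ => hmin j' (Finset.mem_univ _))
          simpa only [Finset.card_univ, Fintype.card_fin, nsmul_eq_mul] using this
        have hm' : (0 : ℝ) < m := by exact_mod_cast hm
        have := le_of_mul_le_mul_left (this.trans_eq (mul_comm _ _)) hm'
        -- One half of ε pays for rounding in the average, the other half for the job q itself.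
        have he : eps' ε + eps' ε = ε := by unfold eps'; ring
        linarith
      · rw [if_neg fun h => hjj h.1, add_zero]
        exact hS.load_le j'
  · obtain ⟨i, hi⟩ := exists_inClass hε (not_le.1 hsmall) hq1
    rw [if_neg hsmall, if_pos ⟨i, hi⟩]
    have hne : (Finset.univ.filter fun j => ∃ i, InClass ε i q ∧
        countOf (InClass ε i) S j < n i j).Nonempty := by
      -- Otherwise S already contains as many jobs of class i as the whole of T, although q is still
      -- to come.
      by_contra hcon
      have hle : ∑ j, n i j ≤ ∑ j, countOf (InClass ε i) S j := by
        refine Finset.sum_le_sum fun j _ => not_lt.1 fun h => hcon ⟨j, ?_⟩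
        exact Finset.mem_filter.2 ⟨Finset.mem_univ _, i, hi, h⟩
      rw [hn.1 i, hv i, sum_countOf] at hle
      have := hpre.sublist.countP_le (p := fun q => decide (InClass ε i q))
      simp only [List.countP_append, List.countP_cons, List.countP_nil, hi, decide_true,
        if_true] at this
      omega
    obtain ⟨j, hj, hfirst⟩ := tie.first_cons_of_nonempty x [Finset.univ] hne
    refine ⟨j, hfirst, ⟨fun i' j' => ?_, fun j' => ?_⟩⟩
    · rw [countOf_concat]
      by_cases h : j = j' ∧ InClass ε i' q
      · rw [if_pos h]
        obtain ⟨rfl, h⟩ := h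
        obtain ⟨i'', h'', hlt⟩ := (Finset.mem_filter.1 hj).2
        obtain rfl := inClass_unique hε h h''
        omega
      · rw [if_neg h]
        exact hS.count_le i' j'
    · rw [loadOf_concat, if_neg fun h => hsmall h.2, add_zero]
      exact hS.load_le j'

end A1

theorem isGood_A1 {m : ℕ} (hm : 0 < m) {ε : ℝ} (hε : 0 < ε) (ch : A1.Choices m ε) :
    IsGood (A1 m ε ch) (1 + ε) := by
  intro γ hγ τ hτ hopt
  obtain ⟨T, hTτ, hT⟩ := exists_normalized_schedule hm hγ hopt
  have hpos : ∀ q ∈ T.map Prod.fst, 0 < q := by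
    rw [hTτ]
    simp only [List.mem_map]
    rintro _ ⟨p, hp, rfl⟩
    exact div_pos (hτ p hp) hγ
  let v : A1.V m ε := fun i => ⟨(T.map Prod.fst).countP (fun q => A1.InClass ε i q),
    Nat.lt_succ_of_le (A1.countP_inClass_le hε hT hpos i)⟩
  have hv : ∀ i, (v i : ℕ) = (T.map Prod.fst).countP (fun q => A1.InClass ε i q) := fun _ => rfl
  have hn := ch.target_opt v
  have hd : A1.eps' ε ≤ ε := by unfold A1.eps'; linarith
  refine ⟨v, exists_rule_of_invariant hγ (A1.Invariant ε (ch.target v)) ⟨by simp, fun j => ?_⟩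
    fun S p hS hpre => ?_⟩
  · have := A1.targetLoad_le_of_isOptimalTarget hm hε hn hT hpos hv j
    rw [loadOf_nil]
    linarith
  · rw [← hTτ] at hpre
    obtain ⟨j, hj, hinv⟩ := hS.exists_next hm hε hn hT hpos hv hpre ch.tie (v, γ, S, p)
    refine ⟨j, hj, ?_, hinv⟩
    have hload := hinv.load_le_target hε (fun q hq => ?_) j
    · rw [load_concat, if_pos rfl] at hload
      exact hload.trans (hinv.load_le j)
    · rw [List.map_append] at hq
      exact le_one_of_mem_map_fst hT hpos (hpre.subset hq)

/-! ### The algorithm `A₂`: job classes -/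

namespace A2

variable {ε : ℝ}

/-- One side of the ceiling that defines λ. It makes the maximum in `a ε 1` equal to the threshold
for small jobs. -/
theorem le_two_pow_lam (hε : 0 < ε) : 1 / 12 + 3 / 2 * eps' ε ≤ 4 * eps' ε * 2 ^ lam ε := by
  have hd : 0 < eps' ε := by unfold eps'; linarith
  have h : Real.logb 2 (3 / 8 + 1 / (48 * eps' ε)) ≤ lam ε := Nat.le_ceil _
  rw [Real.logb_le_iff_le_rpow (by norm_num) (by positivity), Real.rpow_natCast] at h
  calc 1 / 12 + 3 / 2 * eps' ε = 4 * eps' ε * (3 / 8 + 1 / (48 * eps' ε)) := by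
        field_simp
        ring
    _ ≤ _ := by gcongr

/-- The other side of the ceiling. It puts `b ε 1` above the threshold for small jobs, so that the
maximum in `a` is inactive from index 2 on. If λ = 0, the ceiling gives no such bound and the
smallness of ε' is used instead. -/
theorem two_pow_lam_lt (hε : 0 < ε) (hε' : ε ≤ 1 / 2) :
    4 * eps' ε * 2 ^ lam ε < (1 / 12 + 3 / 2 * eps' ε) * 2 := by
  have hd : 0 < eps' ε := by unfold eps'; linarith
  have hd' : eps' ε ≤ 1 / 16 := by unfold eps'; linarith
  rcases Nat.eq_zero_or_pos (lam ε) with h | h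
  · rw [h]
    norm_num
    linarith
  · have h' : ((lam ε - 1 : ℕ) : ℝ) < Real.logb 2 (3 / 8 + 1 / (48 * eps' ε)) :=
      Nat.lt_ceil.1 (Nat.sub_lt h one_pos)
    rw [Real.lt_logb_iff_rpow_lt (by norm_num) (by positivity), Real.rpow_natCast] at h'
    calc 4 * eps' ε * 2 ^ lam ε = 4 * eps' ε * (2 ^ (lam ε - 1) * 2) := by
          rw [← pow_succ, Nat.sub_add_cancel h]
      _ < 4 * eps' ε * ((3 / 8 + 1 / (48 * eps' ε)) * 2) := by gcongr
      _ = _ := by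
        field_simp
        ring

/-- The exponent λ - i is negative for the last two classes; natural powers avoid this. -/
theorem b_eq (ε : ℝ) (i : ℕ) :
    b ε i = 1 / 3 - 2 * eps' ε + (1 / 12 + 3 / 2 * eps' ε) * (2 ^ i / 2 ^ lam ε) := by
  have h : (1 : ℝ) / 2 ^ ((lam ε : ℤ) - i) = 2 ^ i / 2 ^ lam ε := by
    rw [one_div, ← zpow_neg, neg_sub, zpow_sub₀ two_ne_zero, zpow_natCast, zpow_natCast]
  unfold b
  rw [h]

theorem a_eq (ε : ℝ) (i : ℕ) :
    a ε i = max (1 / 3 - 2 * eps' ε + (1 / 12 + 3 / 2 * eps' ε) * (2 ^ i / 2 ^ lam ε / 2))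
      (1 / 3 + 2 * eps' ε) := by
  have h : (1 : ℝ) / 2 ^ ((lam ε : ℤ) + 1 - i) = 2 ^ i / 2 ^ lam ε / 2 := by
    rw [one_div, ← zpow_neg, neg_sub, zpow_sub₀ two_ne_zero, zpow_add₀ two_ne_zero, zpow_natCast,
      zpow_natCast, zpow_one, div_div]
  unfold a
  rw [h]

theorem b_mono (hε : 0 < ε) : Monotone (b ε) := by
  have hd : 0 < eps' ε := by unfold eps'; linarith
  intro i j hij
  rw [b_eq, b_eq]
  have : (2 : ℝ) ^ i ≤ 2 ^ j := pow_le_pow_right₀ (by norm_num) hij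
  gcongr

theorem small_lt_b (hε : 0 < ε) (hε' : ε ≤ 1 / 2) {i : ℕ} (hi : 1 ≤ i) :
    1 / 3 + 2 * eps' ε < b ε i := by
  refine lt_of_lt_of_le ?_ (b_mono hε hi)
  have h := two_pow_lam_lt hε hε'
  rw [b_eq, pow_one, mul_div_assoc']
  have : 4 * eps' ε < (1 / 12 + 3 / 2 * eps' ε) * 2 / 2 ^ lam ε := by
    rwa [lt_div_iff₀ (by positivity)]
  linarith

theorem a_one (hε : 0 < ε) : a ε 1 = 1 / 3 + 2 * eps' ε := by
  rw [a_eq]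
  refine max_eq_right ?_
  have h := le_two_pow_lam hε
  have : (1 / 12 + 3 / 2 * eps' ε) / 2 ^ lam ε ≤ 4 * eps' ε := by
    rwa [div_le_iff₀ (by positivity)]
  calc _ = 1 / 3 - 2 * eps' ε + (1 / 12 + 3 / 2 * eps' ε) / 2 ^ lam ε := by
        field_simp
    _ ≤ _ := by linarith

theorem a_succ (hε : 0 < ε) (hε' : ε ≤ 1 / 2) {i : ℕ} (hi : 1 ≤ i) : a ε (i + 1) = b ε i := by
  have : (2 : ℝ) ^ (i + 1) / 2 ^ lam ε / 2 = 2 ^ i / 2 ^ lam ε := by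
    rw [pow_succ]
    field_simp
  rw [a_eq, this, ← b_eq]
  exact max_eq_left (small_lt_b hε hε' hi).le

theorem b_l (ε : ℝ) : b ε (l ε) = 2 / 3 + 4 * eps' ε := by
  rw [b_eq, l, pow_add]
  field_simp
  ring

theorem b_l_sub_one (ε : ℝ) : b ε (l ε - 1) = 1 / 2 + eps' ε := by
  rw [b_eq, show l ε - 1 = lam ε + 1 from rfl, pow_add]
  field_simp
  ring

theorem two_le_l (ε : ℝ) : 2 ≤ l ε := Nat.le_add_left _ _

/-- The numbers at which the job classes are separated. -/
def breakpoint (ε : ℝ) (i : ℕ) : ℝ :=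
  if i = 0 then 1 / 3 + 2 * eps' ε else if i ≤ l ε then b ε i else 2 * b ε (i - l ε)

/-- The intervals abut: `a ε (i+1) = b ε i`, and at the seam between the two groups of classes 2a₁ =
2/3 + 4ε' = b_l. -/
theorem inClass_iff (hε : 0 < ε) (hε' : ε ≤ 1 / 2) (i : ℕ) (q : ℝ) :
    InClass ε (i + 1) q ↔ breakpoint ε i < q ∧ q ≤ breakpoint ε (i + 1) := by
  unfold InClass breakpoint
  have hl := two_le_l ε
  rw [if_neg (Nat.succ_ne_zero i)]
  by_cases h : i + 1 ≤ l ε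
  · rw [if_pos h, if_pos h]
    rcases Nat.eq_zero_or_pos i with rfl | hi
    · rw [if_pos rfl, a_one hε]
    · rw [if_neg hi.ne', if_pos (by omega), a_succ hε hε' hi]
  · rw [if_neg h, if_neg h, if_neg (by omega)]
    by_cases h' : i ≤ l ε
    · obtain rfl : i = l ε := by omega
      rw [if_pos le_rfl, show l ε + 1 - l ε = 1 by omega, a_one hε, b_l]
      ring_nf
    · rw [if_neg h', show i + 1 - l ε = (i - l ε) + 1 by omega, a_succ hε hε' (by omega)]

theorem breakpoint_mono (hε : 0 < ε) (hε' : ε ≤ 1 / 2) : Monotone (breakpoint ε) := by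
  have hl := two_le_l ε
  refine monotone_nat_of_le_succ fun i => ?_
  unfold breakpoint
  rw [if_neg (Nat.succ_ne_zero i)]
  rcases Nat.eq_zero_or_pos i with rfl | hi
  · rw [if_pos rfl, if_pos (by omega)]
    exact (small_lt_b hε hε' le_rfl).le
  rw [if_neg hi.ne']
  rcases lt_trichotomy i (l ε) with h | h | h
  · rw [if_pos h.le, if_pos (by omega)]
    exact b_mono hε (Nat.le_succ i)
  · rw [if_pos h.le, if_neg (by omega), h, b_l, show l ε + 1 - l ε = 1 by omega]
    linarith [small_lt_b hε hε' (le_refl 1)]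
  · rw [if_neg (by omega), if_neg (by omega)]
    have := b_mono hε (show i - l ε ≤ i + 1 - l ε by omega)
    linarith

/-- The numbers of the job classes. -/
def classes (ε : ℝ) : Finset ℕ := Finset.Icc 1 (2 * l ε - 1)

theorem mem_classes {i : ℕ} : i ∈ classes ε ↔ 1 ≤ i ∧ i ≤ 2 * l ε - 1 := Finset.mem_Icc

theorem inClass_unique (hε : 0 < ε) (hε' : ε ≤ 1 / 2) {i j : ℕ} {q : ℝ} (hi : i ∈ classes ε)
    (hj : j ∈ classes ε) (hiq : InClass ε i q) (hjq : InClass ε j q) : i = j := by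
  obtain ⟨i, rfl⟩ := Nat.exists_eq_succ_of_ne_zero (Nat.one_le_iff_ne_zero.1 (mem_classes.1 hi).1)
  obtain ⟨j, rfl⟩ := Nat.exists_eq_succ_of_ne_zero (Nat.one_le_iff_ne_zero.1 (mem_classes.1 hj).1)
  rw [Nat.succ_eq_add_one, inClass_iff hε hε'] at hiq hjq
  rw [eq_of_lt_le_succ (breakpoint_mono hε hε') hiq hjq]

theorem exists_inClass (hε : 0 < ε) (hε' : ε ≤ 1 / 2) {q : ℝ} (h : ¬ IsSmall ε q) (h1 : q ≤ 1) :
    ∃ i ∈ classes ε, InClass ε i q := by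
  have hd : 0 < eps' ε := by unfold eps'; linarith
  have hl := two_le_l ε
  obtain ⟨i, hi, h'⟩ := exists_lt_le_succ (breakpoint ε) (n := 2 * l ε - 1) (q := q)
    -- The last breakpoint is 2b_{l-1} = 1 + 2ε', so the classes reach beyond 1.
    (by simpa [breakpoint, IsSmall] using h) (by
      unfold breakpoint
      rw [if_neg (by omega), if_neg (by omega), show 2 * l ε - 1 - l ε = l ε - 1 by omega,
        b_l_sub_one]
      linarith)
  exact ⟨i + 1, mem_classes.2 ⟨by omega, by omega⟩, (inClass_iff hε hε' i q).2 h'⟩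

theorem not_isSmall_of_inClass (hε : 0 < ε) (hε' : ε ≤ 1 / 2) {i : ℕ} {q : ℝ}
    (hi : i ∈ classes ε) (h : InClass ε i q) : ¬ IsSmall ε q := by
  obtain ⟨i, rfl⟩ := Nat.exists_eq_succ_of_ne_zero (Nat.one_le_iff_ne_zero.1 (mem_classes.1 hi).1)
  have h₁ := ((inClass_iff hε hε' i q).1 h).1
  have h₂ : 1 / 3 + 2 * eps' ε ≤ breakpoint ε i := by
    simpa [breakpoint] using breakpoint_mono hε hε' (Nat.zero_le i)
  exact not_le.2 (h₂.trans_lt h₁)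

theorem loadMax_eq {i : ℕ} (hi : i ∈ classes ε) :
    ∃ i', 1 ≤ i' ∧ i' ≤ l ε ∧ (i' = i ∨ i = l ε + i' ∧ i' ≤ l ε - 1) ∧
      loadMax ε i = 2 * b ε i' ∧ loadMin ε i = 2 * a ε i' := by
  obtain ⟨h1, h2⟩ := mem_classes.1 hi
  unfold loadMax loadMin
  simp only [if_neg (show i ≠ 0 by omega)]
  by_cases h : i ≤ l ε
  · exact ⟨i, h1, h, Or.inl rfl, by rw [if_pos h], by rw [if_pos h]⟩
  · exact ⟨i - l ε, by omega, by omega, Or.inr ⟨by omega, by omega⟩, by rw [if_neg h],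
      by rw [if_neg h]⟩

theorem loadMax_nonneg (hε : 0 < ε) (hε' : ε ≤ 1 / 2) {i : ℕ} (hi : i ∈ insert 0 (classes ε)) :
    0 ≤ loadMax ε i := by
  have hd : 0 < eps' ε := by unfold eps'; linarith
  rcases Finset.mem_insert.1 hi with rfl | hi
  · simp [loadMax]
  · obtain ⟨i', h1, -, -, h, -⟩ := loadMax_eq hi
    rw [h]
    linarith [small_lt_b hε hε' h1]

theorem loadMin_nonneg (hε : 0 < ε) {i : ℕ} (hi : i ∈ insert 0 (classes ε)) :
    0 ≤ loadMin ε i := by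
  have hd : 0 < eps' ε := by unfold eps'; linarith
  rcases Finset.mem_insert.1 hi with rfl | hi
  · simp [loadMin]
  · obtain ⟨i', -, -, -, -, h⟩ := loadMax_eq hi
    rw [h]
    have : 1 / 3 + 2 * eps' ε ≤ a ε i' := le_max_right _ _
    linarith

theorem loadMax_le (hε : 0 < ε) {i : ℕ} (hi : i ∈ insert 0 (classes ε)) :
    loadMax ε i ≤ 4 / 3 + ε := by
  rcases Finset.mem_insert.1 hi with rfl | hi
  · simp only [loadMax, if_true]
    linarith
  · obtain ⟨i', -, h2, -, h, -⟩ := loadMax_eq hi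
    have := b_mono hε h2
    rw [b_l] at this
    rw [h]
    unfold eps' at this
    linarith

/-- Unless the targeted minimal load is already large, the targeted loads are close to each
other. -/
theorem le_loadMin_or (hε : 0 < ε) (hε' : ε ≤ 1 / 2) {i : ℕ} (hi : i ∈ classes ε) :
    1 + 2 * eps' ε ≤ loadMin ε i ∨ (loadMax ε i ≤ 1 + 2 * eps' ε ∧
      loadMax ε i / 2 + 1 / 3 - 2 * eps' ε ≤ loadMin ε i) := by
  have hl := two_le_l ε
  obtain ⟨i', h1, h2, -, hmax, hmin⟩ := loadMax_eq hi
  rw [hmax, hmin]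
  rcases h2.eq_or_lt with rfl | h
  -- For i' = l the minimal load is 2a_l = 2b_{l-1} = 1 + 2ε'.
  · left
    have := a_succ hε hε' (show 1 ≤ l ε - 1 by omega)
    rw [b_l_sub_one, show l ε - 1 + 1 = l ε by omega] at this
    rw [this]
    linarith
  · right
    have h₁ := b_mono hε (show i' ≤ l ε - 1 by omega)
    rw [b_l_sub_one] at h₁
    -- The distance from 1/3 - 2ε' doubles from a to b (up to the maximum in a), hence 2a ≥ b + 1/3
    -- - 2ε'.
    have h₂ : 1 / 3 - 2 * eps' ε + (1 / 12 + 3 / 2 * eps' ε) * (2 ^ i' / 2 ^ lam ε / 2) ≤ a ε i' := by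
      rw [a_eq]
      exact le_max_left _ _
    refine ⟨by linarith, ?_⟩
    rw [b_eq]
    linarith

/-- Half of this number is the part of a machine of an optimum schedule that a class-`i` job
occupies. -/
def weight (ε : ℝ) (i : ℕ) : ℕ := if i ≤ l ε then 1 else 2

theorem capacity_mul_weight (ε : ℝ) (i : ℕ) : capacity ε i * weight ε i = 2 := by
  unfold capacity weight
  split_ifs <;> rfl

theorem capacity_pos (ε : ℝ) (i : ℕ) : 0 < capacity ε i := by
  unfold capacity
  split_ifs <;> norm_num

theorem loadMin_le_capacity_mul {i : ℕ} {q : ℝ} (hi : i ∈ classes ε) (h : InClass ε i q) :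
    loadMin ε i ≤ capacity ε i * q := by
  have := (mem_classes.1 hi).1
  unfold InClass at h
  unfold loadMin capacity
  simp only [if_neg (show i ≠ 0 by omega)]
  split_ifs at h ⊢
  · push_cast
    linarith [h.1]
  · push_cast
    linarith [h.1]

theorem capacity_mul_le_loadMax {i : ℕ} {q : ℝ} (hi : i ∈ classes ε) (h : InClass ε i q) :
    capacity ε i * q ≤ loadMax ε i := by
  have := (mem_classes.1 hi).1
  unfold InClass at h
  unfold loadMax capacity
  simp only [if_neg (show i ≠ 0 by omega)]
  split_ifs at h ⊢
  · push_cast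
    linarith [h.2]
  · push_cast
    linarith [h.2]

/-- The weight of the class of a large job, `0` for other jobs. -/
def jobWeight (ε q : ℝ) : ℕ := ∑ i ∈ classes ε, if InClass ε i q then weight ε i else 0

theorem sum_ite_inClass_eq_zero (hε : 0 < ε) (hε' : ε ≤ 1 / 2) {M : Type*} [AddCommMonoid M]
    (c : ℕ → M) {q : ℝ} (h : IsSmall ε q) :
    ∑ i ∈ classes ε, (if InClass ε i q then c i else 0) = 0 :=
  Finset.sum_eq_zero fun _ hi => if_neg fun h' => not_isSmall_of_inClass hε hε' hi h' h

theorem sum_ite_inClass (hε : 0 < ε) (hε' : ε ≤ 1 / 2) {M : Type*} [AddCommMonoid M]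
    (c : ℕ → M) {i : ℕ} {q : ℝ} (hi : i ∈ classes ε) (h : InClass ε i q) :
    ∑ i ∈ classes ε, (if InClass ε i q then c i else 0) = c i := by
  rw [Finset.sum_eq_single_of_mem i hi fun j hj hji => if_neg fun hP =>
    hji (inClass_unique hε hε' hj hi hP h), if_pos h]

/-- A unit of weight stands for more than 1/3 + 2ε' of processing time: weight 1 starts above 1/3 +
2ε', weight 2 above twice this. So three units do not fit on a machine of load 1. -/
theorem jobWeight_mul_le (hε : 0 < ε) (hε' : ε ≤ 1 / 2) {q : ℝ} (hq : 0 < q) (h1 : q ≤ 1) :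
    (1 + 6 * eps' ε) * jobWeight ε q ≤ 3 * q := by
  have hd : 0 < eps' ε := by unfold eps'; linarith
  by_cases h : IsSmall ε q
  · rw [jobWeight, sum_ite_inClass_eq_zero hε hε' _ h]
    push_cast
    linarith
  · obtain ⟨i, hi, hiq⟩ := exists_inClass hε hε' h h1
    rw [jobWeight, sum_ite_inClass hε hε' _ hi hiq]
    unfold InClass at hiq
    unfold weight
    have h₁ : ∀ i, 1 / 3 + 2 * eps' ε ≤ a ε i := fun i => le_max_right _ _
    split_ifs at hiq ⊢
    · push_cast
      linarith [hiq.1, h₁ i]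
    · push_cast
      linarith [hiq.1, h₁ (i - l ε)]

/-- Conversely, a unit of weight stands for at most 2/3 + 4ε' = b_l, half of the load 4/3 + 8ε' that
a machine may get; for weight 2 the bound q ≤ 1 suffices. -/
theorem le_jobWeight_mul (hε : 0 < ε) (hε' : ε ≤ 1 / 2) {q : ℝ} (h1 : q ≤ 1)
    (h : ¬ IsSmall ε q) : q ≤ (2 / 3 + 4 * eps' ε) * jobWeight ε q := by
  have hd : 0 < eps' ε := by unfold eps'; linarith
  obtain ⟨i, hi, hiq⟩ := exists_inClass hε hε' h h1
  rw [jobWeight, sum_ite_inClass hε hε' _ hi hiq]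
  unfold InClass at hiq
  unfold weight
  split_ifs at hiq ⊢ with hil
  · have := b_mono hε hil
    rw [b_l] at this
    push_cast
    linarith [hiq.2]
  · push_cast
    linarith

end A2

/-! ### The algorithm `A₂`: target configurations -/

/-- The padding value of a configuration is 0, so it never contributes to a class i ≠ 0. -/
theorem card_filter_getD_eq_count (L : List ℕ) {i : ℕ} (hi : i ≠ 0) (n : ℕ) :
    ((Finset.range n).filter fun x => L.getD x 0 = i).card = (L.take n).count i := by
  induction n with
  | zero => simp
  | succ n ih =>
    rw [Finset.range_add_one, Finset.filter_insert, List.take_add_one, List.count_append, ← ih]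
    rcases h : L[n]? with _ | x
    · have : ¬ L.getD n 0 = i := by simp [List.getD, h, hi.symm]
      rw [if_neg this]
      simp
    · by_cases hx : x = i
      · have : L.getD n 0 = i := by simp [List.getD, h, hx]
        rw [if_pos this, Finset.card_insert_of_notMem (by simp), hx]
        simp
      · have : ¬ L.getD n 0 = i := by simp [List.getD, h, hx]
        rw [if_neg this]
        simp [hx]

namespace A2

variable {m : ℕ} {ε : ℝ}

theorem mu_le (hε : 0 < ε) : mu m ε ≤ m := by
  have hd : 0 < eps' ε := by unfold eps'; linarith
  refine Nat.ceil_le.2 (mul_le_of_le_one_left (Nat.cast_nonneg m) ?_)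
  rw [div_le_one (by linarith)]
  linarith

theorem card_Mc (hε : 0 < ε) : (Mc m ε).card = mu m ε := by
  have : Mc m ε = Finset.univ.filter fun j : Fin m => (j : ℕ) < mu m ε := by
    ext j
    simp [Mc]
  rw [this, Fin.card_filter_val_lt, min_eq_right (mu_le hε)]

theorem mem_Mc {j : Fin m} : j ∈ Mc m ε ↔ (j : ℕ) < mu m ε := by simp [Mc]

theorem mem_Mr {j : Fin m} : j ∈ Mr m ε ↔ mu m ε ≤ (j : ℕ) := by simp [Mr]

theorem notMem_Mc_of_mem_Mr {j : Fin m} (h : j ∈ Mr m ε) : j ∉ Mc m ε := by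
  rw [mem_Mc]
  exact not_lt.2 (mem_Mr.1 h)

theorem sum_Mc_add_sum_Mr {M : Type*} [AddCommMonoid M] (f : Fin m → M) :
    ∑ j ∈ Mc m ε, f j + ∑ j ∈ Mr m ε, f j = ∑ j, f j := by
  have : Mr m ε = Finset.univ.filter fun j : Fin m => ¬ (j : ℕ) < mu m ε := by
    ext j
    simp [Mr]
  rw [this, Mc, Finset.sum_filter_add_sum_filter_not]

theorem card_Mr (hε : 0 < ε) : (Mr m ε).card = m - mu m ε := by
  have h := sum_Mc_add_sum_Mr (m := m) (ε := ε) fun _ => 1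
  simp only [Finset.sum_const, card_Mc hε, smul_eq_mul, mul_one, Finset.card_univ,
    Fintype.card_fin] at h
  omega

/-- The number of class-`i` machines of a configuration. -/
def numMachines {m : ℕ} {ε : ℝ} (c : Fin (mu m ε) → ℕ) (i : ℕ) : ℕ :=
  ((Finset.univ : Finset (Fin m)).filter fun j => classOf c j = i).card

theorem classOf_of_notMem {c : Fin (mu m ε) → ℕ} {j : Fin m} (h : j ∉ Mc m ε) :
    classOf c j = 0 := by
  rw [mem_Mc] at h
  exact dif_neg h

theorem numMachines_config (hε : 0 < ε) (u : U ε) {i : ℕ} (hi : i ≠ 0) :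
    numMachines (m := m) (config m ε u) i = ((config' m ε u).take (mu m ε)).count i := by
  rw [← card_filter_getD_eq_count _ hi]
  refine Finset.card_bij (fun j _ => (j : ℕ)) ?_ (fun j _ j' _ h => Fin.ext h) ?_
  · intro j hj
    have hj := (Finset.mem_filter.1 hj).2
    have hj' : (j : ℕ) < mu m ε := by
      by_contra h
      exact hi (hj.symm.trans (dif_neg h))
    rw [classOf, dif_pos hj'] at hj
    exact Finset.mem_filter.2 ⟨Finset.mem_range.2 hj', hj⟩
  · intro x hx
    obtain ⟨hx, hx'⟩ := Finset.mem_filter.1 hx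
    rw [Finset.mem_range] at hx
    refine ⟨⟨x, hx.trans_le (mu_le hε)⟩, Finset.mem_filter.2 ⟨Finset.mem_univ _, ?_⟩, rfl⟩
    rw [classOf, dif_pos hx]
    exact hx'

/-- The number `m₀`. -/
def blockSize (m : ℕ) (ε : ℝ) : ℕ := (m - mu m ε) / (2 * l ε - 1)

theorem mem_classes_of_mem_config' {u : U ε} {x : ℕ} (h : x ∈ config' m ε u) :
    x ∈ classes ε := by
  unfold config' at h
  obtain ⟨i, -, hx⟩ := List.mem_flatMap.1 h
  obtain rfl := (List.mem_replicate.1 hx).2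
  exact mem_classes.2 ⟨by omega, by have := i.2; omega⟩

theorem count_config' (u : U ε) (i : Fin (2 * l ε - 1)) :
    (config' m ε u).count ((i : ℕ) + 1) = u i * blockSize m ε := by
  unfold config'
  rw [List.count_flatMap]
  have : (List.count ((i : ℕ) + 1) ∘ fun i' : Fin (2 * l ε - 1) =>
      List.replicate ((u i' : ℕ) * ((m - mu m ε) / (2 * l ε - 1))) ((i' : ℕ) + 1)) =
      fun i' => if i' = i then u i * blockSize m ε else 0 := by
    funext i'
    simp only [Function.comp, List.count_replicate]
    by_cases h : i' = i
    · subst h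
      simp [blockSize]
    · have : ¬ (i' : ℕ) = i := fun h' => h (Fin.ext h')
      simp [h, this]
  rw [this, ← Fin.sum_univ_def]
  simp

theorem classOf_config_mem (u : U ε) (j : Fin m) :
    classOf (config m ε u) j ∈ insert 0 (classes ε) := by
  unfold classOf config
  split_ifs with h
  · simp only [List.getD_eq_getElem?_getD]
    rcases hx : (config' m ε u)[(j : ℕ)]? with _ | x
    · simp
    · exact Finset.mem_insert_of_mem (mem_classes_of_mem_config' (List.mem_of_getElem? hx))
  · simp

/-- The machines of the configuration match the classes of the jobs. -/
structure Suitable {m : ℕ} {ε : ℝ} (c : Fin (mu m ε) → ℕ) (L : List ℝ) : Prop where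
  classOf_mem : ∀ j : Fin m, classOf c j ∈ insert 0 (classes ε)
  capacity_mul_le : ∀ i ∈ classes ε,
    capacity ε i * numMachines c i ≤ L.countP (fun q => InClass ε i q)
  sum_le : ∑ i ∈ classes ε, weight ε i * L.countP (fun q => InClass ε i q) ≤
    2 * ∑ i ∈ classes ε, numMachines c i + 2 * (m - mu m ε)

theorem mu_lt (m : ℕ) (hε : 0 < ε) :
    (m : ℝ) * eps' ε < (1 + 2 * eps' ε) * (m - mu m ε + 1) := by
  have hd : 0 < eps' ε := by unfold eps'; linarith
  have : (mu m ε : ℝ) < (1 + eps' ε) / (1 + 2 * eps' ε) * m + 1 := Nat.ceil_lt_add_one (by positivity)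
  have h := mul_lt_mul_of_pos_left this (show 0 < 1 + 2 * eps' ε by linarith)
  have h' : (1 + 2 * eps' ε) * ((1 + eps' ε) / (1 + 2 * eps' ε) * m + 1) =
      (1 + eps' ε) * m + (1 + 2 * eps' ε) := by
    field_simp
  rw [h'] at h
  linarith

theorem le_mu (m : ℕ) (hε : 0 < ε) : (1 + eps' ε) * m ≤ (1 + 2 * eps' ε) * mu m ε := by
  have hd : 0 < eps' ε := by unfold eps'; linarith
  have : (1 + eps' ε) / (1 + 2 * eps' ε) * m ≤ (mu m ε : ℝ) := Nat.le_ceil _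
  rw [div_mul_eq_mul_div, div_le_iff₀ (by linarith)] at this
  linarith

/-- A class has at most `capacity * m` jobs, so this bound keeps the number of blocks per class at
most κ. As m is large, (1+2ε')(2l-1) is at most mε'/2, which absorbs the roundings in μ and m₀ at
the price of a factor 2; that factor and (1+2ε')/ε' = 2 + 1/ε' are built into κ. -/
theorem le_mul_blockSize (hε : 0 < ε) (hε' : ε ≤ 1 / 2)
    (hm : 2 * (l ε : ℝ) / eps' ε ^ 2 ≤ m) : (m : ℝ) ≤ kappa ε * blockSize m ε := by
  have hd : 0 < eps' ε := by unfold eps'; linarith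
  have hd' : eps' ε ≤ 1 / 16 := by unfold eps'; linarith
  have hl : (2 : ℝ) ≤ l ε := by exact_mod_cast two_le_l ε
  have hl' := two_le_l ε
  refine le_trans ?_ (mul_le_mul_of_nonneg_right (Nat.le_ceil _) (Nat.cast_nonneg _))
  rw [div_le_iff₀ (by positivity)] at hm
  have h₁ := mu_lt m hε
  have h₂ : ((m : ℝ) - mu m ε) + 1 ≤ (2 * l ε - 1) * (blockSize m ε + 1) := by
    have h := Nat.lt_mul_div_succ (m - mu m ε) (show 0 < 2 * l ε - 1 by omega)
    have h' : m - mu m ε + 1 ≤ (2 * l ε - 1) * (blockSize m ε + 1) := h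
    have h'' : (((m - mu m ε + 1 : ℕ)) : ℝ) ≤ (((2 * l ε - 1) * (blockSize m ε + 1) : ℕ) : ℝ) := by
      exact_mod_cast h'
    rw [Nat.cast_add, Nat.cast_sub (mu_le hε), Nat.cast_mul, Nat.cast_sub (by omega)] at h''
    push_cast at h''
    exact h''
  have h₃ : (m : ℝ) * eps' ε ≤
      (1 + 2 * eps' ε) * ((2 * l ε - 1) * (blockSize m ε + 1)) :=
    h₁.le.trans (mul_le_mul_of_nonneg_left h₂ (by linarith))
  have h₄ : 2 * (1 + 2 * eps' ε) * (2 * l ε - 1) ≤ m * eps' ε := by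
    have h₅ : 2 * (1 + 2 * eps' ε) * (2 * l ε - 1) * eps' ε ≤ 2 * l ε := by
      have h : 2 * (1 + 2 * eps' ε) * eps' ε ≤ 1 := by nlinarith
      have := mul_le_mul_of_nonneg_right h (show (0 : ℝ) ≤ 2 * l ε - 1 by linarith)
      linarith
    have h₆ : 2 * (1 + 2 * eps' ε) * (2 * l ε - 1) * eps' ε ≤ m * eps' ε * eps' ε := by nlinarith
    exact le_of_mul_le_mul_right h₆ hd
  have h₇ : (m : ℝ) * eps' ε ≤ 2 * (1 + 2 * eps' ε) * (2 * l ε - 1) * blockSize m ε := by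
    linarith
  calc (m : ℝ) = m * eps' ε / eps' ε := by field_simp
    _ ≤ 2 * (1 + 2 * eps' ε) * (2 * l ε - 1) * blockSize m ε / eps' ε := by gcongr
    _ = _ := by
      field_simp
      ring

/-- Machines are allotted to each class in whole blocks of m₀, rounded down; the reserve machines
make up for the loss. -/
theorem exists_suitable (hm0 : 0 < m) (hε : 0 < ε) (hε' : ε ≤ 1 / 2)
    (hm : 2 * (l ε : ℝ) / eps' ε ^ 2 ≤ m) {L : List ℝ}
    (hL : ∑ i ∈ classes ε, weight ε i * L.countP (fun q => InClass ε i q) ≤ 2 * m) :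
    ∃ c : C m ε, Suitable c.1 L := by
  have hl := two_le_l ε
  have hblock := le_mul_blockSize hε hε' hm
  have hblock_pos : 0 < blockSize m ε := by
    refine Nat.pos_of_ne_zero fun h => ?_
    rw [h] at hblock
    have : (0 : ℝ) < m := by exact_mod_cast hm0
    simp only [Nat.cast_zero, mul_zero] at hblock
    linarith
  have hblock' : m ≤ kappa ε * blockSize m ε := by exact_mod_cast hblock
  set n : ℕ → ℕ := fun i => L.countP (fun q => InClass ε i q) with hn
  have hn_le : ∀ i ∈ classes ε, weight ε i * n i ≤ 2 * m := fun i hi =>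
    (Finset.single_le_sum (f := fun i => weight ε i * n i) (fun _ _ => Nat.zero_le _) hi).trans hL
  -- The number of blocks of m₀ machines that the jobs of class i fill completely.
  let w : ℕ → ℕ := fun i => n i / (capacity ε i * blockSize m ε)
  have hw : ∀ i ∈ classes ε, w i < kappa ε + 1 := by
    intro i hi
    refine Nat.lt_succ_of_le (Nat.div_le_of_le_mul ?_)
    have h₁ := hn_le i hi
    have h₂ := capacity_mul_weight ε i
    have h₃ := capacity_pos ε i
    have h₄ : 2 * n i ≤ 2 * (capacity ε i * m) := by
      calc 2 * n i = capacity ε i * (weight ε i * n i) := by rw [← h₂]; ring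
        _ ≤ capacity ε i * (2 * m) := Nat.mul_le_mul_left _ h₁
        _ = _ := by ring
    have h₅ := Nat.mul_le_mul_left (capacity ε i) hblock'
    calc n i ≤ capacity ε i * m := by omega
      _ ≤ capacity ε i * (kappa ε * blockSize m ε) := h₅
      _ = _ := by ring
  have hmem : ∀ i : Fin (2 * l ε - 1), (i : ℕ) + 1 ∈ classes ε := fun i =>
    mem_classes.2 ⟨by omega, by have := i.2; omega⟩
  let u : U ε := fun i => ⟨w (i + 1), hw _ (hmem i)⟩
  have hcount : ∀ i ∈ classes ε, (config' m ε u).count i = w i * blockSize m ε := by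
    intro i hi
    obtain ⟨h1, h2⟩ := mem_classes.1 hi
    have := count_config' (m := m) u ⟨i - 1, by omega⟩
    simpa [u, Nat.sub_add_cancel h1] using this
  have hN : ∀ i ∈ classes ε, numMachines (m := m) (config m ε u) i =
      ((config' m ε u).take (mu m ε)).count i := fun i hi =>
    numMachines_config hε u (by have := (mem_classes.1 hi).1; omega)
  refine ⟨⟨config m ε u, u, rfl⟩, classOf_config_mem u, fun i hi => ?_, ?_⟩
  · have h₁ : numMachines (m := m) (config m ε u) i ≤ w i * blockSize m ε := by
      rw [hN i hi, ← hcount i hi]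
      exact (List.take_sublist _ _).count_le i
    calc capacity ε i * numMachines (m := m) (config m ε u) i
        ≤ capacity ε i * (w i * blockSize m ε) := Nat.mul_le_mul_left _ h₁
      _ = n i / (capacity ε i * blockSize m ε) * (capacity ε i * blockSize m ε) := by
        simp only [w]
        ring
      _ ≤ n i := Nat.div_mul_le_self _ _
  -- Without truncation a class loses weight at most 2m₀, and (2l-1)m₀ ≤ m-μ. With truncation all μ
  -- machines have a positive class, and 2μ + 2(m-μ) = 2m already bounds the total weight.
  · rcases le_total (config' m ε u).length (mu m ε) with hlen | hlen
    · have h₁ : ∀ i ∈ classes ε, weight ε i * n i ≤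
          2 * numMachines (m := m) (config m ε u) i + 2 * blockSize m ε := by
        intro i hi
        rw [hN i hi, List.take_of_length_le hlen, hcount i hi]
        have h := Nat.lt_mul_div_succ (n i)
          (Nat.mul_pos (capacity_pos ε i) hblock_pos)
        calc weight ε i * n i
            ≤ weight ε i * (capacity ε i * blockSize m ε * (w i + 1)) :=
              Nat.mul_le_mul_left _ h.le
          _ = capacity ε i * weight ε i * (w i * blockSize m ε + blockSize m ε) := by ring
          _ = _ := by rw [capacity_mul_weight]; ring
      refine (Finset.sum_le_sum h₁).trans ?_
      rw [Finset.sum_add_distrib, ← Finset.mul_sum, Finset.sum_const, classes, Nat.card_Icc,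
        smul_eq_mul]
      have := Nat.mul_div_le (m - mu m ε) (2 * l ε - 1)
      have h : (2 * l ε - 1) * blockSize m ε ≤ m - mu m ε := this
      calc _ = 2 * ∑ i ∈ Finset.Icc 1 (2 * l ε - 1), numMachines (m := m) (config m ε u) i +
            2 * ((2 * l ε - 1) * blockSize m ε) := by rw [Nat.add_sub_cancel]; ring
        _ ≤ _ := Nat.add_le_add_left (Nat.mul_le_mul_left 2 h) _
    · have h₁ : ∑ i ∈ classes ε, numMachines (m := m) (config m ε u) i = mu m ε := by
        rw [Finset.sum_congr rfl hN]
        have := Multiset.sum_count_eq_card (s := classes ε)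
          (m := (((config' m ε u).take (mu m ε) : List ℕ) : Multiset ℕ)) (fun x hx =>
            mem_classes_of_mem_config' (List.mem_of_mem_take (Multiset.mem_coe.1 hx)))
        simpa [hlen] using this
      have := mu_le (m := m) hε
      refine hL.trans ?_
      rw [h₁]
      omega

end A2

/-! ### Sets of machines that are pairwise well filled -/

/-- If at most one term is smaller than `c`, then the average is not much smaller than `c`. -/
theorem mul_card_sub_le_sum {ι : Type*} {s : Finset ι} {f : ι → ℝ} {c y : ℝ} (hy : y ≤ c)
    (h₀ : ∀ j ∈ s, y ≤ f j) (h : ∀ j ∈ s, ∀ j' ∈ s, j ≠ j' → c ≤ f j ∨ c ≤ f j') :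
    c * s.card - (c - y) ≤ ∑ j ∈ s, f j := by
  by_cases hex : ∃ j₀ ∈ s, f j₀ < c
  · obtain ⟨j₀, hj₀, hlt⟩ := hex
    rw [← Finset.add_sum_erase s f hj₀]
    have h₁ : ∑ _j ∈ s.erase j₀, c ≤ ∑ j ∈ s.erase j₀, f j :=
      Finset.sum_le_sum fun j hj => by
        obtain ⟨hne, hj⟩ := Finset.mem_erase.1 hj
        exact (h j hj j₀ hj₀ hne).resolve_right (not_le.2 hlt)
    have h₂ : ((s.erase j₀).card : ℝ) + 1 = s.card := by
      exact_mod_cast Finset.card_erase_add_one hj₀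
    rw [Finset.sum_const, nsmul_eq_mul] at h₁
    have := h₀ j₀ hj₀
    rw [← h₂]
    linarith
  · have h₁ : ∑ _j ∈ s, c ≤ ∑ j ∈ s, f j :=
      Finset.sum_le_sum fun j hj => not_lt.1 fun h' => hex ⟨j, hj, h'⟩
    rw [Finset.sum_const, nsmul_eq_mul] at h₁
    linarith

/-- Any two machines of `s` with the same key and with positive `f` have together more than a
number that depends on the key. -/
def PairwiseFull {m : ℕ} (s : Finset (Fin m)) (key : Fin m → ℕ) (D : ℕ → ℝ) (f : Fin m → ℝ) :
    Prop :=
  ∀ j ∈ s, ∀ j' ∈ s, j ≠ j' → key j = key j' → 0 < f j → 0 < f j' → D (key j) < f j + f j'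

theorem PairwiseFull.congr {m : ℕ} {s : Finset (Fin m)} {key : Fin m → ℕ} {D : ℕ → ℝ}
    {f f' : Fin m → ℝ} (h : PairwiseFull s key D f) (hf : ∀ j ∈ s, f' j = f j) :
    PairwiseFull s key D f' := by
  intro j hj j' hj'
  rw [hf j hj, hf j' hj']
  exact h j hj j' hj'

/-- The property is preserved if a machine is used for the first time only for a job that does not
fit on the machines in use. -/
theorem PairwiseFull.add {m : ℕ} {s : Finset (Fin m)} {key : Fin m → ℕ} {D : ℕ → ℝ}
    {f : Fin m → ℝ} (h : PairwiseFull s key D f) (hf : ∀ j ∈ s, 0 ≤ f j) {v : Fin m} {q : ℝ}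
    (hq : 0 ≤ q) (hv : v ∈ s)
    (hnew : f v = 0 → ∀ j ∈ s, key j = key v → 0 < f j → D (key j) < f j + q) :
    PairwiseFull s key D fun j => f j + if v = j then q else 0 := by
  have key_v : ∀ j ∈ s, v ≠ j → key j = key v → 0 < f j → D (key j) < f j + (f v + q) := by
    intro j hj hne hkey hpos
    rcases (hf v hv).eq_or_lt with h₀ | h₀
    · rw [← h₀, zero_add]
      exact hnew h₀.symm j hj hkey hpos
    · have := h j hj v hv hne.symm hkey hpos h₀
      linarith
  intro j hj j' hj' hne hkey hpos hpos'
  dsimp only at *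
  by_cases h₁ : v = j
  · subst h₁
    rw [if_neg hne, add_zero] at hpos' ⊢
    rw [if_pos rfl, hkey, add_comm]
    exact key_v j' hj' hne hkey.symm hpos'
  · rw [if_neg h₁, add_zero] at hpos ⊢
    by_cases h₂ : v = j'
    · subst h₂
      rw [if_pos rfl]
      exact key_v j hj h₁ hkey hpos
    · rw [if_neg h₂, add_zero] at hpos' ⊢
      exact h j hj j' hj' hne hkey hpos hpos'

/-! ### The algorithm `A₂`: analysis -/

namespace A2

variable {m : ℕ} {ε : ℝ}

/-- The jobs of class `i` on reserve machines are those for which the class-`i` machines have no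
space. -/
def OverflowOnly (ε : ℝ) (c : Fin (mu m ε) → ℕ) (S : Schedule m) : Prop :=
  ∀ i ∈ classes ε, ∀ j ∈ Mr m ε, 0 < countOf (InClass ε i) S j →
    ∀ j' ∈ Mc m ε, classOf c j' = i → capacity ε i ≤ countOf (InClass ε i) S j'

/-- The invariant of the rule `A_c` for a suitable configuration `c`. -/
structure Invariant (ε : ℝ) (c : Fin (mu m ε) → ℕ) (S : Schedule m) : Prop where
  count_le : ∀ i ∈ classes ε, ∀ j ∈ Mc m ε,
    countOf (InClass ε i) S j ≤ if classOf c j = i then capacity ε i else 0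
  load_Mc : ∀ j ∈ Mc m ε,
    loadMax ε (classOf c j) + loadOf (IsSmall ε) S j ≤ 4 / 3 + ε
  pair_Mc : PairwiseFull (Mc m ε) (classOf c) (fun i => 4 / 3 + ε - loadMax ε i)
    (loadOf (IsSmall ε) S)
  small_Mr : ∀ j ∈ Mr m ε, loadOf (IsSmall ε) S j = 0
  pair_Mr : PairwiseFull (Mr m ε) (fun _ => 0) (fun _ => 4 / 3 + ε) (load S)
  overflow : OverflowOnly ε c S

theorem Invariant.nil (hε : 0 < ε) {c : Fin (mu m ε) → ℕ} {L : List ℝ} (hc : Suitable c L) :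
    Invariant ε c ([] : Schedule m) where
  count_le := by simp
  load_Mc j _ := by
    rw [loadOf_nil, add_zero]
    exact loadMax_le hε (hc.classOf_mem j)
  pair_Mc := by
    intro j _ j' _ _ _ h
    simp at h
  small_Mr := by simp
  pair_Mr := by
    intro j _ j' _ _ _ h
    simp at h
  overflow := by
    intro i _ j _ h
    simp at h

/-- The large jobs on a machine of class i ≥ 1 are at most `capacity ε i` jobs of this class, hence
have load at most ℓ⁺; a class-0 machine has none. The invariant bounds ℓ⁺ plus the small load. -/
theorem Invariant.load_le {c : Fin (mu m ε) → ℕ} {S : Schedule m} (hε : 0 < ε) (hε' : ε ≤ 1 / 2)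
    (hc : ∀ j : Fin m, classOf c j ∈ insert 0 (classes ε)) (hS : Invariant ε c S)
    (h1 : ∀ q ∈ S.map Prod.fst, q ≤ 1) {j : Fin m} (hj : j ∈ Mc m ε) :
    load S j ≤ 4 / 3 + ε := by
  refine le_trans ?_ (hS.load_Mc j hj)
  have h₁ : ∀ q ∈ S.map Prod.fst, q ≤ (∑ i ∈ classes ε,
      loadMax ε i / capacity ε i * if InClass ε i q then 1 else 0) +
      if IsSmall ε q then q else 0 := by
    intro q hq
    simp only [mul_ite, mul_one, mul_zero]
    by_cases h : IsSmall ε q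
    · rw [sum_ite_inClass_eq_zero hε hε' (fun i => loadMax ε i / capacity ε i) h, if_pos h,
        zero_add]
    · obtain ⟨i, hi, hiq⟩ := exists_inClass hε hε' h (h1 q hq)
      rw [sum_ite_inClass hε hε' (fun i => loadMax ε i / capacity ε i) hi hiq, if_neg h, add_zero,
        le_div_iff₀ (by exact_mod_cast capacity_pos ε i), mul_comm]
      exact capacity_mul_le_loadMax hi hiq
  rw [load_eq_weightOn, loadOf_eq_weightOn]
  refine (weightOn_mono h₁ j).trans ?_
  rw [weightOn_add, weightOn_sum _
    fun i q => loadMax ε i / capacity ε i * if InClass ε i q then 1 else 0]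
  gcongr
  simp only [weightOn_mul, ← countOf_eq_weightOn]
  calc _ ≤ ∑ i ∈ classes ε, if classOf c j = i then loadMax ε i else 0 := by
        refine Finset.sum_le_sum fun i hi => ?_
        have hcap : (0 : ℝ) < capacity ε i := by exact_mod_cast capacity_pos ε i
        have hmax := loadMax_nonneg hε hε' (Finset.mem_insert_of_mem hi)
        have h := hS.count_le i hi j hj
        split_ifs at h ⊢
        · have h' : (countOf (InClass ε i) S j : ℝ) ≤ capacity ε i := by exact_mod_cast h
          calc _ ≤ loadMax ε i / capacity ε i * capacity ε i := by gcongr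
            _ = _ := div_mul_cancel₀ _ hcap.ne'
        · rw [Nat.le_zero.1 h]
          simp
    _ ≤ loadMax ε (classOf c j) := by
      rw [Finset.sum_ite_eq]
      split_ifs
      · exact le_rfl
      · exact loadMax_nonneg hε hε' (hc j)

theorem weightOn_jobWeight (S : Schedule m) (j : Fin m) :
    weightOn (fun q => (jobWeight ε q : ℝ)) S j =
      ∑ i ∈ classes ε, (weight ε i : ℝ) * countOf (InClass ε i) S j := by
  have : (fun q => (jobWeight ε q : ℝ)) = fun q => ∑ i ∈ classes ε,
      (weight ε i : ℝ) * if InClass ε i q then 1 else 0 := by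
    funext q
    simp [jobWeight]
  rw [this, weightOn_sum _ fun i q => (weight ε i : ℝ) * if InClass ε i q then 1 else 0]
  simp only [weightOn_mul, countOf_eq_weightOn]

/-- On each machine of T the weight is an integer below 3. -/
theorem sum_weight_mul_countP_le (hε : 0 < ε) (hε' : ε ≤ 1 / 2) {T : Schedule m}
    (hT : ∀ j, load T j ≤ 1) (hpos : ∀ q ∈ T.map Prod.fst, 0 < q) :
    ∑ i ∈ classes ε, weight ε i * (T.map Prod.fst).countP (fun q => InClass ε i q) ≤ 2 * m := by
  have hd : 0 < eps' ε := by unfold eps'; linarith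
  have h₁ : ∀ j, weightOn (fun q => (jobWeight ε q : ℝ)) T j ≤ 2 := by
    intro j
    have h := weightOn_mono (S := T) (fun q hq => jobWeight_mul_le hε hε' (hpos q hq)
      (le_one_of_mem_map_fst hT hpos hq)) j
    rw [weightOn_mul, weightOn_mul, ← load_eq_weightOn] at h
    obtain ⟨n, hn⟩ := exists_nat_eq_weightOn (jobWeight ε) T j
    rw [hn] at h ⊢
    have hlt : (n : ℝ) < 3 := by
      by_contra hcon
      have := mul_le_mul_of_nonneg_left (not_lt.1 hcon) (show 0 ≤ 1 + 6 * eps' ε by linarith)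
      linarith [hT j]
    have : n < 3 := by exact_mod_cast hlt
    exact_mod_cast Nat.le_of_lt_succ this
  have h₂ : ((∑ i ∈ classes ε, weight ε i *
      (T.map Prod.fst).countP (fun q => InClass ε i q) : ℕ) : ℝ) =
      ∑ j, weightOn (fun q => (jobWeight ε q : ℝ)) T j := by
    simp only [weightOn_jobWeight]
    rw [Finset.sum_comm]
    push_cast
    refine Finset.sum_congr rfl fun i _ => ?_
    rw [← Finset.mul_sum, ← sum_countOf]
    push_cast
    rfl
  have h₃ : ∑ j, weightOn (fun q => (jobWeight ε q : ℝ)) T j ≤ 2 * m :=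
    (Finset.sum_le_sum fun j _ => h₁ j).trans (by simp [mul_comm])
  rw [← h₂] at h₃
  exact_mod_cast h₃

/-- The large jobs on reserve machines do not need more than all reserve machines. -/
theorem sum_weight_Mr_le {c : Fin (mu m ε) → ℕ} {S : Schedule m} {L : List ℝ}
    (hc : Suitable c L) (hpre : S.map Prod.fst <+: L) (hS : OverflowOnly ε c S) :
    ∑ j ∈ Mr m ε, ∑ i ∈ classes ε, weight ε i * countOf (InClass ε i) S j ≤
      2 * (m - mu m ε) := by
  have h₁ : ∀ i ∈ classes ε, ∑ j ∈ Mr m ε, countOf (InClass ε i) S j +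
      capacity ε i * numMachines c i ≤ L.countP fun q => InClass ε i q := by
    intro i hi
    -- If some class-i job overflowed, all class-i machines are full and the jobs present suffice
    -- for the count. Otherwise the whole sequence has enough class-i jobs, by suitability.
    by_cases hex : ∃ j ∈ Mr m ε, 0 < countOf (InClass ε i) S j
    · obtain ⟨j, hj, hpos⟩ := hex
      refine le_trans ?_ (hpre.sublist.countP_le (p := fun q => decide (InClass ε i q)))
      rw [← sum_countOf, ← sum_Mc_add_sum_Mr (m := m) (ε := ε), add_comm]
      refine Nat.add_le_add_right ?_ _
      have hi0 : i ≠ 0 := by have := (mem_classes.1 hi).1; omega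
      have hsub : (Finset.univ.filter fun j => classOf c j = i) ⊆ Mc m ε := fun j hj => by
        by_contra h
        exact hi0 ((Finset.mem_filter.1 hj).2.symm.trans (classOf_of_notMem h))
      refine le_trans ?_ (Finset.sum_le_sum_of_subset hsub)
      rw [numMachines, mul_comm]
      refine Finset.card_nsmul_le_sum _ _ _ fun j' hj' => ?_
      exact hS i hi j hj hpos j' (hsub hj') (Finset.mem_filter.1 hj').2
    · have : ∑ j ∈ Mr m ε, countOf (InClass ε i) S j = 0 :=
        Finset.sum_eq_zero fun j hj => Nat.eq_zero_of_not_pos fun h => hex ⟨j, hj, h⟩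
      rw [this, zero_add]
      exact hc.capacity_mul_le i hi
  have h₂ : ∑ i ∈ classes ε, weight ε i * (∑ j ∈ Mr m ε, countOf (InClass ε i) S j) +
      2 * ∑ i ∈ classes ε, numMachines c i ≤
      2 * ∑ i ∈ classes ε, numMachines c i + 2 * (m - mu m ε) := by
    refine le_trans ?_ hc.sum_le
    rw [Finset.mul_sum, ← Finset.sum_add_distrib]
    refine Finset.sum_le_sum fun i hi => ?_
    refine le_trans (le_of_eq ?_) (Nat.mul_le_mul_left _ (h₁ i hi))
    rw [← capacity_mul_weight ε i]
    ring
  rw [Finset.sum_comm]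
  simp only [← Finset.mul_sum]
  omega

theorem OverflowOnly.concat_Mr (hε : 0 < ε) (hε' : ε ≤ 1 / 2) {c : Fin (mu m ε) → ℕ}
    {S : Schedule m} (hS : OverflowOnly ε c S) {q : ℝ} {i : ℕ} (hi : i ∈ classes ε)
    (hiq : InClass ε i q)
    (hfull : ∀ j ∈ Mc m ε, classOf c j = i → capacity ε i ≤ countOf (InClass ε i) S j)
    {v : Fin m} : OverflowOnly ε c (S ++ [(q, v)]) := by
  intro i' hi' j hj hpos j' hj' hclass
  rw [countOf_concat] at hpos ⊢
  refine le_add_of_le_of_nonneg ?_ (Nat.zero_le _)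
  by_cases h : v = j ∧ InClass ε i' q
  · obtain rfl := inClass_unique hε hε' hi hi' hiq h.2
    exact hfull j' hj' hclass
  · rw [if_neg h, add_zero] at hpos
    exact hS i' hi' j hj hpos j' hj' hclass

/-- A large job fits on a class machine or on a reserve machine. -/
theorem Invariant.exists_fits_Mr (hε : 0 < ε) (hε' : ε ≤ 1 / 2)
    {c : Fin (mu m ε) → ℕ} {T : Schedule m} (hc : Suitable c (T.map Prod.fst))
    (hT : ∀ j, load T j ≤ 1) (hpos : ∀ q ∈ T.map Prod.fst, 0 < q) {S : Schedule m} {q : ℝ}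
    (hS : Invariant ε c S) (hpre : S.map Prod.fst ++ [q] <+: T.map Prod.fst) {i : ℕ}
    (hi : i ∈ classes ε) (hiq : InClass ε i q)
    (hfull : ∀ j ∈ Mc m ε, classOf c j = i → capacity ε i ≤ countOf (InClass ε i) S j)
    (hMr : (Mr m ε).Nonempty) :
    ∃ j ∈ Mr m ε, load S j + q ≤ 4 / 3 + ε := by
  by_contra hcon
  push Not at hcon
  obtain ⟨j₀, hj₀⟩ := hMr
  have hd : 0 < eps' ε := by unfold eps'; linarith
  have hd8 : ε = 8 * eps' ε := by unfold eps'; ring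
  have h1 : ∀ q' ∈ T.map Prod.fst, q' ≤ 1 := fun q' h => le_one_of_mem_map_fst hT hpos h
  have hq1 : q ≤ 1 := h1 q (hpre.subset (by simp))
  have hmem : ∀ q' ∈ S.map Prod.fst, q' ∈ T.map Prod.fst := fun q' h =>
    hpre.subset (by simp [h])
  have hsmall := not_isSmall_of_inClass hε hε' hi hiq
  let f : Fin m → ℕ := fun j => ∑ i ∈ classes ε, weight ε i * countOf (InClass ε i) S j
  have hf : ∀ j, weightOn (fun q => (jobWeight ε q : ℝ)) S j = f j := by
    intro j
    rw [weightOn_jobWeight]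
    simp [f]
  -- Reserve machines have no small jobs, so the weight alone bounds the load. Note that 4/3 + ε is
  -- exactly 2(2/3 + 4ε').
  have hload : ∀ j ∈ Mr m ε, load S j ≤ (2 / 3 + 4 * eps' ε) * f j := by
    intro j hj
    rw [← hf, ← weightOn_mul]
    have h₁ : load S j ≤ weightOn (fun q => (2 / 3 + 4 * eps' ε) * (jobWeight ε q : ℝ)) S j +
        loadOf (IsSmall ε) S j := by
      rw [load_eq_weightOn, loadOf_eq_weightOn, ← weightOn_add]
      refine weightOn_mono (fun q hq => ?_) j
      split_ifs with h
      · exact le_add_of_nonneg_left (by positivity)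
      · rw [add_zero]
        exact le_jobWeight_mul hε hε' (h1 q (hmem q hq)) h
    rwa [hS.small_Mr j hj, add_zero] at h₁
  -- The weight bound is applied to the schedule with q put on an arbitrary reserve machine; it does
  -- not require that q fits there.
  have hsum : ∑ j ∈ Mr m ε, f j + jobWeight ε q ≤ 2 * (m - mu m ε) := by
    have h := sum_weight_Mr_le hc (S := S ++ [(q, j₀)]) (by simpa using hpre)
      (hS.overflow.concat_Mr hε hε' hi hiq hfull)
    refine le_trans (le_of_eq ?_) h
    simp only [countOf_concat, mul_add, Finset.sum_add_distrib]
    congr 1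
    rw [Finset.sum_eq_single_of_mem j₀ hj₀ fun j _ hj => Finset.sum_eq_zero fun i _ => by
      rw [if_neg fun h => hj h.1.symm, mul_zero]]
    simp [jobWeight]
  have hqw := le_jobWeight_mul hε hε' hq1 hsmall
  have hq0 : 0 < q := hpos q (hpre.subset (by simp))
  have hcard := card_Mr (m := m) hε
  have hfac : 0 < 2 / 3 + 4 * eps' ε := by linarith
  have hw : jobWeight ε q ≠ 0 := by
    intro h
    rw [h] at hqw
    norm_num at hqw
    linarith
  -- If q has weight 1, every reserve machine has load above 2/3 + 4ε' and so weight at least 2;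
  -- there is no room left for the weight of q. If q has weight 2, every reserve machine is in use,
  -- and any two together have load above 4/3 + ε, hence weight above 2; so at most one has weight
  -- 1, and the total including q is at least 2(m-μ) + 1.
  rcases Nat.lt_or_ge (jobWeight ε q) 2 with hlt | hge
  · have hw1 : jobWeight ε q = 1 := by omega
    rw [hw1, Nat.cast_one, mul_one] at hqw
    have h₂ : ∀ j ∈ Mr m ε, 2 ≤ f j := by
      intro j hj
      have h₃ : (2 / 3 + 4 * eps' ε) * 1 < (2 / 3 + 4 * eps' ε) * f j := by
        linarith [hcon j hj, hload j hj]
      have : (1 : ℝ) < f j := lt_of_mul_lt_mul_left h₃ hfac.le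
      exact_mod_cast this
    have h₃ : (Mr m ε).card * 2 ≤ ∑ j ∈ Mr m ε, f j := Finset.card_nsmul_le_sum _ _ _ h₂
    rw [hcard] at h₃
    omega
  · have hload_pos : ∀ j ∈ Mr m ε, 0 < load S j := fun j hj => by linarith [hcon j hj]
    have h₂ : (2 : ℝ) * (Mr m ε).card - (2 - 1) ≤ ∑ j ∈ Mr m ε, (f j : ℝ) := by
      refine mul_card_sub_le_sum (by norm_num) (fun j hj => ?_) fun j hj j' hj' hne => ?_
      · have h₃ : (2 / 3 + 4 * eps' ε) * 0 < (2 / 3 + 4 * eps' ε) * f j := by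
          linarith [hload_pos j hj, hload j hj]
        have : (0 : ℝ) < f j := lt_of_mul_lt_mul_left h₃ hfac.le
        exact_mod_cast this
      · have h₃ := hS.pair_Mr j hj j' hj' hne rfl (hload_pos j hj) (hload_pos j' hj')
        have h₄ : (2 / 3 + 4 * eps' ε) * 2 < (2 / 3 + 4 * eps' ε) * (f j + f j') := by
          linarith [hload j hj, hload j' hj']
        have h₅ : (2 : ℝ) < f j + f j' := lt_of_mul_lt_mul_left h₄ hfac.le
        have h₆ : 2 < f j + f j' := by exact_mod_cast h₅
        have h₇ : 2 ≤ f j ∨ 2 ≤ f j' := by omega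
        exact_mod_cast h₇
    rw [hcard] at h₂
    have h₃ : ((∑ j ∈ Mr m ε, f j : ℕ) : ℝ) = ∑ j ∈ Mr m ε, (f j : ℝ) := by push_cast; rfl
    rw [← h₃] at h₂
    have h₄ : 2 * (m - mu m ε) ≤ ∑ j ∈ Mr m ε, f j + 1 := by
      have : (2 : ℝ) * ((m - mu m ε : ℕ) : ℝ) ≤ ((∑ j ∈ Mr m ε, f j : ℕ) : ℝ) + 1 := by linarith
      exact_mod_cast this
    omega

/-- The targeted loads and the small jobs do not exceed the total processing time. -/
theorem sum_loadMin_add_small_le (hε : 0 < ε) (hε' : ε ≤ 1 / 2) {c : Fin (mu m ε) → ℕ}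
    {T : Schedule m} (hc : Suitable c (T.map Prod.fst))
    (hT : ∀ j, load T j ≤ 1) (hpos : ∀ q ∈ T.map Prod.fst, 0 < q) {S : Schedule m}
    (hpre : S.map Prod.fst <+: T.map Prod.fst) :
    ∑ j ∈ Mc m ε, (loadMin ε (classOf c j) + loadOf (IsSmall ε) S j) ≤ m := by
  have hmin0 : loadMin ε 0 = 0 := by simp [loadMin]
  have h₁ : ∑ j ∈ Mc m ε, loadMin ε (classOf c j) =
      ∑ i ∈ classes ε, numMachines c i * loadMin ε i := by
    have h₂ : ∑ j ∈ Mc m ε, loadMin ε (classOf c j) = ∑ j, loadMin ε (classOf c j) :=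
      Finset.sum_subset (Finset.subset_univ _) fun j _ hj => by
        rw [classOf_of_notMem hj, hmin0]
    rw [h₂, ← Finset.sum_fiberwise_of_maps_to (g := classOf c) (t := insert 0 (classes ε))
      (fun j _ => hc.classOf_mem j), Finset.sum_insert (by simp [classes])]
    have h₃ : ∀ i, ∑ j : Fin m with classOf c j = i, loadMin ε (classOf c j) =
        numMachines c i * loadMin ε i := by
      intro i
      rw [Finset.sum_congr rfl fun j hj => by rw [(Finset.mem_filter.1 hj).2], Finset.sum_const,
        nsmul_eq_mul, numMachines]
    simp only [h₃, hmin0, mul_zero, zero_add]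
  have h₂ : ∀ i ∈ classes ε, numMachines c i * loadMin ε i ≤
      ((T.map Prod.fst).map fun q => if InClass ε i q then loadMin ε i / capacity ε i else 0).sum := by
    intro i hi
    have hcap : (0 : ℝ) < capacity ε i := by exact_mod_cast capacity_pos ε i
    have hmin := loadMin_nonneg hε (Finset.mem_insert_of_mem hi)
    have h : (capacity ε i : ℝ) * numMachines c i ≤
        (T.map Prod.fst).countP (fun q => InClass ε i q) := by
      exact_mod_cast hc.capacity_mul_le i hi
    rw [sum_map_ite_eq_countP]
    calc (numMachines c i : ℝ) * loadMin ε i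
        = capacity ε i * numMachines c i * (loadMin ε i / capacity ε i) := by field_simp
      _ ≤ _ := by gcongr
  have h₃ : ∑ j ∈ Mc m ε, loadOf (IsSmall ε) S j ≤
      ((T.map Prod.fst).map fun q => if IsSmall ε q then q else 0).sum := by
    refine (Finset.sum_le_univ_sum_of_nonneg fun j => loadOf_nonneg (fun q hq =>
      (hpos q (hpre.subset hq)).le) _ j).trans ?_
    simp only [loadOf_eq_weightOn, sum_weightOn]
    refine sum_map_le_of_prefix hpre fun q hq => ?_
    split_ifs
    · exact (hpos q hq).le
    · exact le_rfl
  rw [Finset.sum_add_distrib, h₁]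
  refine (add_le_add (Finset.sum_le_sum h₂) h₃).trans ?_
  rw [← sum_map_finset_sum, ← List.sum_map_add]
  refine le_trans ?_ (sum_map_fst_le hT)
  conv_rhs => rw [← List.map_id' (T.map Prod.fst)]
  refine List.sum_le_sum fun q hq => ?_
  by_cases h : IsSmall ε q
  · rw [sum_ite_inClass_eq_zero hε hε' (fun i => loadMin ε i / capacity ε i) h, if_pos h, zero_add]
  · obtain ⟨i, hi, hiq⟩ := exists_inClass hε hε' h (le_one_of_mem_map_fst hT hpos hq)
    rw [sum_ite_inClass hε hε' (fun i => loadMin ε i / capacity ε i) hi hiq, if_neg h, add_zero,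
      div_le_iff₀ (by exact_mod_cast capacity_pos ε i), mul_comm]
    exact loadMin_le_capacity_mul hi hiq

/-- A small job fits on a class machine. -/
theorem Invariant.exists_fits_Mc (hε : 0 < ε) (hε' : ε ≤ 1 / 2)
    (hm : 2 * (l ε : ℝ) / eps' ε ^ 2 ≤ m) {c : Fin (mu m ε) → ℕ} {T : Schedule m}
    (hc : Suitable c (T.map Prod.fst))
    (hT : ∀ j, load T j ≤ 1) (hpos : ∀ q ∈ T.map Prod.fst, 0 < q) {S : Schedule m} {q : ℝ}
    (hS : Invariant ε c S) (hpre : S.map Prod.fst <+: T.map Prod.fst) (hq : IsSmall ε q) :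
    ∃ j ∈ Mc m ε, loadMax ε (classOf c j) + loadOf (IsSmall ε) S j + q ≤ 4 / 3 + ε := by
  by_contra hcon
  push Not at hcon
  have hd : 0 < eps' ε := by unfold eps'; linarith
  have hd' : eps' ε ≤ 1 / 16 := by unfold eps'; linarith
  have hd8 : ε = 8 * eps' ε := by unfold eps'; ring
  have hq : q ≤ 1 / 3 + 2 * eps' ε := hq
  have hsmall : ∀ j, 0 ≤ loadOf (IsSmall ε) S j := loadOf_nonneg
    (fun q hq => (hpos q (hpre.subset hq)).le) _
  let g : Fin m → ℝ := fun j => loadMin ε (classOf c j) + loadOf (IsSmall ε) S j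
  have hgroup : ∀ i ∈ insert 0 (classes ε),
      (1 + 2 * eps' ε) * ((Mc m ε).filter fun j => classOf c j = i).card - (1 + 2 * eps' ε - 0) ≤
      ∑ j ∈ (Mc m ε).filter fun j => classOf c j = i, g j := by
    intro i hi
    have hmin := loadMin_nonneg hε hi
    refine mul_card_sub_le_sum (by linarith) (fun j hj => ?_) fun j hj j' hj' hne => ?_
    · have := hsmall j
      have := (Finset.mem_filter.1 hj).2
      simp only [g, this]
      linarith
    · obtain ⟨hj, hji⟩ := Finset.mem_filter.1 hj
      obtain ⟨hj', hji'⟩ := Finset.mem_filter.1 hj'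
      have h₁ := hcon j hj
      have h₂ := hcon j' hj'
      have h₃ := hS.pair_Mc j hj j' hj' hne (hji.trans hji'.symm)
      have h₄ := hsmall j
      have h₅ := hsmall j'
      simp only [g, hji, hji'] at h₁ h₂ h₃ ⊢
      -- On a class-0 machine the small load alone exceeds 4/3 + 8ε' - q ≥ 1 + 6ε'.
      rcases Finset.mem_insert.1 hi with rfl | hi
      · left
        simp only [loadMax, loadMin, if_true] at h₁ ⊢
        linarith
      · rcases le_loadMin_or hε hε' hi with h | ⟨hmax, hle⟩
        · left
          linarith
        -- As ℓ⁺ ≤ 1 + 2ε', a machine without small jobs would have room for q; so both machines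
        -- have some, and together these exceed 4/3 + 8ε' - ℓ⁺. Adding 2ℓ⁻ ≥ ℓ⁺ + 2/3 - 4ε' gives
        -- more than 2(1 + 2ε').
        · have h₆ := h₃ (by linarith) (by linarith)
          by_contra hlt
          push Not at hlt
          linarith [hlt.1, hlt.2]
  have hsum := Finset.sum_le_sum hgroup
  rw [Finset.sum_fiberwise_of_maps_to (fun j _ => hc.classOf_mem j), Finset.sum_sub_distrib,
    ← Finset.mul_sum, ← Nat.cast_sum, ← Finset.card_eq_sum_card_fiberwise
      (fun j _ => hc.classOf_mem j), card_Mc hε, Finset.sum_const, nsmul_eq_mul] at hsum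
  have hl : (2 : ℝ) ≤ l ε := by exact_mod_cast two_le_l ε
  have hcard : ((insert 0 (classes ε)).card : ℝ) = 2 * l ε := by
    have h : (insert 0 (classes ε)).card = 2 * l ε := by
      rw [Finset.card_insert_of_notMem (by simp [classes]), classes, Nat.card_Icc]
      have := two_le_l ε
      omega
    rw [h]
    push_cast
    rfl
  have hupper := sum_loadMin_add_small_le hε hε' hc hT hpos hpre
  have hmu := le_mu m hε
  have h₁ : (2 * l ε : ℝ) ≤ m * eps' ε ^ 2 := by rwa [div_le_iff₀ (by positivity)] at hm
  -- The 2l groups (2l-1 classes and class 0) lose at most 1 + 2ε' each, so (1+ε')m - 2l(1+2ε') ≤ m.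
  -- This contradicts m ≥ 2l/ε'².
  have h₂ : (m : ℝ) * eps' ε ≤ (1 + 2 * eps' ε) * (2 * l ε) := by
    rw [hcard] at hsum
    have := hsum.trans hupper
    linarith
  have h₃ : (m : ℝ) * eps' ε * eps' ε ≤ (1 + 2 * eps' ε) * (2 * l ε) * eps' ε := by gcongr
  have h₄ : (1 + 2 * eps' ε) * eps' ε < 1 := by nlinarith
  nlinarith

theorem Invariant.concat_small (hε : 0 < ε) (hε' : ε ≤ 1 / 2) {c : Fin (mu m ε) → ℕ}
    {S : Schedule m} (hS : Invariant ε c S) (hpos : ∀ q ∈ S.map Prod.fst, 0 ≤ q) {q : ℝ}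
    (hq0 : 0 ≤ q) (hq : IsSmall ε q) {v : Fin m} (hv : v ∈ Mc m ε)
    (hfit : loadMax ε (classOf c v) + loadOf (IsSmall ε) S v + q ≤ 4 / 3 + ε)
    (hnew : loadOf (IsSmall ε) S v = 0 → ∀ j ∈ Mc m ε, 0 < loadOf (IsSmall ε) S j →
      4 / 3 + ε < loadMax ε (classOf c j) + loadOf (IsSmall ε) S j + q) :
    Invariant ε c (S ++ [(q, v)]) := by
  have hcount : ∀ i ∈ classes ε, ∀ j,
      countOf (InClass ε i) (S ++ [(q, v)]) j = countOf (InClass ε i) S j := by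
    intro i hi j
    rw [countOf_concat, if_neg fun h => not_isSmall_of_inClass hε hε' hi h.2 hq, add_zero]
  have hsmall : loadOf (IsSmall ε) (S ++ [(q, v)]) =
      fun j => loadOf (IsSmall ε) S j + if v = j then q else 0 := by
    funext j
    rw [loadOf_concat]
    simp [hq]
  have hne : ∀ j ∈ Mr m ε, v ≠ j := fun j hj h => notMem_Mc_of_mem_Mr hj (h ▸ hv)
  refine ⟨fun i hi j hj => ?_, fun j hj => ?_, ?_, fun j hj => ?_, ?_, fun i hi j hj h j' hj' => ?_⟩
  · rw [hcount i hi]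
    exact hS.count_le i hi j hj
  · rw [hsmall]
    dsimp only
    by_cases h : v = j
    · subst h
      rw [if_pos rfl]
      linarith
    · rw [if_neg h, add_zero]
      exact hS.load_Mc j hj
  · rw [hsmall]
    refine hS.pair_Mc.add (fun j _ => loadOf_nonneg hpos _ j) hq0 hv fun h₀ j hj _ hj₀ => ?_
    linarith [hnew h₀ j hj hj₀]
  · rw [hsmall]
    dsimp only
    rw [if_neg (hne j hj), add_zero]
    exact hS.small_Mr j hj
  · refine hS.pair_Mr.congr fun j hj => ?_
    rw [load_concat, if_neg (hne j hj), add_zero]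
  · rw [hcount i hi] at h ⊢
    exact hS.overflow i hi j hj h j' hj'

theorem Invariant.concat_large_Mc (hε : 0 < ε) (hε' : ε ≤ 1 / 2) {c : Fin (mu m ε) → ℕ}
    {S : Schedule m} (hS : Invariant ε c S) {q : ℝ} {i : ℕ} (hi : i ∈ classes ε)
    (hiq : InClass ε i q) {v : Fin m} (hv : v ∈ Mc m ε) (hclass : classOf c v = i)
    (hcount : countOf (InClass ε i) S v < capacity ε i) :
    Invariant ε c (S ++ [(q, v)]) := by
  have hsmall : loadOf (IsSmall ε) (S ++ [(q, v)]) = loadOf (IsSmall ε) S := by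
    funext j
    rw [loadOf_concat, if_neg fun h => not_isSmall_of_inClass hε hε' hi hiq h.2, add_zero]
  have hne : ∀ j ∈ Mr m ε, v ≠ j := fun j hj h => notMem_Mc_of_mem_Mr hj (h ▸ hv)
  refine ⟨fun i' hi' j hj => ?_, ?_, ?_, ?_, ?_, fun i' hi' j hj h j' hj' hj'' => ?_⟩
  · rw [countOf_concat]
    by_cases h : v = j ∧ InClass ε i' q
    · obtain rfl := inClass_unique hε hε' hi hi' hiq h.2
      obtain rfl := h.1
      rw [if_pos h, if_pos hclass]
      exact hcount
    · rw [if_neg h]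
      exact hS.count_le i' hi' j hj
  · rw [hsmall]
    exact hS.load_Mc
  · rw [hsmall]
    exact hS.pair_Mc
  · rw [hsmall]
    exact hS.small_Mr
  · refine hS.pair_Mr.congr fun j hj => ?_
    rw [load_concat, if_neg (hne j hj), add_zero]
  · rw [countOf_concat, if_neg fun h => hne j hj h.1, add_zero] at h
    rw [countOf_concat]
    exact le_add_of_le_of_nonneg (hS.overflow i' hi' j hj h j' hj' hj'') (Nat.zero_le _)

/-- Choosing the largest load among the fitting machines means that an empty machine is taken only
if the job fits on no reserve machine in use; this preserves `pair_Mr`. -/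
theorem Invariant.concat_large_Mr (hε : 0 < ε) (hε' : ε ≤ 1 / 2) {c : Fin (mu m ε) → ℕ}
    {S : Schedule m} (hS : Invariant ε c S) (hpos : ∀ q ∈ S.map Prod.fst, 0 ≤ q) {q : ℝ}
    (hq0 : 0 ≤ q) {i : ℕ} (hi : i ∈ classes ε) (hiq : InClass ε i q)
    (hfull : ∀ j ∈ Mc m ε, classOf c j = i → capacity ε i ≤ countOf (InClass ε i) S j)
    {v : Fin m} (hv : v ∈ Mr m ε)
    (hmax : ∀ j ∈ Mr m ε, load S j + q ≤ 4 / 3 + ε → load S j ≤ load S v) :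
    Invariant ε c (S ++ [(q, v)]) := by
  have hsmall : loadOf (IsSmall ε) (S ++ [(q, v)]) = loadOf (IsSmall ε) S := by
    funext j
    rw [loadOf_concat, if_neg fun h => not_isSmall_of_inClass hε hε' hi hiq h.2, add_zero]
  have hne : ∀ j ∈ Mc m ε, v ≠ j := fun j hj h => notMem_Mc_of_mem_Mr hv (h ▸ hj)
  refine ⟨fun i' hi' j hj => ?_, ?_, ?_, ?_, ?_, hS.overflow.concat_Mr hε hε' hi hiq hfull⟩
  · rw [countOf_concat, if_neg fun h => hne j hj h.1, add_zero]
    exact hS.count_le i' hi' j hj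
  · rw [hsmall]
    exact hS.load_Mc
  · rw [hsmall]
    exact hS.pair_Mc
  · rw [hsmall]
    exact hS.small_Mr
  · have hload : load (S ++ [(q, v)]) = fun j => load S j + if v = j then q else 0 := by
      funext j
      rw [load_concat]
    rw [hload]
    refine hS.pair_Mr.add (fun j _ => load_nonneg hpos j) hq0 hv fun h₀ j hj _ hj₀ => ?_
    by_contra h
    have := hmax j hj (not_lt.1 h)
    linarith

theorem Invariant.exists_next (hε : 0 < ε) (hε' : ε ≤ 1 / 2)
    (hm : 2 * (l ε : ℝ) / eps' ε ^ 2 ≤ m) (hMr : (Mr m ε).Nonempty) {c : Fin (mu m ε) → ℕ}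
    {T : Schedule m} (hc : Suitable c (T.map Prod.fst))
    (hT : ∀ j, load T j ≤ 1) (hpos : ∀ q ∈ T.map Prod.fst, 0 < q) {S : Schedule m} {q : ℝ}
    (hS : Invariant ε c S) (hpre : S.map Prod.fst ++ [q] <+: T.map Prod.fst)
    {α : Type} (tie : TieBreak m α) (x : α) :
    ∃ j, tie.first x (preferences ε c S q) = some j ∧ load S j + q ≤ 4 / 3 + ε ∧
      Invariant ε c (S ++ [(q, j)]) := by
  have hpre' := (List.prefix_append _ [q]).trans hpre
  have hq : q ∈ T.map Prod.fst := hpre.subset (by simp)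
  have hq0 := (hpos q hq).le
  have hS0 : ∀ q ∈ S.map Prod.fst, 0 ≤ q := fun q hq => (hpos q (hpre'.subset hq)).le
  have h1 : ∀ q ∈ T.map Prod.fst, q ≤ 1 := fun q hq => le_one_of_mem_map_fst hT hpos hq
  have hload : ∀ j ∈ Mc m ε, Invariant ε c (S ++ [(q, j)]) → load S j + q ≤ 4 / 3 + ε := by
    intro j hj hinv
    have h := hinv.load_le hε hε' hc.classOf_mem (fun q' hq' => h1 q' (hpre.subset ?_)) hj
    · rwa [load_concat, if_pos rfl] at h
    · rwa [List.map_append] at hq'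
  unfold preferences
  by_cases hsmall : IsSmall ε q
  · rw [if_pos hsmall]
    by_cases hne : ((Mc m ε).filter fun j => 0 < loadOf (IsSmall ε) S j ∧
        loadMax ε (classOf c j) + loadOf (IsSmall ε) S j + q ≤ 4 / 3 + ε).Nonempty
    · obtain ⟨j, hj, hfirst⟩ := tie.first_cons_of_nonempty x
        [argminOn ((Mc m ε).filter fun j => loadOf (IsSmall ε) S j = 0 ∧
          loadMax ε (classOf c j) + q ≤ 4 / 3 + ε) fun j => loadMin ε (classOf c j), Mc m ε] hne
      obtain ⟨hj, hj', hfit⟩ := Finset.mem_filter.1 hj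
      have hinv := hS.concat_small hε hε' hS0 hq0 hsmall hj hfit fun h => absurd h hj'.ne'
      exact ⟨j, hfirst, hload j hj hinv, hinv⟩
    · rw [tie.first_cons_of_not_nonempty x _ hne]
      have hno : ∀ j ∈ Mc m ε, 0 < loadOf (IsSmall ε) S j →
          4 / 3 + ε < loadMax ε (classOf c j) + loadOf (IsSmall ε) S j + q := by
        intro j hj hj'
        by_contra h
        exact hne ⟨j, Finset.mem_filter.2 ⟨hj, hj', not_lt.1 h⟩⟩
      have hne' : ((Mc m ε).filter fun j => loadOf (IsSmall ε) S j = 0 ∧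
          loadMax ε (classOf c j) + q ≤ 4 / 3 + ε).Nonempty := by
        obtain ⟨j, hj, hfit⟩ := hS.exists_fits_Mc hε hε' hm hc hT hpos hpre' hsmall
        have h₀ : loadOf (IsSmall ε) S j = 0 := by
          rcases (loadOf_nonneg hS0 (IsSmall ε) j).eq_or_lt with h | h
          · exact h.symm
          · exact absurd hfit (not_le.2 (hno j hj h))
        refine ⟨j, Finset.mem_filter.2 ⟨hj, h₀, ?_⟩⟩
        rwa [h₀, add_zero] at hfit
      obtain ⟨j, hj, hfirst⟩ := tie.first_cons_of_nonempty x [Mc m ε]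
        (argminOn_nonempty (fun j => loadMin ε (classOf c j)) hne')
      obtain ⟨hj, h₀, hfit⟩ := Finset.mem_filter.1 (mem_argminOn.1 hj).1
      have hinv := hS.concat_small hε hε' hS0 hq0 hsmall hj (by rwa [h₀, add_zero])
        fun _ => hno
      exact ⟨j, hfirst, hload j hj hinv, hinv⟩
  · obtain ⟨i, hi, hiq⟩ := exists_inClass hε hε' hsmall (h1 q hq)
    rw [if_neg hsmall, if_pos ⟨i, (mem_classes.1 hi).1, (mem_classes.1 hi).2, hiq⟩]
    by_cases hne : ((Mc m ε).filter fun j => ∃ i, 1 ≤ i ∧ i ≤ 2 * l ε - 1 ∧ InClass ε i q ∧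
        classOf c j = i ∧ countOf (InClass ε i) S j < capacity ε i).Nonempty
    · obtain ⟨j, hj, hfirst⟩ := tie.first_cons_of_nonempty x
        [argmaxOn ((Mr m ε).filter fun j => load S j + q ≤ 4 / 3 + ε) fun j => load S j, Mr m ε] hne
      obtain ⟨hj, i', hi1, hi2, hiq', hclass, hcount⟩ := Finset.mem_filter.1 hj
      have hinv := hS.concat_large_Mc hε hε' (mem_classes.2 ⟨hi1, hi2⟩) hiq' hj hclass hcount
      exact ⟨j, hfirst, hload j hj hinv, hinv⟩
    · rw [tie.first_cons_of_not_nonempty x _ hne]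
      have hfull : ∀ j ∈ Mc m ε, classOf c j = i → capacity ε i ≤ countOf (InClass ε i) S j := by
        intro j hj hclass
        by_contra h
        exact hne ⟨j, Finset.mem_filter.2 ⟨hj, i, (mem_classes.1 hi).1, (mem_classes.1 hi).2, hiq,
          hclass, not_le.1 h⟩⟩
      have hne' : ((Mr m ε).filter fun j => load S j + q ≤ 4 / 3 + ε).Nonempty := by
        obtain ⟨j, hj, hfit⟩ := hS.exists_fits_Mr hε hε' hc hT hpos hpre hi hiq hfull hMr
        exact ⟨j, Finset.mem_filter.2 ⟨hj, hfit⟩⟩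
      obtain ⟨j, hj, hfirst⟩ := tie.first_cons_of_nonempty x [Mr m ε]
        (argmaxOn_nonempty (fun j => load S j) hne')
      obtain ⟨hj, hmax⟩ := mem_argmaxOn.1 hj
      obtain ⟨hj, hfit⟩ := Finset.mem_filter.1 hj
      exact ⟨j, hfirst, hfit, hS.concat_large_Mr hε hε' hS0 hq0 hi hiq hfull hj
        fun j' hj' hfit' => hmax j' (Finset.mem_filter.2 ⟨hj', hfit'⟩)⟩

/-- Without reserve machines m₀ would be 0, contrary to m ≤ κ m₀. -/
theorem Mr_nonempty (hm0 : 0 < m) (hε : 0 < ε) (hε' : ε ≤ 1 / 2)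
    (hm : 2 * (l ε : ℝ) / eps' ε ^ 2 ≤ m) : (Mr m ε).Nonempty := by
  have h : (0 : ℝ) < kappa ε * blockSize m ε :=
    lt_of_lt_of_le (by exact_mod_cast hm0) (le_mul_blockSize hε hε' hm)
  rw [← Finset.card_pos, card_Mr hε]
  refine Nat.pos_of_ne_zero fun h₀ => ?_
  simp [blockSize, h₀] at h

end A2

theorem isGood_A2 {m : ℕ} (hm0 : 0 < m) {ε : ℝ} (hε : 0 < ε) (hε' : ε ≤ 1 / 2)
    (hm : 2 * (A2.l ε : ℝ) / A2.eps' ε ^ 2 ≤ m)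
    (tie : TieBreak m (A2.C m ε × ℝ × Schedule m × ℝ)) : IsGood (A2 m ε tie) (4 / 3 + ε) := by
  intro γ hγ τ hτ hopt
  obtain ⟨T, hTτ, hT⟩ := exists_normalized_schedule hm0 hγ hopt
  have hpos : ∀ q ∈ T.map Prod.fst, 0 < q := by
    rw [hTτ]
    simp only [List.mem_map]
    rintro _ ⟨p, hp, rfl⟩
    exact div_pos (hτ p hp) hγ
  obtain ⟨c, hc⟩ := A2.exists_suitable hm0 hε hε' hm
    (A2.sum_weight_mul_countP_le hε hε' hT hpos)
  refine ⟨c, exists_rule_of_invariant hγ (A2.Invariant ε c.1) (A2.Invariant.nil hε hc)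
    fun S p hS hpre => ?_⟩
  rw [← hTτ] at hpre
  exact hS.exists_next hε hε' hm (A2.Mr_nonempty hm0 hε hε' hm) hc hT hpos hpre tie (c, γ, S, p)

theorem isGood_A3 {m : ℕ} (hm : 0 < m) {ε : ℝ} (hε : 0 < ε) (hε' : ε ≤ 1 / 2)
    (ch : A3Choices m ε) : IsGood (A3 m ε ch) (4 / 3 + ε) := by
  unfold A3
  split_ifs with h
  · exact (isGood_A1 hm (by norm_num) ch.one).mono (by linarith)
  · exact isGood_A2 hm hε hε' (not_lt.1 h) ch.two

namespace Star

/-! ### The guesses of the reduction -/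

/-- The position of `g i` in the increasing order of all values, counted from `1`. -/
def guessRank {h : ℕ} (g : Fin h → ℝ) (i : Fin h) : ℕ :=
  (Finset.univ.filter fun i' => g i' ≤ g i).card

/-- The guesses grow geometrically, without large gaps above `X`, and one of them is not much larger
than `X`. -/
structure GuessInvariant {h : ℕ} (δ X : ℝ) (g : Fin h → ℝ) : Prop where
  pos : ∀ i, 0 < g i
  separated : ∀ i i', i ≠ i' → (1 + δ) * g i ≤ g i' ∨ (1 + δ) * g i' ≤ g i
  next : ∀ i, (∀ i', g i' ≤ g i) ∨ ∃ i', g i < g i' ∧ g i' ≤ (1 + δ) * max (g i) X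
  exists_le : ∃ i, g i ≤ (1 + δ) * X

section guesses

variable {h : ℕ} {δ X : ℝ} {g : Fin h → ℝ}

theorem guessRank_pos (g : Fin h → ℝ) (i : Fin h) : 1 ≤ guessRank g i :=
  Finset.card_pos.2 ⟨i, by simp⟩

theorem guessRank_le (g : Fin h → ℝ) (i : Fin h) : guessRank g i ≤ h :=
  (Finset.card_le_univ _).trans (by simp)

theorem guessRank_mono {i i' : Fin h} (hi : g i ≤ g i') : guessRank g i ≤ guessRank g i' := by
  refine Finset.card_le_card fun j hj => ?_
  simp only [Finset.mem_filter, Finset.mem_univ, true_and] at hj ⊢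
  exact hj.trans hi

theorem guessRank_strictMono {i i' : Fin h} (hi : g i < g i') : guessRank g i < guessRank g i' := by
  refine Finset.card_lt_card ((Finset.ssubset_iff_of_subset fun j hj => ?_).2 ⟨i', ?_, ?_⟩)
  · simp only [Finset.mem_filter, Finset.mem_univ, true_and] at hj ⊢
    exact hj.trans hi.le
  · simp
  · simpa using hi

theorem lt_of_guessRank_lt {i i' : Fin h} (hi : guessRank g i < guessRank g i') : g i < g i' := by
  by_contra hcon
  exact absurd (guessRank_mono (not_lt.1 hcon)) (not_le.2 hi)

theorem GuessInvariant.separated_of_lt (hg : GuessInvariant δ X g) (hδ : 0 < δ) {i i' : Fin h}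
    (hi : g i < g i') : (1 + δ) * g i ≤ g i' := by
  have hne : i ≠ i' := fun hne => by rw [hne] at hi; exact lt_irrefl _ hi
  refine (hg.separated i i' hne).resolve_right fun h' => ?_
  nlinarith [hg.pos i']

theorem GuessInvariant.injective (hg : GuessInvariant δ X g) (hδ : 0 < δ) :
    Function.Injective g := by
  intro i i' hi
  by_contra hne
  have h₁ := hg.pos i
  have h₂ := hg.pos i'
  rcases hg.separated i i' hne with h | h <;> rw [hi] at h <;> nlinarith

/-- Separated guesses are distinct, so the ranks are injective into {1, …, h} and exhaust it. -/
theorem GuessInvariant.exists_guessRank_eq (hg : GuessInvariant δ X g) (hδ : 0 < δ) {r : ℕ}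
    (h1 : 1 ≤ r) (hr : r ≤ h) : ∃ i, guessRank g i = r := by
  have hinj : Function.Injective (guessRank g) := by
    intro i i' hi
    refine hg.injective hδ (le_antisymm ?_ ?_) <;> refine not_lt.1 fun hlt => ?_
    · exact absurd (guessRank_strictMono hlt) (by omega)
    · exact absurd (guessRank_strictMono hlt) (by omega)
  have himage : Finset.univ.image (guessRank g) = Finset.Icc 1 h := by
    refine Finset.eq_of_subset_of_card_le (fun r hr => ?_) ?_
    · obtain ⟨i, -, rfl⟩ := Finset.mem_image.1 hr
      exact Finset.mem_Icc.2 ⟨guessRank_pos g i, guessRank_le g i⟩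
    · rw [Finset.card_image_of_injective _ hinj]
      simp
  have : r ∈ Finset.univ.image (guessRank g) := by
    rw [himage]
    exact Finset.mem_Icc.2 ⟨h1, hr⟩
  obtain ⟨i, -, hi⟩ := Finset.mem_image.1 this
  exact ⟨i, hi⟩

theorem le_iSup_guess (g : Fin h → ℝ) (i : Fin h) : g i ≤ ⨆ i', g i' :=
  le_ciSup (Set.finite_range _).bddAbove i

/-- Each of the n ranks above that of guess i contributes a factor of at least 1+δ. -/
theorem GuessInvariant.pow_mul_le (hg : GuessInvariant δ X g) (hδ : 0 < δ) (n : ℕ) (i : Fin h)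
    (hn : guessRank g i + n = h) : (1 + δ) ^ n * g i ≤ ⨆ i', g i' := by
  induction n generalizing i with
  | zero => simpa using le_iSup_guess g i
  | succ n ih =>
    obtain ⟨i', hi'⟩ := hg.exists_guessRank_eq hδ (show 1 ≤ guessRank g i + 1 by omega) (by omega)
    have h₁ := hg.separated_of_lt hδ (lt_of_guessRank_lt (show guessRank g i < guessRank g i' by omega))
    refine le_trans ?_ (ih i' (by omega))
    rw [pow_succ, mul_assoc]
    gcongr

/-- An adjusted guess is much larger than the old one. -/
theorem GuessInvariant.pow_mul_le_adjusted (hg : GuessInvariant δ X g) (hδ : 0 < δ) {M : ℝ}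
    (hM : ∀ i, g i ≤ M) (i : Fin h) : (1 + δ) ^ h * g i ≤ (1 + δ) ^ guessRank g i * M := by
  have : Nonempty (Fin h) := ⟨i⟩
  have h₁ := hg.pow_mul_le hδ (h - guessRank g i) i (by have := guessRank_le g i; omega)
  calc (1 + δ) ^ h * g i = (1 + δ) ^ guessRank g i * ((1 + δ) ^ (h - guessRank g i) * g i) := by
        rw [← mul_assoc, ← pow_add, Nat.add_sub_cancel' (guessRank_le g i)]
    _ ≤ _ := by
      gcongr
      exact h₁.trans (ciSup_le hM)

theorem mul_le_pow_guessRank_mul (g : Fin h → ℝ) (hδ : 0 < δ) {M : ℝ} (hM : 0 ≤ M) (i : Fin h) :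
    (1 + δ) * M ≤ (1 + δ) ^ guessRank g i * M := by
  refine mul_le_mul_of_nonneg_right ?_ hM
  calc 1 + δ = (1 + δ) ^ 1 := (pow_one _).symm
    _ ≤ _ := pow_le_pow_right₀ (by linarith) (guessRank_pos g i)

/-- Adjusting all guesses up to a guess that is smaller than `X`. -/
theorem GuessInvariant.adjust (hg : GuessInvariant δ X g) (hδ : 0 < δ) {s : Fin h} (hs : g s < X)
    {B : ℝ} (hB : B ≤ X) {g' : Fin h → ℝ}
    (h_adj : ∀ i, g i ≤ g s → g' i = (1 + δ) ^ guessRank g i * max (⨆ i', g i') B)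
    (h_keep : ∀ i, ¬ g i ≤ g s → g' i = g i) : GuessInvariant δ X g' := by
  have hne : Nonempty (Fin h) := ⟨s⟩
  set M := max (⨆ i', g i') B with hM
  have hgM : ∀ i, g i ≤ M := fun i => (le_iSup_guess g i).trans (le_max_left _ _)
  have hM0 : 0 < M := (hg.pos s).trans_le (hgM s)
  have hadj_ge : ∀ i, g i ≤ g s → (1 + δ) * M ≤ g' i := fun i hi => by
    rw [h_adj i hi]
    exact mul_le_pow_guessRank_mul g hδ hM0.le i
  obtain ⟨i₁, hi₁⟩ := hg.exists_guessRank_eq hδ le_rfl (show 1 ≤ h from (guessRank_pos g s).trans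
    (guessRank_le g s))
  have hi₁s : g i₁ ≤ g s := by
    by_contra hcon
    have := guessRank_strictMono (not_le.1 hcon)
    have := guessRank_pos g s
    omega
  have hi₁' : g' i₁ = (1 + δ) * M := by rw [h_adj i₁ hi₁s, hi₁, pow_one]
  have hpos' : ∀ i, 0 < g' i := by
    intro i
    by_cases hi : g i ≤ g s
    · exact lt_of_lt_of_le (by positivity) (hadj_ge i hi)
    · rw [h_keep i hi]
      exact hg.pos i
  have hpow : ∀ i i', g i ≤ g s → g i' ≤ g s → guessRank g i < guessRank g i' →
      (1 + δ) * g' i ≤ g' i' := by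
    intro i i' hi hi' hlt
    rw [h_adj i hi, h_adj i' hi', ← mul_assoc, ← pow_succ']
    refine mul_le_mul_of_nonneg_right (pow_le_pow_right₀ (by linarith) hlt) hM0.le
  refine ⟨hpos', fun i i' hne => ?_, fun i => ?_, ?_⟩
  · by_cases hi : g i ≤ g s <;> by_cases hi' : g i' ≤ g s
    · rcases lt_trichotomy (g i) (g i') with hlt | heq | hlt
      · exact Or.inl (hpow i i' hi hi' (guessRank_strictMono hlt))
      · exact absurd (hg.injective hδ heq) hne
      · exact Or.inr (hpow i' i hi' hi (guessRank_strictMono hlt))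
    · right
      rw [h_keep i' hi']
      exact (mul_le_mul_of_nonneg_left (hgM i') (by linarith)).trans (hadj_ge i hi)
    · left
      rw [h_keep i hi]
      exact (mul_le_mul_of_nonneg_left (hgM i) (by linarith)).trans (hadj_ge i' hi')
    · rw [h_keep i hi, h_keep i' hi']
      exact hg.separated i i' hne
  · by_cases hi : g i ≤ g s
    -- The adjusted guesses are the consecutive values (1+δ)^r M, so the successor has rank one
    -- more. The topmost of them exceeds every kept guess.
    · by_cases hmax : ∃ i', g i < g i' ∧ g i' ≤ g s
      · obtain ⟨i', hlt, hi'⟩ := hmax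
        have hr := guessRank_strictMono hlt
        obtain ⟨i'', hi''⟩ := hg.exists_guessRank_eq hδ (show 1 ≤ guessRank g i + 1 by omega)
          (hr.trans_le (guessRank_le g i') : guessRank g i + 1 ≤ h)
        have hi''s : g i'' ≤ g s := by
          refine le_trans ?_ hi'
          by_contra hcon
          have := guessRank_strictMono (not_le.1 hcon)
          omega
        have heq : g' i'' = (1 + δ) * g' i := by
          rw [h_adj i hi, h_adj i'' hi''s, hi'', pow_succ']
          ring
        right
        refine ⟨i'', ?_, ?_⟩
        · rw [heq]
          nlinarith [hpos' i]
        · rw [heq]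
          exact mul_le_mul_of_nonneg_left (le_max_left _ _) (by linarith)
      · left
        intro i'
        by_cases hi' : g i' ≤ g s
        · rw [h_adj i hi, h_adj i' hi']
          refine mul_le_mul_of_nonneg_right (pow_le_pow_right₀ (by linarith) (guessRank_mono ?_))
            hM0.le
          by_contra hcon
          exact hmax ⟨i', not_le.1 hcon, hi'⟩
        · rw [h_keep i' hi']
          refine (hgM i').trans (le_trans ?_ (hadj_ge i hi))
          nlinarith
    · right
      rw [h_keep i hi]
      -- The successor of a kept guess is kept as well. If the guess was the largest one, M ≤ max (g
      -- i) X, and the smallest new guess (1+δ)M takes the place of a successor.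
      rcases hg.next i with hmax | ⟨i', hlt, hle⟩
      · refine ⟨i₁, ?_, ?_⟩
        · rw [hi₁']
          nlinarith [hgM i]
        · rw [hi₁']
          refine mul_le_mul_of_nonneg_left (max_le_max (ciSup_le hmax) hB) (by linarith)
      · have hi' : ¬ g i' ≤ g s := fun h => hi (hlt.le.trans h)
        exact ⟨i', by rwa [h_keep i' hi'], by rwa [h_keep i' hi']⟩
  -- Since g s < X, the old successor of s, which is kept, is at most (1+δ)X. If s was the largest
  -- guess, then M ≤ X and the new guess (1+δ)M will do.
  · rcases hg.next s with hmax | ⟨i', hlt, hle⟩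
    · refine ⟨i₁, ?_⟩
      rw [hi₁']
      exact mul_le_mul_of_nonneg_left (max_le ((ciSup_le hmax).trans hs.le) hB) (by linarith)
    · refine ⟨i', ?_⟩
      rw [h_keep i' (not_le.2 hlt)]
      rwa [max_eq_right hs.le] at hle

theorem guessInvariant_init (hδ : 0 < δ) (hh : 0 < h) {p : ℝ} (hp : 0 < p) (hpX : p ≤ X) :
    GuessInvariant δ X fun i : Fin h => p * (1 + δ) ^ (i : ℕ) := by
  have hlt : ∀ i i' : Fin h, (i : ℕ) < i' →
      (1 + δ) * (p * (1 + δ) ^ (i : ℕ)) ≤ p * (1 + δ) ^ (i' : ℕ) := by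
    intro i i' hi
    calc (1 + δ) * (p * (1 + δ) ^ (i : ℕ)) = p * (1 + δ) ^ ((i : ℕ) + 1) := by ring
      _ ≤ _ := mul_le_mul_of_nonneg_left (pow_le_pow_right₀ (by linarith) hi) hp.le
  refine ⟨fun i => by positivity, fun i i' hne => ?_, fun i => ?_, ⟨⟨0, hh⟩, ?_⟩⟩
  · rcases lt_trichotomy (i : ℕ) i' with hi | hi | hi
    · exact Or.inl (hlt i i' hi)
    · exact absurd (Fin.ext hi) hne
    · exact Or.inr (hlt i' i hi)
  · by_cases hi : (i : ℕ) + 1 < h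
    · have heq : p * (1 + δ) ^ ((i : ℕ) + 1) = (1 + δ) * (p * (1 + δ) ^ (i : ℕ)) := by ring
      refine Or.inr ⟨⟨(i : ℕ) + 1, hi⟩, ?_, ?_⟩
      · dsimp only
        rw [heq]
        nlinarith [show 0 < p * (1 + δ) ^ (i : ℕ) by positivity]
      · dsimp only
        rw [heq]
        exact mul_le_mul_of_nonneg_left (le_max_left _ _) (by linarith)
    · refine Or.inl fun i' => mul_le_mul_of_nonneg_left
        (pow_le_pow_right₀ (by linarith) ?_) hp.le
      omega
  · dsimp only
    rw [pow_zero, mul_one]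
    nlinarith

end guesses

end Star

/-! ### Schedules built job by job -/

theorem Algorithm.schedule_nil {m : ℕ} (A : Algorithm m) (k : A.Index) : A.schedule k [] = [] :=
  rfl

theorem Algorithm.schedule_concat {m : ℕ} (A : Algorithm m) (k : A.Index) (L : List ℝ) (p : ℝ) :
    A.schedule k (L ++ [p]) = A.schedule k L ++ [(p, A.assign k L p)] := by
  unfold Algorithm.schedule
  refine List.ext_getElem (by simp) fun n h₁ h₂ => ?_
  simp only [List.length_ofFn, List.length_append, List.length_singleton] at h₁
  rcases Nat.lt_succ_iff_lt_or_eq.1 h₁ with h | h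
  · rw [List.getElem_append_left (by simpa using h)]
    simp only [List.getElem_ofFn, List.get_eq_getElem, List.getElem_append_left h,
      List.take_append_of_le_length h.le]
  · subst h
    rw [List.getElem_append_right (by simp)]
    simp only [List.getElem_ofFn, List.get_eq_getElem, List.getElem_concat_length,
      List.take_left', List.getElem_singleton]

/-- The smallest of the loads is at most the average load. -/
theorem mul_le_sum_of_mem_argminOn {m : ℕ} {f : Fin m → ℝ} {v : Fin m}
    (hv : v ∈ argminOn Finset.univ f) : m * f v ≤ ∑ j, f j := by
  have := Finset.card_nsmul_le_sum Finset.univ f (f v)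
    fun j hj => (mem_argminOn.1 hv).2 j hj
  simpa using this

/-! ### The invariant of the reduction and its competitiveness -/

namespace Star

variable {m h : ℕ} {A : OptAlgorithm m} {ρ δ X : ℝ}

/-- The invariant of the reduction, where `X` is the optimum makespan of all jobs. -/
structure StateInvariant (A : OptAlgorithm m) (ρ δ X : ℝ) (st : State m h A.Index) : Prop where
  guesses : GuessInvariant δ X st.guess
  not_failed : ∀ i, ∃ k, ¬ st.failed i k
  view_jobs : ∀ i, ∃ τ, τ <:+ st.jobs ∧ ∀ k, (st.view i k).map Prod.fst = τ
  old : ∀ i k, ∃ old : Fin m → ℝ, (∀ v, old v ≤ δ * st.guess i) ∧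
    ∀ v, load (st.full i k) (st.actual i k v) = old v + load (st.view i k) v
  load_full : ∀ i k j, load (st.full i k) j ≤ (2 + δ) * st.guess i
  run : ∀ i k, ¬ st.failed i k →
    WeakRun A k (st.guess i) (st.view i k) ∧ ∀ v, load (st.view i k) v ≤ ρ * st.guess i
  fail : ∀ i k, st.failed i k → ∃ S₀ p j, S₀ ++ [(p, j)] <+: st.view i k ∧
    WeakRun A k (st.guess i) S₀ ∧ Fails A ρ k (st.guess i) S₀ p

theorem nonempty_index (hm : 0 < m) (hA : IsGood A ρ) : Nonempty A.Index := by
  obtain ⟨k, -⟩ := hA 1 one_pos [] (by simp)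
    ((opt_le_makespan (S := []) rfl).trans (makespan_le hm fun j => by simp))
  exact ⟨k⟩

/-- A guess for which all rules have failed is smaller than the optimum makespan. -/
theorem StateInvariant.guess_lt_of_failed (hm : 0 < m) (hA : IsGood A ρ)
    {σ : List ℝ} (hσ : ∀ p ∈ σ, 0 < p) {st : State m h A.Index}
    (hst : StateInvariant A ρ δ (opt m σ) st) {p : ℝ} (hpre : st.jobs ++ [p] <+: σ) {i : Fin h}
    (hi : ∀ k, failedNow A ρ st p i k) : st.guess i < opt m σ := by
  by_contra hcon
  have hm' : (0 : ℝ) < m := by exact_mod_cast hm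
  obtain ⟨τ, hτ, hview⟩ := hst.view_jobs i
  have hsub : (τ ++ [p]).Sublist σ := (hτ.sublist.append_right [p]).trans hpre.sublist
  have hτpos : ∀ q ∈ τ ++ [p], 0 < q := fun q hq => hσ q (hsub.subset hq)
  have hopt : opt m (τ ++ [p]) ≤ st.guess i :=
    (opt_le_of_sublist hm hsub fun q hq => (hσ q hq).le).trans (not_lt.1 hcon)
  obtain ⟨k, hk⟩ := hA _ (hst.guesses.pos i) _ hτpos hopt
  -- Each reason for failure is excluded: the rule names a machine with small enough load, and the
  -- guess is at least the optimum, hence at least the average load and the job.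
  have hnot : ∀ (S : Schedule m) (q : ℝ), WeakRun A k (st.guess i) S →
      S.map Prod.fst ++ [q] <+: τ ++ [p] → ¬ Fails A ρ k (st.guess i) S q := by
    intro S q hS hq
    obtain ⟨j, hj, hle⟩ := hk S q hS hq
    have hopt' : opt m (S.map Prod.fst ++ [q]) ≤ st.guess i :=
      (opt_le_of_sublist hm hq.sublist fun q hq => (hτpos q hq).le).trans hopt
    have hpos' : ∀ q' ∈ S.map Prod.fst ++ [q], 0 ≤ q' := fun q' h => (hτpos q' (hq.subset h)).le
    rintro (h | ⟨j', hj', hlt⟩ | h | h)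
    · rw [hj] at h
      exact Option.some_ne_none _ h
    · rw [hj] at hj'
      obtain rfl := Option.some_injective _ hj'
      exact absurd hle (not_le.2 hlt)
    · have := sum_le_mul_opt hm (S.map Prod.fst ++ [q])
      rw [List.sum_append, List.sum_singleton] at this
      rw [lt_div_iff₀ hm'] at h
      unfold volume at h
      nlinarith
    · exact absurd ((le_opt_of_mem hm hpos' (by simp)).trans hopt') (not_le.2 h)
  by_cases hfail : st.failed i k
  · obtain ⟨S₀, q, j, hpre', hrun, hfails⟩ := hst.fail i k hfail
    refine hnot S₀ q hrun ?_ hfails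
    have := hpre'.map Prod.fst
    rw [hview k, List.map_append] at this
    exact this.trans (List.prefix_append _ _)
  · refine hnot (st.view i k) p (hst.run i k hfail).1 ?_ ((hi k).resolve_left hfail)
    rw [hview k]

theorem StateInvariant.guesses_step (hm : 0 < m) (hA : IsGood A ρ) (hδ : 0 < δ)
    {σ : List ℝ} (hσ : ∀ p ∈ σ, 0 < p) {st : State m h A.Index}
    (hst : StateInvariant A ρ δ (opt m σ) st) {p : ℝ} (hpre : st.jobs ++ [p] <+: σ)
    (ch : Choices m h A.Index) : GuessInvariant δ (opt m σ) (step A δ ρ ch st p).guess := by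
  have hm' : (0 : ℝ) < m := by exact_mod_cast hm
  by_cases hex : ∃ i, ∀ k, failedNow A ρ st p i k
  · obtain ⟨s, hs, hmax⟩ := Finset.exists_max_image
      (Finset.univ.filter fun i => ∀ k, failedNow A ρ st p i k) st.guess
      (by obtain ⟨i, hi⟩ := hex; exact ⟨i, by simpa using hi⟩)
    simp only [Finset.mem_filter, Finset.mem_univ, true_and] at hs hmax
    have hadj : ∀ i, Adjusted A ρ st p i ↔ st.guess i ≤ st.guess s :=
      fun i => ⟨fun ⟨i', hi', hle⟩ => hle.trans (hmax i' hi'), fun hle => ⟨s, hs, hle⟩⟩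
    refine hst.guesses.adjust hδ (hst.guess_lt_of_failed hm hA hσ hpre hs)
      (B := max p ((st.jobs.sum + p) / m)) (max_le ?_ ?_)
      (fun i hi => if_pos ((hadj i).2 hi)) (fun i hi => if_neg fun h => hi ((hadj i).1 h))
    · exact le_opt_of_mem hm (fun q hq => (hσ q hq).le) (hpre.subset (by simp))
    · rw [div_le_iff₀ hm', mul_comm]
      refine le_trans ?_ (mul_le_mul_of_nonneg_left
        (opt_le_of_sublist hm hpre.sublist fun q hq => (hσ q hq).le) hm'.le)
      have := sum_le_mul_opt hm (st.jobs ++ [p])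
      rwa [List.sum_append, List.sum_singleton] at this
  · have : (step A δ ρ ch st p).guess = st.guess := by
      funext i
      exact if_neg fun ⟨i', hi', _⟩ => hex ⟨i', hi'⟩
    rw [this]
    exact hst.guesses

theorem load_full_step (ch : Choices m h A.Index) (st : State m h A.Index) (p : ℝ) (i : Fin h)
    (k : A.Index) (j : Fin m) : load ((step A δ ρ ch st p).full i k) j =
      load (st.full i k) j + if placeActual A ρ ch st p i k = j then p else 0 :=
  load_concat _ _ _ _

/-- The bounds for a guess that is not adjusted. -/
theorem StateInvariant.le_guess_of_not_adjusted (hm : 0 < m) {st : State m h A.Index}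
    (hst : StateInvariant A ρ δ X st) {p : ℝ} {i : Fin h} (hi : ¬ Adjusted A ρ st p i) :
    (∃ k, ¬ failedNow A ρ st p i k) ∧ p ≤ st.guess i ∧
      ∀ k, ∑ v, load (st.view i k) v + p ≤ m * st.guess i := by
  have hm' : (0 : ℝ) < m := by exact_mod_cast hm
  obtain ⟨k, hk⟩ : ∃ k, ¬ failedNow A ρ st p i k := by
    by_contra hcon
    push Not at hcon
    exact hi ⟨i, hcon, le_rfl⟩
  obtain ⟨τ, -, hview⟩ := hst.view_jobs i
  have hk' := not_or.1 (not_or.1 (not_or.1 (not_or.1 hk).2).2).2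
  refine ⟨⟨k, hk⟩, not_lt.1 hk'.2, fun k' => ?_⟩
  have h := not_lt.1 hk'.1
  rw [div_le_iff₀ hm', mul_comm] at h
  -- All views of a guess contain the same jobs, so the volume test passed by the rule k bounds the
  -- volume for every k'.
  rwa [sum_load, hview, ← hview k]

theorem place_of_not_failedNow (ch : Choices m h A.Index) {st : State m h A.Index} {p : ℝ}
    {i : Fin h} {k : A.Index} (hk : ¬ failedNow A ρ st p i k) :
    A.rule k (st.guess i) (st.view i k) p = some (place A ρ ch st p i k) ∧
      load (st.view i k) (place A ρ ch st p i k) + p ≤ ρ * st.guess i := by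
  have h₁ := not_or.1 (not_or.1 hk).2
  have h₂ := not_or.1 h₁.2
  obtain ⟨j, hj⟩ := Option.ne_none_iff_exists'.1 h₁.1
  have hplace : place A ρ ch st p i k = j := by rw [place, if_neg hk, hj, Option.getD_some]
  rw [hplace]
  exact ⟨hj, not_lt.1 fun hlt => h₂.1 ⟨j, hj, hlt⟩⟩

/-- After a failure, the least loaded machine has load at most the average: guess plus δ·guess for
old jobs, whichever way old jobs are treated; the job adds at most one more guess. Without failure
the bound is ρ+δ ≤ 2+δ times the guess. -/
theorem StateInvariant.load_place_le (hm : 0 < m) (hρ : ρ ≤ 2)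
    {st : State m h A.Index} (hst : StateInvariant A ρ δ X st) {p : ℝ} (ch : Choices m h A.Index)
    {i : Fin h} (hi : ¬ Adjusted A ρ st p i) (hp : 0 ≤ p) (k : A.Index) :
    load (st.full i k) (placeActual A ρ ch st p i k) + p ≤ (2 + δ) * st.guess i := by
  have hm' : (0 : ℝ) < m := by exact_mod_cast hm
  have hne : (Finset.univ : Finset (Fin m)).Nonempty := ⟨⟨0, hm⟩, Finset.mem_univ _⟩
  have hg := hst.guesses.pos i
  obtain ⟨-, hp', hvol⟩ := hst.le_guess_of_not_adjusted hm hi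
  have hvol := hvol k
  obtain ⟨old, hold, hload⟩ := hst.old i k
  rw [placeActual]
  by_cases hk : failedNow A ρ st p i k
  · have hplace : place A ρ ch st p i k = leastLoaded ch st p i k := if_pos hk
    have hmem := ch.tie.pick_mem (st.jobs ++ [p], i, k) _ (argminOn_nonempty (fun v =>
      if ch.ignoreOld then load (st.view i k) v else load (st.full i k) (st.actual i k v)) hne)
    change leastLoaded ch st p i k ∈ _ at hmem
    rw [hplace]
    rcases hb : ch.ignoreOld with _ | _
    · simp only [hb, Bool.false_eq_true, if_false] at hmem
      have h₁ := mul_le_sum_of_mem_argminOn hmem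
      have h₂ : ∑ v, load (st.full i k) (st.actual i k v) ≤
          m * (δ * st.guess i) + ∑ v, load (st.view i k) v := by
        simp only [hload, Finset.sum_add_distrib]
        gcongr
        exact (Finset.sum_le_sum fun v _ => hold v).trans (by simp)
      have h₃ : (m : ℝ) * load (st.full i k) (st.actual i k (leastLoaded ch st p i k)) ≤
          m * (δ * st.guess i + st.guess i) := by linarith
      have := le_of_mul_le_mul_left h₃ hm'
      linarith
    · simp only [hb, if_true] at hmem
      have h₁ := mul_le_sum_of_mem_argminOn hmem
      have h₂ : (m : ℝ) * load (st.view i k) (leastLoaded ch st p i k) ≤ m * st.guess i := by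
        linarith
      have := le_of_mul_le_mul_left h₂ hm'
      rw [hload]
      linarith [hold (leastLoaded ch st p i k)]
  · have h := (place_of_not_failedNow ch hk).2
    rw [hload]
    have := mul_le_mul_of_nonneg_right hρ hg.le
    linarith [hold (place A ρ ch st p i k)]

/-- The second bound turns all present load into negligible old load; it uses 2+δ = δ(1+2/δ) and the
choice of h. -/
theorem le_newGuess (hδ : 0 < δ) {st : State m h A.Index}
    (hst : StateInvariant A ρ δ X st) (hpow : 1 + 2 / δ ≤ (1 + δ) ^ h) (p : ℝ) (i : Fin h) :
    p ≤ newGuess δ st p i ∧ (2 + δ) * st.guess i ≤ δ * newGuess δ st p i := by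
  have hg := hst.guesses.pos i
  set M := max (⨆ i', st.guess i') (max p ((st.jobs.sum + p) / m)) with hM
  have hgM : ∀ i, st.guess i ≤ M := fun i => (le_iSup_guess st.guess i).trans (le_max_left _ _)
  have hM0 : 0 < M := hg.trans_le (hgM i)
  have hnew : newGuess δ st p i = (1 + δ) ^ guessRank st.guess i * M := rfl
  constructor
  · rw [hnew]
    have h₁ : p ≤ M := (le_max_left _ _).trans (le_max_right _ _)
    have := mul_le_pow_guessRank_mul st.guess hδ hM0.le i
    nlinarith
  · rw [hnew]
    have h₁ := hst.guesses.pow_mul_le_adjusted hδ hgM i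
    calc (2 + δ) * st.guess i = δ * ((1 + 2 / δ) * st.guess i) := by
          field_simp
          ring
      _ ≤ δ * ((1 + δ) ^ h * st.guess i) := by gcongr
      _ ≤ _ := by gcongr

theorem StateInvariant.step (hm : 0 < m) (hA : IsGood A ρ) (hδ : 0 < δ) (hρ1 : 1 ≤ ρ)
    (hρ2 : ρ ≤ 2) (hpow : 1 + 2 / δ ≤ (1 + δ) ^ h)
    {σ : List ℝ} (hσ : ∀ p ∈ σ, 0 < p) {st : State m h A.Index}
    (hst : StateInvariant A ρ δ (opt m σ) st) {p : ℝ} (hpre : st.jobs ++ [p] <+: σ)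
    (ch : Choices m h A.Index) : StateInvariant A ρ δ (opt m σ) (step A δ ρ ch st p) := by
  have hguess := hst.guesses_step hm hA hδ hσ hpre ch
  have hp : 0 < p := hσ p (hpre.subset (by simp))
  obtain ⟨k₀⟩ := nonempty_index hm hA
  have hview_adj : ∀ i k, Adjusted A ρ st p i → (Star.step A δ ρ ch st p).view i k =
    [(p, firstPlace A δ ρ ch st p i k)] := fun i k hi => if_pos hi
  have hview_keep : ∀ i k, ¬ Adjusted A ρ st p i → (Star.step A δ ρ ch st p).view i k =
    st.view i k ++ [(p, place A ρ ch st p i k)] := fun i k hi => if_neg hi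
  have hguess_adj : ∀ i, Adjusted A ρ st p i → (Star.step A δ ρ ch st p).guess i =
    newGuess δ st p i := fun i hi => if_pos hi
  have hguess_keep : ∀ i, ¬ Adjusted A ρ st p i → (Star.step A δ ρ ch st p).guess i =
    st.guess i := fun i hi => if_neg hi
  refine ⟨hguess, fun i => ?_, fun i => ?_, fun i k => ?_, fun i k j => ?_, fun i k hk => ?_,
    fun i k hk => ?_⟩
  · by_cases hi : Adjusted A ρ st p i
    · exact ⟨k₀, fun hf => hf.1 hi⟩
    · obtain ⟨⟨k, hk⟩, -⟩ := hst.le_guess_of_not_adjusted hm hi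
      exact ⟨k, fun hf => hk hf.2⟩
  · by_cases hi : Adjusted A ρ st p i
    · refine ⟨[p], List.suffix_append _ _, fun k => ?_⟩
      rw [hview_adj i k hi]
      rfl
    · obtain ⟨τ, ⟨R, hR⟩, hview⟩ := hst.view_jobs i
      refine ⟨τ ++ [p], ⟨R, ?_⟩, fun k => ?_⟩
      · rw [← List.append_assoc, hR]
        rfl
      · rw [hview_keep i k hi, List.map_append, hview k]
        rfl
  · by_cases hi : Adjusted A ρ st p i
    · have hactual : (Star.step A δ ρ ch st p).actual i k = ch.renumber (st.jobs ++ [p]) i k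
          (firstPlace A δ ρ ch st p i k) (placeActual A ρ ch st p i k) := if_pos hi
      have hspec := ch.renumber_spec (st.jobs ++ [p]) i k
          (firstPlace A δ ρ ch st p i k) (placeActual A ρ ch st p i k)
      rw [← hactual] at hspec
      -- At an adjustment everything before p becomes old. The renumbering makes the actual machine
      -- of p agree with its place in the new view.
      refine ⟨fun v => load (st.full i k) ((Star.step A δ ρ ch st p).actual i k v),
        fun v => ?_, fun v => ?_⟩
      · rw [hguess_adj i hi]
        exact (hst.load_full i k _).trans (le_newGuess hδ hst hpow p i).2
      · rw [load_full_step, hview_adj i k hi, ← List.nil_append [(p, _)], load_concat, load_nil,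
          zero_add]
        have hiff : placeActual A ρ ch st p i k = (Star.step A δ ρ ch st p).actual i k v ↔
            firstPlace A δ ρ ch st p i k = v := by
          rw [← hspec]
          exact EmbeddingLike.apply_eq_iff_eq _
        simp only [hiff]
    · obtain ⟨old, hold, hload⟩ := hst.old i k
      have hactual : (Star.step A δ ρ ch st p).actual i k = st.actual i k := if_neg hi
      refine ⟨old, fun v => ?_, fun v => ?_⟩
      · rw [hguess_keep i hi]
        exact hold v
      · rw [hactual, load_full_step, hload, hview_keep i k hi, load_concat, placeActual, add_assoc]
        simp only [EmbeddingLike.apply_eq_iff_eq]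
  · rw [load_full_step]
    by_cases hi : Adjusted A ρ st p i
    · rw [hguess_adj i hi]
      obtain ⟨h₁, h₂⟩ := le_newGuess hδ hst hpow p i
      have h₃ := hst.load_full i k j
      split_ifs <;> linarith
    · rw [hguess_keep i hi]
      by_cases hj : placeActual A ρ ch st p i k = j
      · rw [if_pos hj, ← hj]
        exact hst.load_place_le hm hρ2 ch hi hp.le k
      · rw [if_neg hj, add_zero]
        exact hst.load_full i k j
  · by_cases hi : Adjusted A ρ st p i
    · rw [hguess_adj i hi, hview_adj i k hi, ← List.nil_append [(p, _)]]
      refine ⟨WeakRun.nil.concat fun j' hj' => ?_, fun v => ?_⟩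
      · rw [firstPlace, hj', Option.getD_some]
      · rw [load_concat, load_nil, zero_add]
        have h₁ := (le_newGuess hδ hst hpow p i).1
        split_ifs <;> nlinarith
    · have hk' : ¬ failedNow A ρ st p i k := fun hf => hk ⟨hi, hf⟩
      obtain ⟨hrun, hload⟩ := hst.run i k fun hf => hk' (Or.inl hf)
      obtain ⟨hplace, hle⟩ := place_of_not_failedNow ch hk'
      rw [hguess_keep i hi, hview_keep i k hi]
      refine ⟨hrun.concat fun j' hj' => ?_, fun v => ?_⟩
      · rw [hplace] at hj'
        exact (Option.some_injective _ hj').symm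
      · rw [load_concat]
        by_cases hv : place A ρ ch st p i k = v
        · rw [if_pos hv, ← hv]
          exact hle
        · rw [if_neg hv, add_zero]
          exact hload v
  · obtain ⟨hi, hk⟩ := hk
    rw [hguess_keep i hi, hview_keep i k hi]
    by_cases hf : st.failed i k
    · obtain ⟨S₀, q, j, hpre', h⟩ := hst.fail i k hf
      exact ⟨S₀, q, j, hpre'.trans (List.prefix_append _ _), h⟩
    · exact ⟨st.view i k, p, _, List.prefix_refl _, (hst.run i k hf).1, hk.resolve_left hf⟩

theorem stateInvariant_init (hm : 0 < m) (hA : IsGood A ρ) (hδ : 0 < δ) (hρ1 : 1 ≤ ρ)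
    (hh : 0 < h) {p : ℝ} (hp : 0 < p) (hpX : p ≤ X) :
    StateInvariant A ρ δ X (init m h A.Index δ p) := by
  obtain ⟨k₀⟩ := nonempty_index hm hA
  have hg := guessInvariant_init hδ hh hp hpX
  have hpos : ∀ i : Fin h, 0 < p * (1 + δ) ^ (i : ℕ) := hg.pos
  refine ⟨hg, fun i => ⟨k₀, fun hf => hf⟩, fun i => ⟨[], List.suffix_refl _, fun k => rfl⟩,
    fun i k => ⟨fun _ => 0, fun v => (mul_pos hδ (hpos i)).le, fun v => ?_⟩, fun i k j => ?_,
    fun i k _ => ⟨WeakRun.nil, fun v => ?_⟩, fun i k hf => hf.elim⟩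
  · simp [init]
  · have := hpos i
    simp only [init, load_nil]
    positivity
  · have := hpos i
    simp only [init, load_nil]
    positivity

/-- Executing a good algorithm for known optimum makespan. -/
theorem isCompetitive_algorithm (hm : 0 < m) (hA : IsGood A ρ) (hδ : 0 < δ) (hρ1 : 1 ≤ ρ)
    (hρ2 : ρ ≤ 2) (hh : 0 < h) (hpow : 1 + 2 / δ ≤ (1 + δ) ^ h) (ch : Choices m h A.Index) :
    (algorithm A ρ δ h ch).IsCompetitive ((ρ + δ) * (1 + δ)) := by
  intro σ hσ
  have hfin := (algorithm A ρ δ h ch).finite_index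
  obtain ⟨k₀⟩ := nonempty_index hm hA
  have hne : Nonempty (algorithm A ρ δ h ch).Index := ⟨(⟨0, hh⟩, k₀)⟩
  obtain ⟨k, hk⟩ := Finite.exists_min fun k => makespan ((algorithm A ρ δ h ch).schedule k σ)
  refine ⟨k, hk, ?_⟩
  suffices hex : ∃ k', makespan ((algorithm A ρ δ h ch).schedule k' σ) ≤
      (ρ + δ) * (1 + δ) * opt m σ by
    obtain ⟨k', hk'⟩ := hex
    exact (hk k').trans hk'
  rcases σ with _ | ⟨p₁, σ'⟩
  · refine ⟨k, ?_⟩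
    obtain ⟨S, hS, hopt⟩ := exists_makespan_eq_opt hm []
    obtain rfl := List.map_eq_nil_iff.1 hS
    rw [← hopt, Algorithm.schedule_nil]
    have h0 : makespan ([] : Schedule m) = 0 := by simp [makespan]
    rw [h0, mul_zero]
  set σ := p₁ :: σ' with hσ_def
  have hp₁ : 0 < p₁ := hσ p₁ (by simp [hσ_def])
  have hp₁X : p₁ ≤ opt m σ :=
    le_opt_of_mem hm (fun q hq => (hσ q hq).le) (by simp [hσ_def])
  let st : List ℝ → State m h A.Index := fun L => L.foldl (step A δ ρ ch) (init m h A.Index δ p₁)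
  have key : ∀ L : List ℝ, L <+: σ → (st L).jobs = L ∧ StateInvariant A ρ δ (opt m σ) (st L) ∧
      ∀ i k, (st L).full i k = (algorithm A ρ δ h ch).schedule (i, k) L := by
    intro L
    induction L using List.reverseRecOn with
    | nil =>
      exact fun _ => ⟨rfl, stateInvariant_init hm hA hδ hρ1 hh hp₁ hp₁X, fun _ _ => rfl⟩
    | append_singleton L p ih =>
      intro hL
      obtain ⟨hjobs, hinv, hfull⟩ := ih ((List.prefix_append _ _).trans hL)
      have hst : st (L ++ [p]) = step A δ ρ ch (st L) p := by
        simp only [st, List.foldl_append, List.foldl_cons, List.foldl_nil]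
      have hjobs' : (st (L ++ [p])).jobs = L ++ [p] := by
        rw [hst]
        change (st L).jobs ++ [p] = _
        rw [hjobs]
      refine ⟨hjobs', ?_, fun i k => ?_⟩
      · rw [hst]
        exact hinv.step hm hA hδ hρ1 hρ2 hpow hσ (by rwa [hjobs]) ch
      -- The algorithm reads the first job off `past ++ [p]`, so its initial guesses are the same at
      -- every step.
      · have hhead : (L ++ [p]).headD 0 = p₁ := by
          obtain ⟨R, hR⟩ := hL
          have : ((L ++ [p]) ++ R).headD 0 = p₁ := by rw [hR, hσ_def]; rfl
          rcases L with _ | ⟨x, L⟩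
          · simpa using this
          · simpa using this
        rw [hst]
        refine (congrArg₂ (· ++ ·) (hfull i k) ?_).trans
          ((algorithm A ρ δ h ch).schedule_concat (i, k) L p).symm
        change [(p, placeActual A ρ ch (st L) p i k)] =
          [(p, placeActual A ρ ch (L.foldl (step A δ ρ ch)
            (init m h A.Index δ ((L ++ [p]).headD 0))) p i k)]
        rw [hhead]
  obtain ⟨-, hinv, hfull⟩ := key σ (List.prefix_refl _)
  obtain ⟨i, hi⟩ := hinv.guesses.exists_le
  obtain ⟨k', hk'⟩ := hinv.not_failed i
  obtain ⟨old, hold, hload⟩ := hinv.old i k'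
  refine ⟨(i, k'), makespan_le hm fun j => ?_⟩
  rw [← hfull]
  obtain ⟨v, rfl⟩ := ((st σ).actual i k').surjective j
  rw [hload]
  have h₁ := (hinv.run i k' hk').2 v
  have h₂ := mul_le_mul_of_nonneg_left hi (show 0 ≤ ρ + δ by linarith)
  linarith [hold v]

end Star

/-! ### Competitiveness -/

theorem Algorithm.IsCompetitive.mono {m : ℕ} (hm : 0 < m) {A : Algorithm m} {ρ ρ' : ℝ}
    (hA : A.IsCompetitive ρ) (h : ρ ≤ ρ') : A.IsCompetitive ρ' := by
  intro σ hσ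
  obtain ⟨k, hk, hle⟩ := hA σ hσ
  refine ⟨k, hk, hle.trans (mul_le_mul_of_nonneg_right h ?_)⟩
  obtain ⟨S, rfl, hS⟩ := exists_makespan_eq_opt hm σ
  rw [← hS]
  exact (load_nonneg (fun q hq => (hσ q hq).le) ⟨0, hm⟩).trans (load_le_makespan S _)

theorem le_pow_numGuesses {ρ ε : ℝ} (hρ : 0 < ρ) (hε : 0 < ε) :
    1 + 6 * ρ / ε ≤ (1 + ε / (3 * ρ)) ^ Star.numGuesses ρ ε := by
  have hδ : 0 < ε / (3 * ρ) := by positivity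
  have hlog : 0 < Real.log (1 + ε / (3 * ρ)) := Real.log_pos (by linarith)
  have h : Real.log (1 + 6 * ρ / ε) / Real.log (1 + ε / (3 * ρ)) ≤ Star.numGuesses ρ ε :=
    Nat.le_ceil _
  rw [div_le_iff₀ hlog, ← Real.log_pow] at h
  exact (Real.log_le_log_iff (by positivity) (by positivity)).1 h

theorem isCompetitive_A3Star {ε : ℝ} (hε : 0 < ε) (hε' : ε ≤ 1) {m : ℕ} (hm : 0 < m)
    (ch : A3StarChoices m ε) : (A3Star m ε ch).IsCompetitive (4 / 3 + ε) := by
  have hA := isGood_A3 hm (show 0 < ε / 2 by linarith) (by linarith) ch.inner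
  have hδ : 0 < ε / 2 / (3 * (4 / 3 + ε / 2)) := by positivity
  have hpow := le_pow_numGuesses (show 0 < 4 / 3 + ε / 2 by linarith) (show 0 < ε / 2 by linarith)
  have hh : 0 < Star.numGuesses (4 / 3 + ε / 2) (ε / 2) := by
    refine Nat.pos_of_ne_zero fun h => ?_
    rw [h, pow_zero] at hpow
    have : 0 < 6 * (4 / 3 + ε / 2) / (ε / 2) := by positivity
    linarith
  have hmul : ε / 2 / (3 * (4 / 3 + ε / 2)) * (4 / 3 + ε / 2) = ε / 6 := by
    field_simp
    ring
  have hpow' : 1 + 2 / (ε / 2 / (3 * (4 / 3 + ε / 2))) = 1 + 6 * (4 / 3 + ε / 2) / (ε / 2) := by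
    field_simp
    ring
  refine (Star.isCompetitive_algorithm hm hA hδ (by linarith) (by linarith) hh
    (hpow'.trans_le hpow) ch.outer).mono hm ?_
  set δ := ε / 2 / (3 * (4 / 3 + ε / 2))
  -- In (ρ+δ)(1+δ) = ρ + ρδ + δ + δ² one has ρδ = ε/6, so the excess over ρ is below ε/2.
  have h₁ : δ ≤ ε / 8 := by nlinarith
  nlinarith

/-! ### The number of schedules -/

/-- Here δ = ε/(8+3ε) ≥ ε/11 and log(1+δ) ≥ δ/(1+δ) ≥ ε/22, while the numerator is at most (16+6ε)/ε
≤ 22/ε. -/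
theorem numGuesses_le {ε : ℝ} (hε : 0 < ε) (hε' : ε ≤ 1) :
    (Star.numGuesses (4 / 3 + ε / 2) (ε / 2) : ℝ) ≤ 485 * (1 / ε) ^ 3 := by
  have hE : 1 ≤ 1 / ε := (one_le_div hε).2 hε'
  have hδ : ε / 11 ≤ ε / 2 / (3 * (4 / 3 + ε / 2)) := by
    rw [div_le_div_iff₀ (by norm_num) (by positivity)]
    nlinarith
  have hδ' : ε / 2 / (3 * (4 / 3 + ε / 2)) ≤ 1 := by
    rw [div_le_one (by positivity)]
    linarith
  have hδ0 : 0 < ε / 2 / (3 * (4 / 3 + ε / 2)) := by positivity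
  have hlog : ε / 22 ≤ Real.log (1 + ε / 2 / (3 * (4 / 3 + ε / 2))) := by
    refine le_trans ?_ (Real.one_sub_inv_le_log_of_pos (by positivity))
    set δ := ε / 2 / (3 * (4 / 3 + ε / 2))
    have h₁ : 1 - (1 + δ)⁻¹ = δ / (1 + δ) := by
      field_simp
      ring
    rw [h₁, le_div_iff₀ (by positivity)]
    nlinarith
  have hlog' : Real.log (1 + 6 * (4 / 3 + ε / 2) / (ε / 2)) ≤ 22 * (1 / ε) := by
    have h₁ := Real.log_le_sub_one_of_pos (show 0 < 1 + 6 * (4 / 3 + ε / 2) / (ε / 2) by positivity)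
    refine h₁.trans ?_
    rw [add_sub_cancel_left, mul_one_div, div_le_div_iff₀ (by positivity) hε]
    nlinarith
  have h₁ : Real.log (1 + 6 * (4 / 3 + ε / 2) / (ε / 2)) /
      Real.log (1 + ε / 2 / (3 * (4 / 3 + ε / 2))) ≤ 484 * (1 / ε) ^ 2 := by
    rw [div_le_iff₀ (lt_of_lt_of_le (by positivity) hlog)]
    refine hlog'.trans ?_
    calc 22 * (1 / ε) = 484 * (1 / ε) ^ 2 * (ε / 22) := by
          field_simp
          norm_num
      _ ≤ _ := by gcongr
  have h₂ : (Star.numGuesses (4 / 3 + ε / 2) (ε / 2) : ℝ) < _ + 1 :=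
    Nat.ceil_lt_add_one (div_nonneg
      (Real.log_nonneg (le_add_of_nonneg_right (by positivity)))
      (Real.log_nonneg (le_add_of_nonneg_right hδ0.le)))
  have h₃ : (1 / ε) ^ 2 ≤ (1 / ε) ^ 3 := pow_le_pow_right₀ hE (by norm_num)
  have h₄ : 1 ≤ (1 / ε) ^ 3 := one_le_pow₀ hE
  linarith

/-- With ε' = ε/16 the argument of the logarithm is 3/8 + 1/(3ε) ≤ 1/ε; the factor 2 comes from log
2 ≥ 1/2. -/
theorem A2.l_le {ε : ℝ} (hε : 0 < ε) (hε' : ε ≤ 1) :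
    (A2.l (ε / 2) : ℝ) ≤ 2 * Real.log (1 / ε) + 3 := by
  have hE : 1 ≤ 1 / ε := (one_le_div hε).2 hε'
  have hL : 0 ≤ Real.log (1 / ε) := Real.log_nonneg hE
  have h₁ : Real.logb 2 (3 / 8 + 1 / (48 * A2.eps' (ε / 2))) ≤ 2 * Real.log (1 / ε) := by
    have h₂ : 3 / 8 + 1 / (48 * A2.eps' (ε / 2)) ≤ 1 / ε := by
      have : 1 / (48 * A2.eps' (ε / 2)) = 1 / 3 * (1 / ε) := by
        unfold A2.eps'
        field_simp
        norm_num
      rw [this]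
      linarith
    have hpos : 0 < A2.eps' (ε / 2) := by unfold A2.eps'; linarith
    have hlog2 : 1 / 2 ≤ Real.log 2 := by linarith [Real.log_two_gt_d9]
    rw [Real.logb, div_le_iff₀ (by linarith)]
    refine (Real.log_le_log (by positivity) h₂).trans ?_
    nlinarith
  have h₂ : A2.lam (ε / 2) ≤ ⌈2 * Real.log (1 / ε)⌉₊ := Nat.ceil_le_ceil h₁
  have h₃ := Nat.ceil_lt_add_one (show 0 ≤ 2 * Real.log (1 / ε) by linarith)
  have h₄ : (A2.lam (ε / 2) : ℝ) ≤ ⌈2 * Real.log (1 / ε)⌉₊ := by exact_mod_cast h₂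
  unfold A2.l
  push_cast
  linarith

theorem A2.l_le_mul {ε : ℝ} (hε : 0 < ε) (hε' : ε ≤ 1) : (A2.l (ε / 2) : ℝ) ≤ 5 * (1 / ε) := by
  have hE : 1 ≤ 1 / ε := (one_le_div hε).2 hε'
  have h₁ := A2.l_le hε hε'
  have h₂ := Real.log_le_sub_one_of_pos (show 0 < 1 / ε by positivity)
  linarith

theorem A2.kappa_add_one_le {ε : ℝ} (hε : 0 < ε) (hε' : ε ≤ 1) :
    (A2.kappa (ε / 2) : ℝ) + 1 ≤ 362 * (1 / ε) ^ 3 := by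
  have hE : 1 ≤ 1 / ε := (one_le_div hε).2 hε'
  have hl := A2.l_le_mul hε hε'
  have hl2 : (2 : ℝ) ≤ A2.l (ε / 2) := by exact_mod_cast A2.two_le_l _
  have hd : 1 / A2.eps' (ε / 2) = 16 * (1 / ε) := by
    unfold A2.eps'
    field_simp
    norm_num
  have h₁ : (A2.kappa (ε / 2) : ℝ) <
      2 * (2 + 1 / A2.eps' (ε / 2)) * (2 * A2.l (ε / 2) - 1) + 1 := by
    refine Nat.ceil_lt_add_one (mul_nonneg ?_ (by linarith))
    rw [hd]
    positivity
  rw [hd] at h₁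
  have h₂ : 2 * (2 + 16 * (1 / ε)) * (2 * A2.l (ε / 2) - 1) ≤
      2 * (18 * (1 / ε)) * (10 * (1 / ε)) :=
    mul_le_mul (by linarith) (by linarith) (by linarith) (by positivity)
  have h₃ : (1 / ε) ^ 2 ≤ (1 / ε) ^ 3 := pow_le_pow_right₀ hE (by norm_num)
  have h₄ : 1 ≤ (1 / ε) ^ 3 := one_le_pow₀ hE
  nlinarith

theorem card_index_A1_le {m : ℕ} (ch : A1.Choices m (1 / 3)) {x : ℝ} (hx : 6 * (m : ℝ) + 1 ≤ x) :
    (Nat.card (A1 m (1 / 3) ch).Index : ℝ) ≤ x ^ A1.l (1 / 3) := by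
  have h₁ : Nat.card (A1 m (1 / 3) ch).Index =
      (⌊(m : ℝ) / A1.eps' (1 / 3)⌋₊ + 1) ^ A1.l (1 / 3) := by
    change Nat.card (A1.V m (1 / 3)) = _
    simp [A1.V]
  rw [h₁]
  push_cast
  refine pow_le_pow_left₀ (by positivity) (le_trans ?_ hx) _
  have h₂ : (m : ℝ) / A1.eps' (1 / 3) = 6 * m := by
    unfold A1.eps'
    ring
  rw [h₂]
  have := Nat.floor_le (show (0 : ℝ) ≤ 6 * m by positivity)
  linarith

theorem card_index_A2_le {m : ℕ} {ε : ℝ} (tie : TieBreak m (A2.C m ε × ℝ × Schedule m × ℝ)) :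
    Nat.card (A2 m ε tie).Index ≤ (A2.kappa ε + 1) ^ (2 * A2.l ε - 1) := by
  change Nat.card (Set.range (A2.config m ε)) ≤ _
  refine (Finite.card_range_le _).trans ?_
  simp [A2.U]

/-- The number of rules of `A₃(ε/2)`. -/
theorem card_index_A3_le {m : ℕ} {ε : ℝ} (hε : 0 < ε) (hε' : ε ≤ 1) (ch : A3Choices m (ε / 2)) :
    ∃ N : ℕ, (N : ℝ) ≤ 4 * Real.log (1 / ε) + 5 + A1.l (1 / 3) ∧
      (Nat.card (A3 m (ε / 2) ch).Index : ℝ) ≤ (15361 * (1 / ε) ^ 3) ^ N := by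
  have hE : 1 ≤ 1 / ε := (one_le_div hε).2 hε'
  have hL : 0 ≤ Real.log (1 / ε) := Real.log_nonneg hE
  have hl := A2.l_le hε hε'
  have h1 : 1 ≤ (1 / ε) ^ 3 := one_le_pow₀ hE
  unfold A3
  split_ifs with h
  · refine ⟨A1.l (1 / 3), by linarith, card_index_A1_le ch.one ?_⟩
    have h₁ : 2 * (A2.l (ε / 2) : ℝ) / A2.eps' (ε / 2) ^ 2 = 512 * A2.l (ε / 2) * (1 / ε) ^ 2 := by
      unfold A2.eps'
      field_simp
      ring
    rw [h₁] at h
    -- So m < 2560(1/ε)³, and 6m + 1 is at most 15361(1/ε)³; this is the source of the constant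
    -- 15361.
    have h₂ : 512 * A2.l (ε / 2) * (1 / ε) ^ 2 ≤ 512 * (5 * (1 / ε)) * (1 / ε) ^ 2 := by
      gcongr
      exact A2.l_le_mul hε hε'
    have h₃ : 512 * (5 * (1 / ε)) * (1 / ε) ^ 2 = 2560 * (1 / ε) ^ 3 := by ring
    linarith
  · refine ⟨2 * A2.l (ε / 2) - 1, ?_, ?_⟩
    · have h2 := A2.two_le_l (ε / 2)
      rw [Nat.cast_sub (by omega)]
      push_cast
      linarith [Nat.cast_nonneg (α := ℝ) (A1.l (1 / 3))]
    · have h₁ : (Nat.card (A2 m (ε / 2) ch.two).Index : ℝ) ≤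
          ((A2.kappa (ε / 2) : ℝ) + 1) ^ (2 * A2.l (ε / 2) - 1) := by
        exact_mod_cast card_index_A2_le ch.two
      refine h₁.trans (pow_le_pow_left₀ (by positivity) ?_ _)
      have := A2.kappa_add_one_le hε hε'
      linarith

theorem numSchedules_A3Star_le {ε : ℝ} (hε : 0 < ε) (hε' : ε ≤ 1) {m : ℕ}
    (ch : A3StarChoices m ε) :
    ((A3Star m ε ch).numSchedules : ℝ) ≤
      Real.exp (2 * ((Real.log 15361 + 3) * (6 + A1.l (1 / 3)))) *
        (1 / ε) ^ (2 * ((Real.log 15361 + 3) * (6 + A1.l (1 / 3))) * Real.log (1 / ε)) := by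
  have hE : 1 ≤ 1 / ε := (one_le_div hε).2 hε'
  have hE0 : 0 < 1 / ε := by positivity
  have hL : 0 ≤ Real.log (1 / ε) := Real.log_nonneg hE
  have h1 : 1 ≤ (1 / ε) ^ 3 := one_le_pow₀ hE
  have ha : 0 ≤ Real.log 15361 := Real.log_nonneg (by norm_num)
  obtain ⟨N, hN, hcard⟩ := card_index_A3_le hε hε' ch.inner
  have hnum : (A3Star m ε ch).numSchedules =
      Star.numGuesses (4 / 3 + ε / 2) (ε / 2) * Nat.card (A3 m (ε / 2) ch.inner).Index := by
    change Nat.card (Fin (Star.numGuesses (4 / 3 + ε / 2) (ε / 2)) ×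
      (A3 m (ε / 2) ch.inner).Index) = _
    rw [Nat.card_prod, Nat.card_fin]
  have hle : ((A3Star m ε ch).numSchedules : ℝ) ≤ (15361 * (1 / ε) ^ 3) ^ (N + 1) := by
    rw [hnum, pow_succ', Nat.cast_mul]
    refine mul_le_mul ((numGuesses_le hε hε').trans (by linarith)) hcard (Nat.cast_nonneg _)
      (by positivity)
  refine hle.trans ?_
  have hexp : (15361 * (1 / ε) ^ 3) ^ (N + 1) =
      Real.exp ((N + 1 : ℕ) * (Real.log 15361 + 3 * Real.log (1 / ε))) := by
    rw [Real.exp_nat_mul, Real.exp_add, Real.exp_log (by norm_num),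
      show (3 : ℝ) = (3 : ℕ) by norm_num, Real.exp_nat_mul, Real.exp_log hE0]
  rw [hexp, Real.rpow_def_of_pos hE0, ← Real.exp_add]
  refine Real.exp_le_exp.2 ?_
  push_cast
  set L := Real.log (1 / ε)
  set α := Real.log 15361
  have hc : (0 : ℝ) ≤ A1.l (1 / 3) := Nat.cast_nonneg _
  set c : ℝ := ((A1.l (1 / 3) : ℕ) : ℝ)
  -- The exponent is quadratic in L = log(1/ε). The linear term is absorbed by (1+L)² ≤ 2 + 2L²,
  -- whose constant part gives K and whose square part gives (1/ε)^(C L).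
  calc ((N : ℝ) + 1) * (α + 3 * L) ≤ ((6 + c) * (1 + L)) * ((α + 3) * (1 + L)) := by
        refine mul_le_mul ?_ ?_ (by positivity) (by positivity)
        · nlinarith
        · nlinarith
    _ = (α + 3) * (6 + c) * (1 + L) ^ 2 := by ring
    _ ≤ (α + 3) * (6 + c) * (2 + 2 * L ^ 2) := by
        refine mul_le_mul_of_nonneg_left ?_ (by positivity)
        nlinarith [sq_nonneg (1 - L)]
    _ = _ := by ring

end MPS

end

/-- For every `0 < ε ≤ 1`, every number `m ≥ 1` of machines and every way to resolve the free choices,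
`A₃*(ε)` is `(4/3 + ε)`-competitive; and it uses at most `(1/ε) ^ O(log (1/ε))` schedules, uniformly in
the number of machines. The factor `K` accounts for `ε` close to `1`, where `log (1/ε)` tends to `0`. -/
theorem corollary2 :
    (∀ ε : ℝ, 0 < ε → ε ≤ 1 → ∀ m : ℕ, 0 < m → ∀ ch : MPS.A3StarChoices m ε,
      (MPS.A3Star m ε ch).IsCompetitive (4 / 3 + ε)) ∧
    ∃ C K : ℝ, 0 < C ∧ 0 < K ∧
      ∀ ε : ℝ, 0 < ε → ε ≤ 1 → ∀ m : ℕ, 0 < m → ∀ ch : MPS.A3StarChoices m ε,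
        ((MPS.A3Star m ε ch).numSchedules : ℝ) ≤ K * (1 / ε) ^ (C * Real.log (1 / ε)) := by
  refine ⟨fun ε hε hε' m hm ch => MPS.isCompetitive_A3Star hε hε' hm ch, _, _, ?_,
    Real.exp_pos _, fun ε hε hε' m _ ch => MPS.numSchedules_A3Star_le hε hε' ch⟩
  have : 0 ≤ Real.log 15361 := Real.log_nonneg (by norm_num)
  positivity
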